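/- For a graph $G=(V,E)$, a set $F\subseteq V$ is a $VCP_3$ set if every path on three vertices in $G$ contains at least one vertex of $F$. An instance of Constrained Connected $VCP_3$ (Constrained $CVCP_3$) consists of a graph $G=(V,E)$, a nonempty set $S\subseteq V$ and an integer $k\ge 0$; the question is whether there is a $VCP_3$ set $F$ of $G$ with $|F|\le k$ and $S\subseteq F$ such that the induced subgraph $G[F]$ is connected. **Theorem.** There is a randomized algorithm which, given an $n$-vertex graph $G$ together with a rooted tree decomposition of $G$ of width $p$ with $m$ nodes, a nonempty set $S\subseteq V$ and an integer $k\ge 0$, always halts within $$O\bigl(4^{p}\cdot (p+1)\cdot n^{6}+(p+1)\,m\bigr)$$ time (thus within $O(4^p\cdot p\, n^6)$ time if $p\ge 1$ and $m=O(n^6)$) and answers YES or NO so that: if the answer to the instance is NO, the algorithm never answers YES (no false positives); if the answer to the instance is YES, the algorithm answers NO with probability at most $1/2$ (false negatives). Here time is the number of steps of a word RAM with fair random bits and words of $O(p+\log(n+m+k))$ bits, and the implied constants are absolute. -/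

import Mathlib

/-! ### Graph notions -/

/-- `F` is a vertex cover `P_t` (a `VCP_t` set) of `G`: every path of order `t` in `G`
contains at least one vertex of `F`. -/
def IsVCP {V : Type*} (G : SimpleGraph V) (t : ℕ) (F : Finset V) : Prop :=
  ∀ (u v : V) (q : G.Walk u v), q.IsPath → q.support.length = t → ∃ x ∈ q.support, x ∈ F

/-- `F` is a solution of the instance `(G, S, k)` of Constrained Connected Vertex Cover `P_3`. -/
def IsConstrainedCVCP3Solution {V : Type*} (G : SimpleGraph V) (S : Finset V) (k : ℕ)
    (F : Finset V) : Prop :=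
  IsVCP G 3 F ∧ F.card ≤ k ∧ S ⊆ F ∧ (G.induce (F : Set V)).Connected

/-- A tree decomposition of `G` whose underlying rooted tree has node set `Fin m`. -/
structure TreeDecomposition {V : Type*} [DecidableEq V] (G : SimpleGraph V) (m : ℕ) where
  /-- the tree -/
  tree : SimpleGraph (Fin m)
  isTree : tree.IsTree
  /-- the root of the tree -/
  root : Fin m
  /-- the bags -/
  bag : Fin m → Finset V
  mem_bag : ∀ v : V, ∃ i, v ∈ bag i
  adj_bag : ∀ u v : V, G.Adj u v → ∃ i, u ∈ bag i ∧ v ∈ bag i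
  inter_subset_bag : ∀ (i j k : Fin m) (q : tree.Walk i k), q.IsPath → j ∈ q.support →
    bag i ∩ bag k ⊆ bag j

namespace TreeDecomposition

variable {V : Type*} [DecidableEq V] {G : SimpleGraph V} {m : ℕ}

/-- The width: the maximum size of a bag, minus one.  (As soon as `V` is nonempty, some bag is
nonempty, so that the subtraction is the one in the integers.) -/
def width (D : TreeDecomposition G m) : ℕ :=
  (Finset.univ.sup fun i => (D.bag i).card) - 1

/-- The parent of a node: the second node on the path from it to the root.  The root is its own
parent. -/
noncomputable def parent (D : TreeDecomposition G m) (i : Fin m) : Fin m :=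
  (D.isTree.existsUnique_path i D.root).exists.choose.snd

end TreeDecomposition

/-! ### A randomized word RAM

The machine has registers and a random access memory, both holding words of `w` bits, and a
source of fair random bits.  Its programs are structured programs over the usual word RAM
instructions; every executed instruction and every evaluated test costs one time unit. -/

namespace WordRAM

/-- Binary word operations. -/
inductive BinOp where
  | add | sub | mul | div | mod | and | or | xor | eq | lt

/-- The value of an operation: subtraction is truncated at `0`, division by `0` gives `0`, and
the bitwise operations act on binary representations; `eq` and `lt` give `1` for true and `0`
for false. -/
def BinOp.eval : BinOp → ℕ → ℕ → ℕ
  | .add, a, b => a + b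
  | .sub, a, b => a - b
  | .mul, a, b => a * b
  | .div, a, b => a / b
  | .mod, a, b => a % b
  | .and, a, b => a &&& b
  | .or, a, b => a ||| b
  | .xor, a, b => a ^^^ b
  | .eq, a, b => if a = b then 1 else 0
  | .lt, a, b => if a < b then 1 else 0

/-- Programs.  A program is a finite object, fixed once and for all inputs, and mentions only
finitely many registers. -/
inductive Program where
  /-- no operation -/
  | skip
  /-- `R[x] := c` -/
  | const (x c : ℕ)
  /-- `R[x] := R[y] op R[z]` -/
  | op (o : BinOp) (x y z : ℕ)
  /-- `R[x] := M[R[y]]` -/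
  | load (x y : ℕ)
  /-- `M[R[x]] := R[y]` -/
  | store (x y : ℕ)
  /-- `R[x] :=` a fair random bit -/
  | flip (x : ℕ)
  /-- first `P`, then `Q` -/
  | seq (P Q : Program)
  /-- if `R[x] ≠ 0` then `P` else `Q` -/
  | ite (x : ℕ) (P Q : Program)
  /-- while `R[x] ≠ 0` do `P` -/
  | while (x : ℕ) (P : Program)

/-- A configuration: registers, memory, and the infinite sequence of the random bits that have
not been used so far. -/
structure Config where
  reg : ℕ → ℕ
  mem : ℕ → ℕ
  coins : ℕ → Bool

/-- The configuration after writing `a` into register `x`. -/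
def Config.setReg (s : Config) (x a : ℕ) : Config :=
  { s with reg := Function.update s.reg x a }

/-- The configuration after writing `a` into the memory cell `i`. -/
def Config.setMem (s : Config) (i a : ℕ) : Config :=
  { s with mem := Function.update s.mem i a }

/-- The configuration after moving the first unused random bit into register `x`. -/
def Config.flip (s : Config) (x : ℕ) : Config :=
  { s.setReg x (s.coins 0).toNat with coins := fun i => s.coins (i + 1) }

/-- `Exec w P s t s'`: on words of `w` bits, the program `P` started in `s` halts in `s'` after
exactly `t` time units.  An operation whose result does not fit into a word has no rule: the
computation then breaks down and does not halt. -/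
inductive Exec (w : ℕ) : Program → Config → ℕ → Config → Prop
  | skip (s : Config) : Exec w .skip s 1 s
  | const (s : Config) (x c : ℕ) : c < 2 ^ w → Exec w (.const x c) s 1 (s.setReg x c)
  | op (s : Config) (o : BinOp) (x y z : ℕ) : o.eval (s.reg y) (s.reg z) < 2 ^ w →
      Exec w (.op o x y z) s 1 (s.setReg x (o.eval (s.reg y) (s.reg z)))
  | load (s : Config) (x y : ℕ) : Exec w (.load x y) s 1 (s.setReg x (s.mem (s.reg y)))
  | store (s : Config) (x y : ℕ) : Exec w (.store x y) s 1 (s.setMem (s.reg x) (s.reg y))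
  | flip (s : Config) (x : ℕ) : Exec w (.flip x) s 1 (s.flip x)
  | seq {P Q : Program} {s s' s'' : Config} {t t' : ℕ} :
      Exec w P s t s' → Exec w Q s' t' s'' → Exec w (.seq P Q) s (t + t') s''
  | ite_true {x : ℕ} {P Q : Program} {s s' : Config} {t : ℕ} :
      s.reg x ≠ 0 → Exec w P s t s' → Exec w (.ite x P Q) s (t + 1) s'
  | ite_false {x : ℕ} {P Q : Program} {s s' : Config} {t : ℕ} :
      s.reg x = 0 → Exec w Q s t s' → Exec w (.ite x P Q) s (t + 1) s'
  | while_true {x : ℕ} {P : Program} {s s' s'' : Config} {t t' : ℕ} :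
      s.reg x ≠ 0 → Exec w P s t s' → Exec w (.while x P) s' t' s'' →
      Exec w (.while x P) s (t + t' + 1) s''
  | while_false {x : ℕ} {P : Program} {s : Config} :
      s.reg x = 0 → Exec w (.while x P) s 1 s

/-- The initial configuration: the input stands in the memory from address `0` on, and all other
memory cells and all registers are `0`. -/
def initial (input : List ℕ) (coins : ℕ → Bool) : Config where
  reg := fun _ => 0
  mem := fun i => input.getD i 0
  coins := coins

/-- On words of `w` bits, the program `P` with the given input and random bits halts after exactly
`t` time units with the answer `b`.  The answer is read off register `0`: it is YES (`true`) if
this register contains `1`, and NO (`false`) otherwise. -/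
def Answers (w : ℕ) (P : Program) (input : List ℕ) (coins : ℕ → Bool) (t : ℕ) (b : Bool) : Prop :=
  ∃ s : Config, Exec w P (initial input coins) t s ∧ b = decide (s.reg 0 = 1)

/-- The distribution of an infinite sequence of independent fair random bits. -/
noncomputable def fairCoins : MeasureTheory.Measure (ℕ → Bool) :=
  MeasureTheory.Measure.infinitePi fun _ => (PMF.uniformOfFintype Bool).toMeasure

end WordRAM

/-! ### The input of the algorithm -/

open Classical in
/-- The input as a list of numbers: `n`, the number `m` of nodes of the tree, `k`, the adjacency
matrix of `G` row by row, the characteristic vector of `S`, the root, the parents of the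
nodes `0, …, m - 1`, and for each node the size of its bag followed by the vertices in the bag in
increasing order. -/
noncomputable def encodeInstance {n m : ℕ} (G : SimpleGraph (Fin n)) (D : TreeDecomposition G m)
    (S : Finset (Fin n)) (k : ℕ) : List ℕ :=
  [n, m, k]
    ++ (List.finRange n).flatMap (fun u => (List.finRange n).map fun v =>
        if G.Adj u v then 1 else 0)
    ++ (List.finRange n).map (fun v => if v ∈ S then 1 else 0)
    ++ [(D.root : ℕ)]
    ++ (List.finRange m).map (fun i => (D.parent i : ℕ))
    ++ (List.finRange m).flatMap (fun i =>
        (D.bag i).card :: ((D.bag i).sort (· ≤ ·)).map fun v => (v : ℕ))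

/-! Fix a vertex `s ∈ S` and a finite field `K` of characteristic two. The algorithm evaluates, at a
random point, the polynomial `solutionPoly` with one multilinear monomial `∏ v ∈ F, x v` for each
solution `F`. Without solutions it is the zero polynomial, so YES is never wrong. With solutions it
is nonzero of degree at most `n`, so by Schwartz–Zippel it vanishes with probability at most `n /
|K| ≤ 1 / 2` (`solutionPoly_ne_zero`, `RandomBits.fairCoins_eval_eq_zero_le`).

The constraints are made local by counting modulo two. The two-colourings of `G[F]` that are
constant along edges and give `s` a fixed colour number `2 ^ (c - 1)` for `c` components, which is
odd exactly if `G[F]` is connected (`sum_colourings`). Next, `F` is a `VCP_3` set exactly if every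
vertex outside `F` has at most one neighbour outside `F`. Such a vertex with `d` outside neighbours
gets two states whose weights add up to `τ ^ (d - 1)` with truncated subtraction. So four states per
vertex, weighted by factors of vertices and edges, sum to `∑ (∏ v ∈ F, x v) * τ ^ excess G F` over
the connected `F ⊇ S` (`sum_weight`).

Let `g` generate the multiplicative group of `K`. Replacing `x v` by `x v * g ^ e` and `τ` by `g ^
(e * (n + 1))` gives `F` the extra factor `g ^ (e * (|F| + (n + 1) * excess G F))`. The inner
exponent is at most `min k n` exactly if size and excess are as required. Since `|K| > (n + 2) ^ 3`,
these exponents stay below the order of `g`, and summing over all `e` against the powers `g ^ (-e *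
j)` with `j ≤ min k n` keeps precisely the solutions (`sum_filter_weight`).

For each `e` the sum over all assignments is found by variable elimination. The graph in which two
vertices are adjacent when they share a bag contains `G`, is chordal, and has cliques of at most `p
+ 1` vertices (`exists_simplicial`, `card_clique_le`). Along a perfect elimination order every
message depends only on the at most `p` later neighbours (`Scheme.msg_congr`, `Scheme.sum_eq`). A
greedy colouring with at most `p + 1` slots turns it into a table with at most `4 ^ (p + 1)`
entries.

The tables cost `O(4 ^ p * n ^ 2)` for one `e`, hence `O(4 ^ p * n ^ 5)` for all `O(n ^ 3)` of them.
The sharing graph costs `O((p + 1) * m + (p + 1) ^ 2 * n)`, since at most `n` bags are not contained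
in the bag of their parent. The field comes from an exhaustive search for a shift register of full
period, quadratic in `|K|`, which costs `O(n ^ 6)`.

The algorithm is written in a language of bounded loops. Its compilation to the word RAM loses only
constant factors in time and word length (`Stmt.simulates_compile`), and the logic `WP` tracks
ranges, time and results together. The preparation uses no random bits, so the field and the order
are fixed before any probability is estimated. -/

/-! ### Rooted tree decompositions -/

namespace TreeDecomposition

variable {V : Type*} [DecidableEq V] {G : SimpleGraph V} {m : ℕ} (D : TreeDecomposition G m)

/-- The path from a node to the root. -/
noncomputable def pathToRoot (i : Fin m) : D.tree.Walk i D.root :=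
  (D.isTree.existsUnique_path i D.root).exists.choose

theorem isPath_pathToRoot (i : Fin m) : (D.pathToRoot i).IsPath :=
  (D.isTree.existsUnique_path i D.root).exists.choose_spec

theorem eq_pathToRoot {i : Fin m} {q : D.tree.Walk i D.root} (hq : q.IsPath) :
    q = D.pathToRoot i :=
  (D.isTree.existsUnique_path i D.root).unique hq (D.isPath_pathToRoot i)

theorem parent_eq (i : Fin m) : D.parent i = (D.pathToRoot i).snd := rfl

/-- The distance of a node from the root. -/
noncomputable def depth (i : Fin m) : ℕ := (D.pathToRoot i).length

theorem depth_root : D.depth D.root = 0 := by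
  rw [depth, ← D.eq_pathToRoot SimpleGraph.Walk.IsPath.nil]; rfl

theorem parent_eq_of_cons {i j : Fin m} (h : D.tree.Adj i j) {q : D.tree.Walk j D.root}
    (hq : (SimpleGraph.Walk.cons h q).IsPath) :
    D.parent i = j ∧ D.depth i = D.depth j + 1 := by
  rw [SimpleGraph.Walk.cons_isPath_iff] at hq
  rw [parent_eq, depth, depth, ← D.eq_pathToRoot hq.1,
    ← D.eq_pathToRoot (SimpleGraph.Walk.IsPath.cons (h := h) hq.1 hq.2)]
  exact ⟨SimpleGraph.Walk.snd_cons _ h, SimpleGraph.Walk.length_cons _ _⟩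

theorem depth_parent {i : Fin m} (hi : i ≠ D.root) : D.depth i = D.depth (D.parent i) + 1 := by
  have hp := D.isPath_pathToRoot i
  cases hq : D.pathToRoot i with
  | nil => exact absurd rfl hi
  | cons h q =>
    rw [hq] at hp
    obtain ⟨h1, h2⟩ := D.parent_eq_of_cons h hp
    rw [h1, h2]

/-- Paths in a tree are unique. If `i` lies on the path from `j` to the root, that path starts with
the edge to `i`; otherwise the edge prepended to it is the path from `i`. -/
theorem parent_eq_or_parent_eq {i j : Fin m} (h : D.tree.Adj i j) :
    D.parent i = j ∨ D.parent j = i := by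
  by_cases hj : i ∈ (D.pathToRoot j).support
  · right
    have hq := D.isPath_pathToRoot j
    have hu : (D.pathToRoot j).takeUntil i hj = SimpleGraph.Walk.cons h.symm .nil :=
      (D.isTree.existsUnique_path j i).unique (hq.takeUntil hj)
        (SimpleGraph.Walk.IsPath.cons .nil (by simpa using h.ne.symm))
    have := (D.pathToRoot j).take_spec hj
    rw [hu] at this
    rw [parent_eq, ← this]
    simp
  · exact .inl (D.parent_eq_of_cons h ((D.isPath_pathToRoot j).cons hj)).1

/-- Paths that leave a node downwards arrive at their end from its parent. -/
theorem parent_mem_of_isPath {i j : Fin m} (q : D.tree.Walk i j) (hq : q.IsPath)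
    (hij : i ≠ j) (hi : D.parent i ∉ q.support.tail) : D.parent j ∈ q.support ∧ j ≠ D.root := by
  induction q with
  | nil => exact absurd rfl hij
  | @cons i l j h q ih =>
    rw [SimpleGraph.Walk.cons_isPath_iff] at hq
    -- The first edge cannot lead to the parent of `i`, which is not on the rest of the path. So it
    -- leads downwards, and the hypothesis passes on to the remaining path.
    have hl : D.parent l = i := by
      rcases D.parent_eq_or_parent_eq h with h' | h'
      · exact absurd (h' ▸ q.start_mem_support) hi
      · exact h'
    by_cases hlj : l = j
    · subst hlj
      refine ⟨by simp [hl], ?_⟩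
      rintro rfl
      have h0 : D.parent D.root = D.root := by
        rw [parent_eq, ← D.eq_pathToRoot SimpleGraph.Walk.IsPath.nil]; rfl
      exact h.ne (hl.symm.trans h0)
    · obtain ⟨h1, h2⟩ := ih hq.1 hlj (fun hmem => hq.2 (hl ▸ List.mem_of_mem_tail hmem))
      exact ⟨by simp [h1], h2⟩

/-- The node `i` is the highest node whose bag contains `v`. -/
def IsTop (i : Fin m) (v : V) : Prop := v ∈ D.bag i ∧ (i = D.root ∨ v ∉ D.bag (D.parent i))

-- All bags on the path between two tops contain `v`. The path either visits the parent of the first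
-- top, where `v` is absent, or starts downwards and then arrives at the second top from its parent,
-- where `v` is absent too. The root, being its own parent, is treated apart.
variable {D} in
theorem IsTop.unique {i j : Fin m} {v : V} (hi : D.IsTop i v) (hj : D.IsTop j v) : i = j := by
  by_contra hij
  obtain ⟨q, hq, -⟩ := D.isTree.existsUnique_path i j
  have hb : ∀ l ∈ q.support, v ∈ D.bag l := fun l hl =>
    D.inter_subset_bag i l j q hq hl (Finset.mem_inter.2 ⟨hi.1, hj.1⟩)
  by_cases hmem : D.parent i ∈ q.support.tail
  · rcases hi.2 with rfl | h
    · cases q with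
      | nil => exact hij rfl
      | cons h q =>
        have h0 : D.parent D.root = D.root := by
          rw [parent_eq, ← D.eq_pathToRoot SimpleGraph.Walk.IsPath.nil]; rfl
        rw [SimpleGraph.Walk.cons_isPath_iff] at hq
        rw [h0] at hmem
        exact hq.2 (by simpa using hmem)
    · exact h (hb _ (List.mem_of_mem_tail hmem))
  · obtain ⟨h1, h2⟩ := D.parent_mem_of_isPath q hq hij hmem
    exact (hj.2.resolve_left h2) (hb _ h1)

/-- The highest node above `j` whose bag contains a vertex of the bag of `j`; every vertex of the
bag of `j` whose top is not deeper belongs to its bag. -/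
theorem exists_isTop {j : Fin m} {v : V} (hv : v ∈ D.bag j) :
    ∃ i, D.IsTop i v ∧ D.depth i ≤ D.depth j ∧
      ∀ u ∈ D.bag j, (∀ l, D.IsTop l u → D.depth l ≤ D.depth i) → u ∈ D.bag i := by
  induction hd : D.depth j generalizing j with
  | zero =>
    refine ⟨j, ⟨hv, .inl ?_⟩, hd.le, fun u hu _ => hu⟩
    by_contra h
    have := D.depth_parent h
    omega
  | succ d ih =>
    have hj : j ≠ D.root := by
      rintro rfl
      rw [depth_root] at hd
      omega
    have hdp := D.depth_parent hj
    by_cases hv' : v ∈ D.bag (D.parent j)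
    · obtain ⟨i, h1, h2, h3⟩ := ih hv' (by omega)
      -- If `u` were missing from the bag of the parent, `j` would be a top of `u` deeper than `i`.
      refine ⟨i, h1, by omega, fun u hu hl => h3 u ?_ hl⟩
      by_contra hu'
      have := hl j ⟨hu, .inr hu'⟩
      omega
    · exact ⟨j, ⟨hv, .inr hv'⟩, hd.le, fun u hu _ => hu⟩

/-- Two vertices share a bag. -/
def Share (u v : V) : Prop := ∃ i, u ∈ D.bag i ∧ v ∈ D.bag i

theorem share_refl (v : V) : D.Share v v := by
  obtain ⟨i, hi⟩ := D.mem_bag v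
  exact ⟨i, hi, hi⟩

variable {D} in
theorem Share.symm {u v : V} (h : D.Share u v) : D.Share v u :=
  h.imp fun _ h => h.symm

/-- Sharing a bag is decided by the bags that are not contained in the bag of their parent. -/
theorem share_iff_exists_isTop {u v : V} :
    D.Share u v ↔ ∃ i, (∃ x, D.IsTop i x) ∧ u ∈ D.bag i ∧ v ∈ D.bag i := by
  refine ⟨fun ⟨j, hu, hv⟩ => ?_, fun ⟨i, _, h⟩ => ⟨i, h⟩⟩
  induction hd : D.depth j generalizing j with
  | zero =>
    refine ⟨j, ⟨u, hu, .inl ?_⟩, hu, hv⟩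
    by_contra h
    have := D.depth_parent h
    omega
  | succ d ih =>
    have hj : j ≠ D.root := by
      rintro rfl
      rw [depth_root] at hd
      omega
    have hdp := D.depth_parent hj
    -- A bag that is the top of no vertex lies inside the bag of its parent, so the common bag can
    -- be moved one level up.
    by_cases h : ∃ x, D.IsTop j x
    · exact ⟨j, h, hu, hv⟩
    · have hsub : ∀ x ∈ D.bag j, x ∈ D.bag (D.parent j) := fun x hx => by
        by_contra hx'
        exact h ⟨x, hx, .inr hx'⟩
      exact ih _ (hsub _ hu) (hsub _ hv) (by omega)

/-- Some vertex of a nonempty set is such that its neighbours in the set lie in one bag. -/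
theorem exists_deepest (R : Finset V) (hR : R.Nonempty) :
    ∃ v ∈ R, ∃ i, ∀ u ∈ R, D.Share v u → u ∈ D.bag i := by
  have htop : ∀ v, ∃ i, D.IsTop i v := fun v => by
    obtain ⟨j, hj⟩ := D.mem_bag v
    obtain ⟨i, hi, -⟩ := D.exists_isTop hj
    exact ⟨i, hi⟩
  choose top htop using htop
  -- The vertex with the deepest top works: a neighbour has a bag in common with it and a top no
  -- deeper, so its subtree of bags passes through the top of `v`.
  obtain ⟨v, hv, hmax⟩ := R.exists_max_image (fun v => D.depth (top v)) hR
  refine ⟨v, hv, top v, fun u hu ⟨j, hvj, huj⟩ => ?_⟩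
  obtain ⟨i, hi, -, h⟩ := D.exists_isTop hvj
  rw [← hi.unique (htop v)]
  refine h u huj fun l hl => ?_
  rw [hl.unique (htop u), hi.unique (htop v)]
  exact hmax u hu

/-- This is chordality of the sharing graph in the form used by the elimination: every nonempty
vertex set has a simplicial vertex, so a greedy choice never gets stuck. -/
theorem exists_simplicial (R : Finset V) (hR : R.Nonempty) :
    ∃ v ∈ R, ∀ u ∈ R, ∀ u' ∈ R, D.Share v u → D.Share v u' → D.Share u u' := by
  obtain ⟨v, hv, i, h⟩ := D.exists_deepest R hR
  exact ⟨v, hv, fun u hu u' hu' h1 h2 => ⟨i, h u hu h1, h u' hu' h2⟩⟩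

theorem card_bag_le (i : Fin m) : (D.bag i).card ≤ D.width + 1 := by
  have : (D.bag i).card ≤ Finset.univ.sup fun i => (D.bag i).card :=
    Finset.le_sup (f := fun i => (D.bag i).card) (Finset.mem_univ i)
  rw [width]
  omega

/-- Helly property of subtrees: a clique consists of neighbours of its vertex with the deepest top,
so it lies in a single bag. -/
theorem card_clique_le (K : Finset V) (hK : ∀ u ∈ K, ∀ v ∈ K, D.Share u v) :
    K.card ≤ D.width + 1 := by
  rcases K.eq_empty_or_nonempty with rfl | hne
  · simp
  obtain ⟨v, hv, i, h⟩ := D.exists_deepest K hne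
  exact (Finset.card_le_card fun u hu => h u hu (hK v hv u hu)).trans (D.card_bag_le i)

/-- The number of bags that are not contained in the bag of their parent. -/
theorem card_isTop_le [Fintype V] [DecidablePred fun i => ∃ x, D.IsTop i x] :
    (Finset.univ.filter fun i => ∃ x, D.IsTop i x).card ≤ Fintype.card V := by
  classical
  -- Each such node is mapped to a vertex of which it is the top, injectively by uniqueness of tops.
  -- The value `none` serves the other nodes, for which `V` need not offer a default.
  have : ∀ i : Fin m, ∃ x : Option V, ∀ _ : ∃ x, D.IsTop i x, ∃ v, x = some v ∧ D.IsTop i v :=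
    fun i => by
      by_cases h : ∃ x, D.IsTop i x
      · exact ⟨some h.choose, fun _ => ⟨_, rfl, h.choose_spec⟩⟩
      · exact ⟨none, fun h' => absurd h' h⟩
  choose f hf using this
  rw [← Finset.card_univ, ← Finset.card_map (f := ⟨some, Option.some_injective V⟩) (s := Finset.univ)]
  refine Finset.card_le_card_of_injOn f (fun i hi => ?_) (fun i hi j hj hij => ?_)
  · obtain ⟨v, hv, -⟩ := hf i (by simpa using hi)
    simp [hv]
  · obtain ⟨v, hv, h1⟩ := hf i (by simpa using hi)
    obtain ⟨u, hu, h2⟩ := hf j (by simpa using hj)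
    rw [hij, hu] at hv
    cases hv
    exact h1.unique h2

end TreeDecomposition

/-! ### Binary fields and shift registers -/

namespace ShiftRegister

open Polynomial

/-- The polynomial over the field with two elements whose coefficients are the bits of `a`. -/
noncomputable def bitPoly (a : ℕ) : (ZMod 2)[X] :=
  ∑ i ∈ Finset.range a, if a.testBit i then X ^ i else 0

theorem coeff_bitPoly (a i : ℕ) : (bitPoly a).coeff i = if a.testBit i then 1 else 0 := by
  rw [bitPoly, finsetSum_coeff]
  have : ∀ j ∈ Finset.range a, (if a.testBit j then (X : (ZMod 2)[X]) ^ j else 0).coeff i =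
      if j = i then (if a.testBit i then 1 else 0) else 0 := by
    intro j _
    by_cases hji : j = i
    · subst hji
      by_cases h : a.testBit j <;> simp [h]
    · rw [if_neg hji]
      split_ifs
      · rw [coeff_X_pow, if_neg (Ne.symm hji)]
      · simp
  rw [Finset.sum_congr rfl this, Finset.sum_ite_eq']
  split_ifs with h1 h2 h2
  · rfl
  · rfl
  · refine absurd (Finset.mem_range.2 ?_) h1
    exact Nat.lt_two_pow_self.trans_le (Nat.ge_two_pow_of_testBit h2)
  · rfl

theorem bitPoly_xor (a b : ℕ) : bitPoly (a ^^^ b) = bitPoly a + bitPoly b := by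
  ext i
  rw [coeff_add, coeff_bitPoly, coeff_bitPoly, coeff_bitPoly, Nat.testBit_xor]
  cases a.testBit i <;> cases b.testBit i <;> (simp; try rfl)

theorem bitPoly_two_mul (a : ℕ) : bitPoly (2 * a) = X * bitPoly a := by
  ext i
  cases i with
  | zero => simp [coeff_bitPoly]
  | succ i => simp [coeff_bitPoly, coeff_X_mul, Nat.testBit_succ]

theorem bitPoly_zero : bitPoly 0 = 0 := by simp [bitPoly]

theorem bitPoly_one : bitPoly 1 = 1 := by simp [bitPoly]

theorem bitPoly_inj {a b : ℕ} : bitPoly a = bitPoly b ↔ a = b := by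
  refine ⟨fun h => Nat.eq_of_testBit_eq fun i => ?_, fun h => h ▸ rfl⟩
  have := congrArg (fun f => f.coeff i) h
  simp only [coeff_bitPoly] at this
  cases ha : a.testBit i <;> cases hb : b.testBit i <;> simp_all

theorem degree_bitPoly_lt {a q : ℕ} : (bitPoly a).degree < q ↔ a < 2 ^ q := by
  rw [degree_lt_iff_coeff_zero]
  constructor
  · intro h
    refine Nat.lt_pow_two_of_testBit a fun i hi => ?_
    have := h i hi
    rw [coeff_bitPoly] at this
    cases ha : a.testBit i <;> simp_all
  · intro h i hi
    rw [coeff_bitPoly, Nat.testBit_lt_two_pow (h.trans_le (Nat.pow_le_pow_right (by omega) hi))]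
    simp

theorem exists_bitPoly (f : (ZMod 2)[X]) : ∃ a, bitPoly a = f := by
  induction hn : f.natDegree using Nat.strong_induction_on generalizing f with
  | _ n ih =>
    have hC : ∀ c : ZMod 2, ∃ a, bitPoly a = C c := by
      intro c
      fin_cases c
      · exact ⟨0, bitPoly_zero.trans C_0.symm⟩
      · exact ⟨1, bitPoly_one.trans C_1.symm⟩
    rcases Nat.eq_zero_or_pos n with rfl | hpos
    · rw [eq_C_of_natDegree_eq_zero hn]
      exact hC _
    · obtain ⟨a, ha⟩ := ih (f.divX.natDegree) (by rw [natDegree_divX_eq_natDegree_tsub_one]; omega)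
        f.divX rfl
      obtain ⟨b, hb⟩ := hC (f.coeff 0)
      refine ⟨(2 * a) ^^^ b, ?_⟩
      rw [bitPoly_xor, bitPoly_two_mul, ha, hb, mul_comm, divX_mul_X_add]

/-- One step of the shift register with feedback `f`. -/
def step (fs f s : ℕ) : ℕ := if 2 * s < fs then 2 * s else (2 * s) ^^^ f

/-- The states of the shift register. -/
def state (fs f : ℕ) : ℕ → ℕ
  | 0 => 1
  | i + 1 => step fs f (state fs f i)

/-- The shift register runs through all nonzero states. -/
def FullPeriod (fs f : ℕ) : Prop := ∀ i < fs - 1, (state fs f (i + 1) = 1 ↔ i + 1 = fs - 1)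

variable {q f : ℕ}

/-- Both numbers have their leading bit at position `q`, and the exclusive or cancels it. -/
theorem xor_lt_of_testBit {a b : ℕ} (ha : 2 ^ q ≤ a) (ha' : a < 2 ^ (q + 1)) (hb : 2 ^ q ≤ b)
    (hb' : b < 2 ^ (q + 1)) : a ^^^ b < 2 ^ q := by
  have top : ∀ c, 2 ^ q ≤ c → c < 2 ^ (q + 1) → c.testBit q = true := fun c h h' => by
    rw [Nat.testBit_eq_decide_div_mod_eq]
    have : c / 2 ^ q = 1 := by
      rw [Nat.div_eq_iff (by positivity)]
      rw [pow_succ] at h'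
      constructor <;> omega
    simp [this]
  refine Nat.lt_pow_two_of_testBit _ fun i hi => ?_
  rw [Nat.testBit_xor]
  rcases hi.eq_or_lt with rfl | hlt
  · rw [top a ha ha', top b hb hb']; rfl
  · have hp : 2 ^ (q + 1) ≤ 2 ^ i := Nat.pow_le_pow_right (by omega) hlt
    rw [Nat.testBit_lt_two_pow (ha'.trans_le hp), Nat.testBit_lt_two_pow (hb'.trans_le hp)]
    rfl

theorem step_lt (hf : 2 ^ q ≤ f) (hf' : f < 2 ^ (q + 1)) {s : ℕ} (hs : s < 2 ^ q) :
    step (2 ^ q) f s < 2 ^ q := by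
  rw [step]
  split_ifs with h
  · exact h
  · exact xor_lt_of_testBit (not_lt.1 h) (by rw [pow_succ]; omega) hf hf'

theorem state_lt (hq : 1 ≤ q) (hf : 2 ^ q ≤ f) (hf' : f < 2 ^ (q + 1)) (i : ℕ) :
    state (2 ^ q) f i < 2 ^ q := by
  induction i with
  | zero => exact Nat.one_lt_two_pow (by omega)
  | succ i ih => exact step_lt hf hf' ih

section Aeval

variable {A : Type*} [CommRing A] [Algebra (ZMod 2) A] {θ : A}

/-- A step is multiplication by `X`, followed by the subtraction of `f` if the degree reaches `q`;
at a root of `f` the subtraction has no effect. -/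
theorem aeval_step (h : aeval θ (bitPoly f) = 0) (s : ℕ) :
    aeval θ (bitPoly (step (2 ^ q) f s)) = aeval θ (bitPoly s) * θ := by
  rw [step]
  split_ifs
  · rw [bitPoly_two_mul, map_mul, aeval_X, mul_comm]
  · rw [bitPoly_xor, map_add, h, add_zero, bitPoly_two_mul, map_mul, aeval_X, mul_comm]

theorem aeval_state (h : aeval θ (bitPoly f) = 0) (i : ℕ) :
    aeval θ (bitPoly (state (2 ^ q) f i)) = θ ^ i := by
  induction i with
  | zero => simp [state, bitPoly_one]
  | succ i ih => rw [state, aeval_step h, ih, pow_succ]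

/-- The elements of the ring are represented by the numbers with `q` bits. -/
theorem injOn_aeval {g : (ZMod 2)[X]} (hdeg : g.natDegree = q) (hg : g ≠ 0)
    (hdvd : ∀ p : (ZMod 2)[X], aeval θ p = 0 → g ∣ p) :
    Set.InjOn (fun a => aeval θ (bitPoly a)) {a | a < 2 ^ q} := by
  intro a ha b hb hab
  have h0 : aeval θ (bitPoly (a ^^^ b)) = 0 := by
    rw [bitPoly_xor, map_add]
    have hc : (aeval θ (bitPoly a) : A) = aeval θ (bitPoly b) := hab
    rw [hc, ← map_add, ← bitPoly_xor, Nat.xor_self, bitPoly_zero, map_zero]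
  -- The difference is a multiple of `g` of degree less than `q`, hence zero.
  have hz : bitPoly (a ^^^ b) = 0 := by
    refine eq_zero_of_dvd_of_degree_lt (hdvd _ h0) ?_
    rw [degree_eq_natDegree hg, hdeg]
    exact degree_bitPoly_lt.2 (Nat.xor_lt_two_pow ha hb)
  rw [← bitPoly_zero, bitPoly_inj] at hz
  exact Nat.xor_eq_zero_iff.1 hz

end Aeval

/-- Some shift register has full period: the one of a primitive polynomial. -/
theorem exists_fullPeriod (hq : 1 ≤ q) : ∃ c < 2 ^ q, FullPeriod (2 ^ q) (2 ^ q + c) := by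
  classical
  let K := GaloisField 2 q
  have hK : Nat.card K = 2 ^ q := GaloisField.card 2 q (by omega)
  obtain ⟨θ, hθ⟩ := IsCyclic.exists_generator (α := Kˣ)
  have hord : orderOf θ = 2 ^ q - 1 := by
    rw [orderOf_eq_card_of_forall_mem_zpowers hθ, Nat.card_units, hK]
  have hint : IsIntegral (ZMod 2) (θ : K) := Algebra.IsIntegral.isIntegral _
  -- Every nonzero element is a power of `θ`, so `θ` generates the field and its minimal polynomial,
  -- the desired feedback, has degree `q`.
  have htop : IntermediateField.adjoin (ZMod 2) {(θ : K)} = ⊤ := by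
    rw [eq_top_iff]
    intro x _
    rcases eq_or_ne x 0 with rfl | hx
    · exact zero_mem _
    · obtain ⟨i, hi⟩ := hθ (Units.mk0 x hx)
      have : x = (θ : K) ^ i := by
        have := congrArg Units.val hi
        simpa using this.symm
      rw [this]
      exact zpow_mem (IntermediateField.mem_adjoin_simple_self _ _) _
  have hdeg : (minpoly (ZMod 2) (θ : K)).natDegree = q := by
    rw [← IntermediateField.adjoin.finrank hint, htop, IntermediateField.finrank_top',
      GaloisField.finrank 2 (by omega)]
  obtain ⟨f, hf⟩ := exists_bitPoly (minpoly (ZMod 2) (θ : K))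
  have hne : minpoly (ZMod 2) (θ : K) ≠ 0 := minpoly.ne_zero hint
  have hfl : f < 2 ^ (q + 1) := by
    rw [← degree_bitPoly_lt, hf, degree_eq_natDegree hne, hdeg]
    exact_mod_cast Nat.lt_succ_self q
  have hfu : 2 ^ q ≤ f := by
    by_contra h
    rw [not_le, ← degree_bitPoly_lt, hf, degree_eq_natDegree hne, hdeg] at h
    exact lt_irrefl _ h
  refine ⟨f - 2 ^ q, by rw [pow_succ] at hfl; omega, fun i hi => ?_⟩
  rw [Nat.add_sub_cancel' hfu]
  have hz : aeval (θ : K) (bitPoly f) = 0 := by rw [hf]; exact minpoly.aeval _ _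
  have hinj := injOn_aeval (q := q) hdeg hne (fun p hp => minpoly.dvd _ (θ : K) hp)
  have h1 : state (2 ^ q) f (i + 1) = 1 ↔ (θ : K) ^ (i + 1) = 1 := by
    rw [← aeval_state (q := q) hz, ← map_one (aeval (R := ZMod 2) (θ : K)), ← bitPoly_one]
    exact ⟨fun h => by rw [h], fun h => hinj (state_lt hq hfu hfl _)
      (Nat.one_lt_two_pow (by omega)) h⟩
  have h2 : (θ : K) ^ (i + 1) = 1 ↔ θ ^ (i + 1) = 1 := by
    rw [← Units.val_pow_eq_pow_val, Units.val_eq_one]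
  rw [h1, h2, ← orderOf_dvd_iff_pow_eq_one, hord]
  exact ⟨fun h => le_antisymm (by omega) (Nat.le_of_dvd (by omega) h), fun h => h ▸ dvd_rfl⟩

/-- A representation of the field `K` by numbers below `fs`, with addition as exclusive or, and the
powers of a generator. -/
structure Repr (K : Type) [Field K] [Fintype K] (fs : ℕ) where
  val : ℕ → K
  g : K
  pow : ℕ → ℕ
  val_zero : val 0 = 0
  val_one : val 1 = 1
  val_xor : ∀ a b, val (a ^^^ b) = val a + val b
  val_bij : Set.BijOn val {a | a < fs} Set.univ
  pow_lt : ∀ i, pow i < fs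
  val_pow : ∀ i, val (pow i) = g ^ i
  orderOf_g : orderOf g = fs - 1
  card : Fintype.card K = fs

/-- A shift register with full period defines a field. -/
theorem exists_field (hq : 1 ≤ q) (hf : 2 ^ q ≤ f) (hf' : f < 2 ^ (q + 1))
    (hfull : FullPeriod (2 ^ q) f) :
    ∃ (K : Type) (_ : Field K) (_ : Fintype K) (_ : CharP K 2) (F : Repr K (2 ^ q)),
      F.pow = state (2 ^ q) f := by
  classical
  set φ := bitPoly f with hφ
  have hne : φ ≠ 0 := by
    rw [hφ, ← bitPoly_zero, Ne, bitPoly_inj]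
    have : 0 < 2 ^ q := by positivity
    omega
  have hdeg : φ.natDegree = q := by
    have h1 := degree_bitPoly_lt.2 hf'
    have h2 : ¬ φ.degree < q := by rw [degree_bitPoly_lt]; omega
    rw [← hφ, degree_eq_natDegree hne, Nat.cast_lt] at h1
    rw [degree_eq_natDegree hne, Nat.cast_lt] at h2
    omega
  have hmonic : φ.Monic := by
    have h : φ.leadingCoeff ≠ 0 := leadingCoeff_ne_zero.2 hne
    have : ∀ c : ZMod 2, c ≠ 0 → c = 1 := by decide
    exact this _ h
  let A := AdjoinRoot φ
  let θ : A := AdjoinRoot.root φ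
  have haeval : ∀ p, aeval θ p = AdjoinRoot.mk φ p := fun p => AdjoinRoot.aeval_eq p
  have hz : aeval θ (bitPoly f) = 0 := by rw [haeval]; exact AdjoinRoot.mk_self
  have hinj := injOn_aeval (q := q) (θ := θ) hdeg hne fun p hp => by
    rw [haeval] at hp; exact AdjoinRoot.mk_eq_zero.1 hp
  have hsurj : ∀ x : A, ∃ a < 2 ^ q, aeval θ (bitPoly a) = x := by
    intro x
    obtain ⟨p, rfl⟩ := AdjoinRoot.mk_surjective x
    obtain ⟨a, ha⟩ := exists_bitPoly (p %ₘ φ)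
    refine ⟨a, ?_, ?_⟩
    · rw [← degree_bitPoly_lt, ha, ← hdeg, ← degree_eq_natDegree hne]
      exact degree_modByMonic_lt _ hmonic
    · rw [haeval, ha, AdjoinRoot.mk_eq_mk]
      have := modByMonic_add_div p φ
      exact ⟨-(p /ₘ φ), by linear_combination this⟩
  have h1q : 1 < 2 ^ q := Nat.one_lt_two_pow (by omega)
  have hstate : ∀ i, state (2 ^ q) f i = 1 ↔ θ ^ i = 1 := fun i => by
    rw [← aeval_state (q := q) hz, ← map_one (aeval (R := ZMod 2) θ), ← bitPoly_one]
    exact ⟨fun h => by rw [h], fun h => hinj (state_lt hq hf hf' _) h1q h⟩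
  have hN : θ ^ (2 ^ q - 1) = 1 := by
    rw [← hstate]
    have := (hfull (2 ^ q - 2) (by omega)).2 (by omega)
    rwa [show 2 ^ q - 2 + 1 = 2 ^ q - 1 by omega] at this
  have hord : orderOf θ = 2 ^ q - 1 := by
    rw [orderOf_eq_iff (by omega)]
    refine ⟨hN, fun m hm hm0 h => ?_⟩
    rw [← hstate] at h
    have := (hfull (m - 1) (by omega)).1 (by rwa [Nat.sub_add_cancel hm0])
    omega
  have hnontriv : (0 : A) ≠ 1 := fun h => by
    have h0 : aeval θ (bitPoly 0) = aeval θ (bitPoly 1) := by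
      rw [bitPoly_zero, bitPoly_one, map_zero, map_one, h]
    have h0' : (0 : ℕ) < 2 ^ q := by positivity
    exact absurd (hinj h0' h1q h0) (by omega)
  -- Irreducibility of `φ` is not assumed; it follows from the period. The `2 ^ q - 1` powers of `θ`
  -- are distinct, their states are nonzero, and so they exhaust the nonzero residues. Every nonzero
  -- residue is thus a power of the unit `θ`.
  have hunit : ∀ x : A, x ≠ 0 → ∃ i, x = θ ^ i := by
    have himg : (Finset.range (2 ^ q - 1)).image (state (2 ^ q) f) = Finset.Ico 1 (2 ^ q) := by
      refine Finset.eq_of_subset_of_card_le (fun a ha => ?_) ?_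
      · obtain ⟨i, -, rfl⟩ := Finset.mem_image.1 ha
        rw [Finset.mem_Ico]
        refine ⟨Nat.one_le_iff_ne_zero.2 fun h0 => ?_, state_lt hq hf hf' i⟩
        have := aeval_state (q := q) hz i
        rw [h0, bitPoly_zero, map_zero] at this
        have h2 : θ ^ i * θ ^ ((2 ^ q - 1) * i - i) = 1 := by
          rw [← pow_add, Nat.add_sub_cancel' (Nat.le_mul_of_pos_left _ (by omega)), pow_mul, hN,
            one_pow]
        rw [← this, zero_mul] at h2
        exact hnontriv h2
      · rw [Finset.card_image_of_injOn, Finset.card_range, Nat.card_Ico]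
        intro i hi j hj hij
        have h3 : θ ^ i = θ ^ j := by
          rw [← aeval_state (q := q) hz, ← aeval_state (q := q) hz]
          exact congrArg (fun a => aeval θ (bitPoly a)) hij
        have hi' := Finset.mem_range.1 (Finset.mem_coe.1 hi)
        have hj' := Finset.mem_range.1 (Finset.mem_coe.1 hj)
        rw [← hord] at hi' hj'
        exact pow_injOn_Iio_orderOf hi' hj' h3
    intro x hx
    obtain ⟨a, ha, rfl⟩ := hsurj x
    have ha0 : a ≠ 0 := by
      rintro rfl
      rw [bitPoly_zero, map_zero] at hx
      exact hx rfl
    have : a ∈ Finset.Ico 1 (2 ^ q) := Finset.mem_Ico.2 ⟨by omega, ha⟩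
    rw [← himg] at this
    obtain ⟨i, -, rfl⟩ := Finset.mem_image.1 this
    exact ⟨i, aeval_state (q := q) hz i⟩
  have hfield : IsField A := by
    refine ⟨⟨0, 1, hnontriv⟩, mul_comm, fun {x} hx => ?_⟩
    obtain ⟨i, rfl⟩ := hunit x hx
    refine ⟨θ ^ ((2 ^ q - 1) * i - i), ?_⟩
    rw [← pow_add, Nat.add_sub_cancel' (Nat.le_mul_of_pos_left _ (by omega)), pow_mul, hN, one_pow]
  let : Field A := hfield.toField
  have hbij : Set.BijOn (fun a => aeval θ (bitPoly a)) {a | a < 2 ^ q} Set.univ :=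
    ⟨fun _ _ => Set.mem_univ _, hinj, fun x _ => hsurj x⟩
  have : Finite A := by
    have : (Set.univ : Set A).Finite := by
      rw [← hbij.image_eq]
      exact (Set.finite_lt_nat _).image _
    exact Set.finite_univ_iff.1 this
  let : Fintype A := Fintype.ofFinite A
  have : CharP A 2 := charP_of_injective_algebraMap (algebraMap (ZMod 2) A).injective 2
  refine ⟨A, inferInstance, inferInstance, inferInstance, ⟨fun a => aeval θ (bitPoly a), θ,
    state (2 ^ q) f, ?_, ?_, ?_, hbij, state_lt hq hf hf', aeval_state hz, hord, ?_⟩, rfl⟩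
  · simp only [bitPoly_zero, map_zero]
  · simp only [bitPoly_one, map_one]
  · intro a b
    simp only [bitPoly_xor, map_add]
  · rw [← Nat.card_eq_fintype_card, ← Nat.card_congr (Equiv.Set.univ A),
      ← Nat.card_congr (hbij.equiv)]
    rw [Nat.card_eq_fintype_card]
    simp

end ShiftRegister

/-! ### Counting solutions modulo two -/

namespace CutCount

open Finset

theorem prod_ite_one {K V : Type*} [CommSemiring K] [Fintype V] (p : V → Prop) [DecidablePred p] :
    ∏ v, (if p v then (1 : K) else 0) = if ∀ v, p v then 1 else 0 := by
  split_ifs with h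
  · exact prod_eq_one fun v _ => if_pos (h v)
  · push Not at h
    obtain ⟨v, hv⟩ := h
    exact prod_eq_zero (mem_univ v) (if_neg hv)

theorem isVCP_three_iff {V : Type*} (G : SimpleGraph V) {F : Finset V} : IsVCP G 3 F ↔
    ∀ u v w, G.Adj v u → G.Adj v w → u ≠ w → u ∈ F ∨ v ∈ F ∨ w ∈ F := by
  constructor
  · intro h u v w huv hvw huw
    obtain ⟨x, hx, hxF⟩ := h u w (.cons huv.symm (.cons hvw .nil))
      (by simp [SimpleGraph.Walk.cons_isPath_iff, huw, huv.ne', hvw.ne]) (by simp)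
    simp only [SimpleGraph.Walk.support_cons, SimpleGraph.Walk.support_nil, List.mem_cons,
      List.not_mem_nil, or_false] at hx
    rcases hx with rfl | rfl | rfl
    exacts [.inl hxF, .inr (.inl hxF), .inr (.inr hxF)]
  · intro h u w q hq hlen
    match q, hq, hlen with
    | .cons (v := v) h1 (.cons h2 .nil), hq, _ =>
      have huw : u ≠ w := by
        simp only [SimpleGraph.Walk.cons_isPath_iff, SimpleGraph.Walk.support_cons,
          SimpleGraph.Walk.support_nil, List.mem_cons, List.not_mem_nil, or_false, not_or] at hq
        exact hq.2.2
      rcases h u v w h1.symm h2 huw with h | h | h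
      exacts [⟨_, by simp, h⟩, ⟨_, by simp, h⟩, ⟨_, by simp, h⟩]
    | .cons _ (.cons _ (.cons _ p)), _, hlen => simp at hlen

variable {K : Type*} [Field K] [CharP K 2]

/-- The number of two-colourings of a graph that are constant on the components and give a fixed
colour to `s` is odd if and only if the graph is connected. -/
theorem sum_colourings {W : Type*} [Fintype W] (H : SimpleGraph W) (s : W)
    [Decidable H.Connected] [DecidablePred fun b : W → Bool => b s = false ∧ ∀ u v, H.Adj u v → b u = b v]
    [DecidableEq W] :
    ∑ b : W → Bool, (if b s = false ∧ ∀ u v, H.Adj u v → b u = b v then (1 : K) else 0) =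
      if H.Connected then 1 else 0 := by
  classical
  have hreach : ∀ b : W → Bool, (∀ u v, H.Adj u v → b u = b v) → ∀ u v, H.Reachable u v →
      b u = b v := by
    rintro b hb u v ⟨p⟩
    induction p with
    | nil => rfl
    | cons h _ ih => exact (hb _ _ h).trans ih
  split_ifs with hc
  · rw [sum_eq_single fun _ => false]
    · simp
    · intro b _ hb
      rw [if_neg]
      rintro ⟨h1, h2⟩
      exact hb (funext fun v => (hreach b h2 v s (hc.preconnected v s)).trans h1)
    · simp
  · have : ∃ w, ¬ H.Reachable w s := by
      by_contra! h
      have : Nonempty W := ⟨s⟩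
      exact hc ⟨fun u v => (h u).trans (h v).symm⟩
    obtain ⟨w, hw⟩ := this
    rw [← sum_filter]
    -- The component of `w` does not contain `s`. Swapping the colours on it pairs up the admissible
    -- colourings, so their number vanishes in characteristic two.
    refine sum_involution (fun b _ v => if H.Reachable w v then !(b v) else b v) ?_ ?_ ?_ ?_
    · intro b _
      exact CharTwo.add_self_eq_zero 1
    · intro b _ _ h
      have := congrFun h w
      simp only [SimpleGraph.Reachable.refl, if_true] at this
      cases hb : b w <;> simp [hb] at this
    · intro b hb
      simp only [mem_filter, mem_univ, true_and] at hb ⊢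
      refine ⟨by rw [if_neg hw]; exact hb.1, fun u v huv => ?_⟩
      have : H.Reachable w u ↔ H.Reachable w v :=
        ⟨fun h => h.trans huv.reachable, fun h => h.trans huv.symm.reachable⟩
      simp only [this, hb.2 u v huv]
    · intro b _
      funext v
      by_cases h : H.Reachable w v <;> simp [h]

/-- The states of a vertex: the first bit tells whether the vertex belongs to the solution. For
vertices of the solution the second bit is the side of the cut, and for the other vertices it
tells whether neighbours outside the solution are forbidden. -/
abbrev State := Bool × Bool

/-- The factor of a vertex in the state `c` for a neighbour in the state `c'`. -/
def halfEdge (τ : K) (c c' : State) : K :=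
  if c.1 && c'.1 then (if c.2 = c'.2 then 1 else 0)
  else if c.1 || c'.1 then 1 else if c.2 then 0 else τ

variable {V : Type*} [Fintype V] [DecidableEq V] (G : SimpleGraph V) [DecidableRel G.Adj]
  (S : Finset V) (s : V)

/-- The weight of the state `c` of the vertex `v`. -/
def vertexWeight (τ : K) (x : V → K) (v : V) (c : State) : K :=
  if c.1 then (if v = s ∧ c.2 then 0 else x v)
  else if v ∈ S then 0 else if c.2 then 1 + τ⁻¹ else τ⁻¹

/-- The weight of an assignment of states. -/
def weight (τ : K) (x : V → K) (σ : V → State) : K :=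
  (∏ v, vertexWeight S s τ x v (σ v)) *
    ∏ v, ∏ u, if G.Adj v u then halfEdge τ (σ v) (σ u) else 1

/-- The number of neighbours of `v` outside `F`. -/
def outDegree (F : Finset V) (v : V) : ℕ := #{u | G.Adj v u ∧ u ∉ F}

/-- The surplus of degrees outside `F`; it vanishes if and only if all degrees are at most one. -/
def excess (F : Finset V) : ℕ := ∑ v ∈ Fᶜ, (outDegree G F v - 1)

/-- Boolean functions are finite sets. -/
def boolEquivFinset : (V → Bool) ≃ Finset V where
  toFun f := {v | f v = true}
  invFun F v := decide (v ∈ F)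
  left_inv f := by funext v; simp
  right_inv F := by ext v; simp

/-- For fixed `F` the sum factors. Inside `F` the second bits are the colourings of
`sum_colourings`. A vertex outside `F` with `d` outside neighbours contributes `(1 + τ⁻¹) * 0 ^ d +
τ⁻¹ * τ ^ d`, which is `1` for `d = 0` by characteristic two, and `τ ^ (d - 1)` for `d > 0`. -/
theorem sum_weight_of_finset {τ : K} (hτ : τ ≠ 0) (x : V → K) (hs : s ∈ S) (F : Finset V)
    [Decidable (G.induce (F : Set V)).Connected] :
    ∑ b : V → Bool, weight G S s τ x (fun v => (decide (v ∈ F), b v)) =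
      if S ⊆ F ∧ (G.induce (F : Set V)).Connected then (∏ v ∈ F, x v) * τ ^ excess G F else 0 := by
  classical
  by_cases hSF : S ⊆ F
  swap
  · rw [if_neg (fun h => hSF h.1)]
    obtain ⟨v, hv, hvF⟩ := not_subset.1 hSF
    refine sum_eq_zero fun b _ => ?_
    rw [weight, prod_eq_zero (mem_univ v), zero_mul]
    simp [vertexWeight, hv, hvF]
  have hsF := hSF hs
  -- the factors of the vertices inside and outside `F`
  let A : ((v : {v // v ∈ F}) → Bool) → K := fun b =>
    if b ⟨s, hsF⟩ = false ∧ ∀ u v, (G.induce (F : Set V)).Adj u v → b u = b v then 1 else 0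
  let g : V → Bool → K := fun v b =>
    (if b then 1 + τ⁻¹ else τ⁻¹) * (if b then 0 else τ) ^ outDegree G F v
  have hsplit : ∀ b : V → Bool, weight G S s τ x (fun v => (decide (v ∈ F), b v)) =
      (∏ v ∈ F, x v) * (A (fun v => b v) * ∏ v : {v // v ∉ F}, g v (b v)) := by
    intro b
    rw [weight, ← prod_mul_distrib, ← prod_mul_prod_compl F, ← prod_subtype Fᶜ (by simp)
      (fun v => g v (b v)), ← mul_assoc]
    congr 1
    · have h1 : ∀ v ∈ F, vertexWeight S s τ x v (decide (v ∈ F), b v) *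
          ∏ u, (if G.Adj v u then halfEdge τ (decide (v ∈ F), b v) (decide (u ∈ F), b u) else 1) =
          x v * (if (v = s → b v = false) ∧ ∀ u, G.Adj v u ∧ u ∈ F → b v = b u then 1 else 0) := by
        intro v hv
        have h2 : ∏ u, (if G.Adj v u then halfEdge τ (decide (v ∈ F), b v) (decide (u ∈ F), b u)
            else 1) = if ∀ u, G.Adj v u ∧ u ∈ F → b v = b u then 1 else 0 := by
          rw [← prod_ite_one]
          refine prod_congr rfl fun u _ => ?_
          by_cases h3 : G.Adj v u <;> by_cases h4 : u ∈ F <;> simp [halfEdge, hv, h3, h4]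
        rw [h2]
        by_cases h5 : v = s
        · subst h5
          cases h6 : b v <;> simp [vertexWeight, hv]
        · simp [vertexWeight, hv, h5]
      rw [prod_congr rfl h1, prod_mul_distrib]
      congr 1
      rw [← prod_coe_sort, prod_ite_one]
      refine if_congr ?_ rfl rfl
      constructor
      · intro h
        refine ⟨(h ⟨s, hsF⟩).1 rfl, fun u v huv => (h u).2 v ⟨huv, v.2⟩⟩
      · rintro ⟨h3, h4⟩ ⟨v, hv⟩
        refine ⟨?_, fun u hu => h4 ⟨v, hv⟩ ⟨u, hu.2⟩ hu.1⟩
        rintro rfl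
        exact h3
    · refine prod_congr rfl fun v hv => ?_
      have hv' : v ∉ F := mem_compl.1 hv
      have hvS : v ∉ S := fun h => hv' (hSF h)
      have h2 : ∏ u, (if G.Adj v u then halfEdge τ (decide (v ∈ F), b v) (decide (u ∈ F), b u)
            else 1) = (if b v then 0 else τ) ^ outDegree G F v := by
        rw [outDegree, ← prod_const, prod_filter]
        refine prod_congr rfl fun u _ => ?_
        by_cases h3 : G.Adj v u <;> by_cases h4 : u ∈ F <;> simp [halfEdge, hv', h3, h4]
      rw [h2]
      simp [g, vertexWeight, hv', hvS]
  simp_rw [hsplit]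
  rw [← mul_sum]
  have hprod : ∑ b : V → Bool, A (fun v => b v) * ∏ v : {v // v ∉ F}, g v (b v) =
      (∑ b, A b) * ∏ v : {v // v ∉ F}, ∑ c, g v c := by
    rw [Fintype.prod_sum, sum_mul_sum, ← Fintype.sum_prod_type']
    refine Fintype.sum_equiv (Equiv.piEquivPiSubtypeProd (fun v => v ∈ F) fun _ => Bool) _ _ ?_
    intro b
    rfl
  rw [hprod]
  have hA : ∑ b, A b = if (G.induce (F : Set V)).Connected then 1 else 0 := by
    have := sum_colourings (K := K) (G.induce (F : Set V)) ⟨s, hsF⟩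
    convert this
  have hg : ∏ v : {v // v ∉ F}, ∑ c, g v c = τ ^ excess G F := by
    rw [excess, ← prod_pow_eq_pow_sum, ← prod_subtype Fᶜ (by simp) (fun v => ∑ c, g v c)]
    refine prod_congr rfl fun v _ => ?_
    simp only [g, Fintype.sum_bool, if_true, Bool.false_eq_true, if_false]
    rcases Nat.eq_zero_or_pos (outDegree G F v) with h | h
    · rw [h, pow_zero, pow_zero, mul_one, mul_one, add_assoc, CharTwo.add_self_eq_zero, add_zero]
    · rw [zero_pow (by omega), mul_zero, zero_add]
      obtain ⟨d, hd⟩ := Nat.exists_eq_succ_of_ne_zero h.ne'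
      rw [hd, Nat.succ_sub_one, pow_succ', ← mul_assoc, inv_mul_cancel₀ hτ, one_mul]
  rw [hA, hg]
  by_cases hc : (G.induce (F : Set V)).Connected
  · rw [if_pos hc, if_pos ⟨hSF, hc⟩, one_mul]
  · rw [if_neg hc, if_neg (fun h => hc h.2), zero_mul, mul_zero]

open Classical in
theorem sum_weight {τ : K} (hτ : τ ≠ 0) (x : V → K) (hs : s ∈ S) :
    ∑ σ : V → State, weight G S s τ x σ =
      ∑ F : Finset V, if S ⊆ F ∧ (G.induce (F : Set V)).Connected then
        (∏ v ∈ F, x v) * τ ^ excess G F else 0 := by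
  rw [← (Equiv.arrowProdEquivProdArrow V (fun _ => Bool) (fun _ => Bool)).symm.sum_comp,
    Fintype.sum_prod_type]
  refine Fintype.sum_equiv boolEquivFinset _ _ fun f => ?_
  rw [← sum_weight_of_finset G S s hτ x hs]
  refine sum_congr rfl fun b _ => ?_
  congr 1
  funext v
  simp [boolEquivFinset, Equiv.arrowProdEquivProdArrow]

/-- A path on three vertices that avoids `F` is the same as a vertex outside `F` with two different
neighbours outside `F`. -/
theorem excess_eq_zero_iff {F : Finset V} : excess G F = 0 ↔ IsVCP G 3 F := by
  rw [excess, sum_eq_zero_iff, isVCP_three_iff]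
  constructor
  · intro h u v w huv hvw huw
    by_contra! hc
    have h1 := h v (mem_compl.2 hc.2.1)
    have h2 : 1 < outDegree G F v := by
      rw [outDegree, one_lt_card]
      exact ⟨u, by simp [huv, hc.1], w, by simp [hvw, hc.2.2], huw⟩
    omega
  · intro h v hv
    have : outDegree G F v ≤ 1 := by
      rw [outDegree, card_le_one]
      intro u hu w hw
      by_contra huw
      simp only [mem_filter, mem_univ, true_and] at hu hw
      rcases h u v w hu.1 hw.1 huw with h' | h' | h'
      exacts [hu.2 h', mem_compl.1 hv h', hw.2 h']
    omega

theorem excess_le (F : Finset V) : excess G F ≤ Fintype.card V * Fintype.card V := by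
  rw [excess]
  calc ∑ v ∈ Fᶜ, (outDegree G F v - 1) ≤ ∑ _v ∈ Fᶜ, Fintype.card V :=
        sum_le_sum fun v _ => (Nat.sub_le _ _).trans (card_le_univ _)
    _ = #Fᶜ * Fintype.card V := by rw [sum_const, smul_eq_mul]
    _ ≤ _ := Nat.mul_le_mul_right _ (card_le_univ _)

end CutCount

/-! ### Extracting the solutions from the values at all field elements -/

namespace CutCount

open Finset

section Filter

variable {K : Type} [Field K] [CharP K 2] {g : K} {N : ℕ}

/-- Orthogonality of characters of a cyclic group: if `g ^ t ≠ 1` the geometric sum vanishes, and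
otherwise it is `N`, which equals `1` in `K` because `N` is odd. -/
theorem sum_pow_orderOf (hN : orderOf g = N) (hodd : Odd N) (t : ℕ) :
    ∑ e ∈ range N, g ^ (e * t) = if N ∣ t then 1 else 0 := by
  have h : ∀ e ∈ range N, g ^ (e * t) = (g ^ t) ^ e := fun e _ => by rw [← pow_mul, mul_comm]
  rw [sum_congr rfl h]
  split_ifs with hd
  · have : g ^ t = 1 := by rw [← orderOf_dvd_iff_pow_eq_one, hN]; exact hd
    simp only [this, one_pow, sum_const, card_range, nsmul_eq_mul, mul_one]
    obtain ⟨r, rfl⟩ := hodd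
    push_cast
    rw [CharTwo.two_eq_zero, zero_mul, zero_add]
  · have hne : g ^ t ≠ 1 := fun h => hd (by rw [← hN]; exact orderOf_dvd_of_pow_eq_one h)
    have := geom_sum_mul (g ^ t) N
    rw [← pow_mul, mul_comm t, pow_mul, ← hN, pow_orderOf_eq_one, one_pow, sub_self, hN] at this
    exact (mul_eq_zero.1 this).resolve_right (sub_ne_zero.2 hne)

variable {V : Type*} [Fintype V] [DecidableEq V] (G : SimpleGraph V) [DecidableRel G.Adj]
  (S : Finset V) (s : V)

open Classical in
/-- The sum over the field elements isolates the solutions. -/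
theorem sum_filter_weight (hN : orderOf g = N) (hodd : Odd N) (x : V → K) (hs : s ∈ S) (k : ℕ)
    {n : ℕ} (hn : Fintype.card V = n) (hlarge : (n + 1) * n * n + n < N) :
    ∑ e ∈ range N, (∑ σ : V → State, weight G S s (g ^ (e * (n + 1))) (fun v => x v * g ^ e) σ) *
        ∑ j ∈ range (min k n + 1), g ^ (e * (N - j)) =
      ∑ F : Finset V, if IsConstrainedCVCP3Solution G S k F then ∏ v ∈ F, x v else 0 := by
  have hg : g ≠ 0 := by
    rintro rfl
    rw [orderOf_zero] at hN
    omega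
  simp_rw [fun e => sum_weight G S s (pow_ne_zero (e * (n + 1)) hg) (fun v => x v * g ^ e) hs,
    sum_mul]
  rw [sum_comm]
  refine sum_congr rfl fun F _ => ?_
  have hF : #F ≤ n := hn ▸ card_le_univ F
  have hexc : excess G F ≤ n * n := hn ▸ excess_le G F
  by_cases hc : S ⊆ F ∧ (G.induce (F : Set V)).Connected
  swap
  · rw [if_neg fun h => hc ⟨h.2.2.1, h.2.2.2⟩]
    refine sum_eq_zero fun e _ => ?_
    rw [if_neg hc, zero_mul]
  -- The factor `n + 1` exceeds every possible size, so any positive excess pushes `E` above `n`.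
  -- Hence `E ≤ min k n` says both that the excess is zero and that the size is at most `k`.
  set E := #F + (n + 1) * excess G F with hE
  have hEN : E < N := by
    have : (n + 1) * excess G F ≤ (n + 1) * (n * n) := Nat.mul_le_mul_left _ hexc
    have h2 : (n + 1) * (n * n) = (n + 1) * n * n := by ring
    omega
  have h1 : ∀ e ∈ range N, ((if S ⊆ F ∧ (G.induce (F : Set V)).Connected then
        (∏ v ∈ F, x v * g ^ e) * (g ^ (e * (n + 1))) ^ excess G F else 0) *
        ∑ j ∈ range (min k n + 1), g ^ (e * (N - j))) =
      (∏ v ∈ F, x v) * ∑ j ∈ range (min k n + 1), g ^ (e * (E + (N - j))) := by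
    intro e _
    rw [if_pos hc, prod_mul_distrib, prod_const, mul_assoc, mul_assoc, mul_sum, mul_sum]
    congr 1
    refine sum_congr rfl fun j _ => ?_
    rw [← pow_mul, ← pow_mul, ← pow_add, ← pow_add, hE]
    congr 1
    ring
  -- The power `g ^ (e * (N - j))` stands for `g ^ (-e * j)`. As `E` and `j` are below `N`, the only
  -- multiple of `N` that `E + (N - j)` can equal is `N` itself.
  have h2 : ∀ j ∈ range (min k n + 1), (∑ e ∈ range N, g ^ (e * (E + (N - j)))) =
      if E = j then 1 else 0 := by
    intro j hj
    rw [sum_pow_orderOf hN hodd]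
    have hjn : j ≤ n := by
      have := mem_range.1 hj
      omega
    refine if_congr ⟨fun ⟨c, hc⟩ => ?_, fun h => ?_⟩ rfl rfl
    · have hjN : j < N := by omega
      have : c = 1 := by
        rcases Nat.lt_or_ge c 2 with h | h
        · interval_cases c
          · omega
          · rfl
        · have : N * 2 ≤ N * c := Nat.mul_le_mul_left _ h
          omega
      subst this
      omega
    · exact ⟨1, by omega⟩
  rw [sum_congr rfl h1, ← mul_sum, sum_comm, sum_congr rfl h2, sum_ite_eq]
  have h3 : E ∈ range (min k n + 1) ↔ IsConstrainedCVCP3Solution G S k F := by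
    rw [mem_range, IsConstrainedCVCP3Solution, ← excess_eq_zero_iff]
    constructor
    · intro h
      have : excess G F = 0 := by
        by_contra h0
        have : n + 1 ≤ (n + 1) * excess G F := Nat.le_mul_of_pos_right _ (Nat.pos_of_ne_zero h0)
        omega
      exact ⟨this, by omega, hc⟩
    · rintro ⟨h0, h1, -⟩
      rw [hE, h0, mul_zero]
      omega
  rw [if_congr h3 rfl rfl]
  split_ifs <;> simp

end Filter

end CutCount

/-! ### Variable elimination -/

namespace Elimination

open Finset

variable {K : Type*} [CommSemiring K]

section Messages

variable (loc : ℕ → (ℕ → ℕ) → K) (par : ℕ → ℕ)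

/-- The sum over the states of the variables below `i` in the elimination forest. -/
def msg (i : ℕ) (σ : ℕ → ℕ) : K :=
  ∑ c ∈ range 4, loc i (Function.update σ i c) *
    ∏ j : Fin i, if par j = i then msg j (Function.update σ i c) else 1
termination_by i

theorem msg_eq (i : ℕ) (σ : ℕ → ℕ) : msg loc par i σ =
    ∑ c ∈ range 4, loc i (Function.update σ i c) *
      ∏ j ∈ range i, if par j = i then msg loc par j (Function.update σ i c) else 1 := by
  rw [msg]
  refine sum_congr rfl fun c _ => ?_
  rw [Fin.prod_univ_eq_prod_range
    (fun j => if par j = i then msg loc par j (Function.update σ i c) else 1) i]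

/-- The hypotheses on an elimination order: `R i j` means that `j` is a later neighbour of `i`. -/
structure Scheme (n : ℕ) (R : ℕ → ℕ → Prop) : Prop where
  lt : ∀ i j, R i j → i < j ∧ j < n
  clique : ∀ i j k, R i j → R i k → j < k → R j k
  par_le : ∀ i j, R i j → par i ≤ j
  lt_par : ∀ i < n, i < par i
  par_le_n : ∀ i < n, par i ≤ n
  par_rel : ∀ i < n, par i < n → R i (par i)
  loc_congr : ∀ i < n, ∀ σ σ' : ℕ → ℕ, σ i = σ' i → (∀ j, R i j → σ j = σ' j) → loc i σ = loc i σ'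

variable {loc par} {n : ℕ} {R : ℕ → ℕ → Prop} (h : Scheme loc par n R)
include h

/-- A message depends only on the later neighbours of its vertex. For a child `j` of `i`, the parent
`i` is its first later neighbour, so by `clique` its other later neighbours are later neighbours of
`i`. -/
theorem Scheme.msg_congr {i : ℕ} (hi : i < n) {σ σ' : ℕ → ℕ} (hσ : ∀ j, R i j → σ j = σ' j) :
    msg loc par i σ = msg loc par i σ' := by
  induction i using Nat.strong_induction_on generalizing σ σ' with
  | _ i ih =>
    have hup : ∀ c j, (j = i ∨ R i j) → Function.update σ i c j = Function.update σ' i c j := by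
      intro c j hj
      by_cases hji : j = i
      · subst hji
        simp
      · rw [Function.update_of_ne hji, Function.update_of_ne hji]
        exact hσ j (hj.resolve_left hji)
    rw [msg_eq, msg_eq]
    refine sum_congr rfl fun c _ => ?_
    rw [h.loc_congr i hi _ _ (hup c i (.inl rfl)) fun j hj => hup c j (.inr hj)]
    congr 1
    refine prod_congr rfl fun j hj => ?_
    have hji := mem_range.1 hj
    split_ifs with hp
    · have hji' := h.par_rel j (by omega) (by omega)
      rw [hp] at hji'
      refine ih j hji (by omega) fun k hk => hup c k ?_
      rcases (h.par_le j k hk).eq_or_lt with h1 | h1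
      · exact .inl (by omega)
      · exact .inr (h.clique j i k hji' hk (by omega))
    · rfl

/-- The recursion for assignments that agree on the relevant variables. -/
theorem Scheme.msg_eq_of_agree {i : ℕ} (hi : i < n) {σ : ℕ → ℕ} (ρ : ℕ → ℕ → ℕ)
    (hρ : ∀ c < 4, ρ c i = c) (hρ' : ∀ c < 4, ∀ j, R i j → ρ c j = σ j) :
    msg loc par i σ = ∑ c ∈ range 4, loc i (ρ c) *
      ∏ j ∈ range i, if par j = i then msg loc par j (ρ c) else 1 := by
  rw [msg_eq]
  refine sum_congr rfl fun c hc => ?_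
  have hc := mem_range.1 hc
  have hup : ∀ j, (j = i ∨ R i j) → Function.update σ i c j = ρ c j := by
    rintro j (rfl | hj)
    · rw [Function.update_self, hρ c hc]
    · rw [Function.update_of_ne (h.lt i j hj).1.ne', hρ' c hc j hj]
  rw [h.loc_congr i hi _ _ (hup i (.inl rfl)) fun j hj => hup j (.inr hj)]
  congr 1
  refine prod_congr rfl fun j hj => ?_
  have hji := mem_range.1 hj
  split_ifs with hp
  · have hji' := h.par_rel j (by omega) (by omega)
    rw [hp] at hji'
    refine h.msg_congr (by omega) fun k hk => hup k ?_
    rcases (h.par_le j k hk).eq_or_lt with h1 | h1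
    · exact .inl (by omega)
    · exact .inr (h.clique j i k hji' hk (by omega))
  · rfl

omit h in
/-- The assignment that extends `τ` by `σ`. -/
def extend {i : ℕ} (τ : Fin i → Fin 4) (σ : ℕ → ℕ) (j : ℕ) : ℕ :=
  if hj : j < i then τ ⟨j, hj⟩ else σ j

/-- The invariant of elimination: once the first `i` variables are summed out, what remains are the
local factors of the others and the messages whose receiver has not been eliminated yet. -/
theorem Scheme.sum_eq_partial (i : ℕ) (hi : i ≤ n) (σ : ℕ → ℕ) :
    ∑ τ : Fin i → Fin 4, ∏ j ∈ range n, loc j (extend τ σ) =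
      (∏ j ∈ Ico i n, loc j σ) * ∏ j ∈ range i, if i ≤ par j then msg loc par j σ else 1 := by
  induction i generalizing σ with
  | zero =>
    rw [Fintype.sum_unique, range_zero, prod_empty, mul_one, Nat.Ico_zero_eq_range]
    rfl
  | succ i ih =>
    have hin : i < n := hi
    have h1 : ∑ τ : Fin (i + 1) → Fin 4, ∏ j ∈ range n, loc j (extend τ σ) =
        ∑ c : Fin 4, ∑ τ : Fin i → Fin 4,
          ∏ j ∈ range n, loc j (extend τ (Function.update σ i c)) := by
      rw [← Fintype.sum_prod_type']
      symm
      refine Fintype.sum_equiv (Fin.snocEquiv fun _ => Fin 4) _ _ fun ⟨c, τ⟩ => ?_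
      refine prod_congr rfl fun j _ => ?_
      congr 1
      funext l
      simp only [extend, Fin.snocEquiv, Equiv.coe_fn_mk]
      by_cases hl : l < i
      · rw [dif_pos hl, dif_pos (by omega)]
        have : (⟨l, by omega⟩ : Fin (i + 1)) = Fin.castSucc ⟨l, hl⟩ := rfl
        rw [this, Fin.snoc_castSucc]
      · rw [dif_neg hl]
        by_cases hli : l = i
        · subst hli
          rw [dif_pos (by omega), Function.update_self]
          have : (⟨l, by omega⟩ : Fin (l + 1)) = Fin.last l := rfl
          rw [this, Fin.snoc_last]
        · rw [dif_neg (by omega), Function.update_of_ne hli]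
    have hloc : ∀ j ∈ Ico (i + 1) n, ∀ c, loc j (Function.update σ i c) = loc j σ := by
      intro j hj c
      rw [mem_Ico] at hj
      refine h.loc_congr j hj.2 _ _ (Function.update_of_ne (by omega) _ _) fun k hk => ?_
      have := (h.lt j k hk).1
      exact Function.update_of_ne (by omega) _ _
    have h2 : ∀ c : Fin 4, (∏ j ∈ Ico i n, loc j (Function.update σ i c)) *
          (∏ j ∈ range i, if i ≤ par j then msg loc par j (Function.update σ i c) else 1) =
        ((∏ j ∈ Ico (i + 1) n, loc j σ) *
          ∏ j ∈ range i, if i + 1 ≤ par j then msg loc par j σ else 1) *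
        (loc i (Function.update σ i c) *
          ∏ j ∈ range i, if par j = i then msg loc par j (Function.update σ i c) else 1) := by
      intro c
      -- The messages addressed to `i` are consumed now. Those with a later receiver have no later
      -- neighbour `i`, so they do not change with its state.
      have h3 : (∏ j ∈ range i, if i ≤ par j then msg loc par j (Function.update σ i c) else 1) =
          (∏ j ∈ range i, if i + 1 ≤ par j then msg loc par j σ else 1) *
          ∏ j ∈ range i, if par j = i then msg loc par j (Function.update σ i c) else 1 := by
        rw [← prod_mul_distrib]
        refine prod_congr rfl fun j hj => ?_
        have hji := mem_range.1 hj
        rcases lt_trichotomy (par j) i with hlt | heq | hgt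
        · rw [if_neg (by omega), if_neg (by omega), if_neg (by omega), mul_one]
        · rw [if_pos (by omega), if_neg (by omega), if_pos heq, one_mul]
        · rw [if_pos (by omega), if_pos (by omega), if_neg (by omega), mul_one]
          refine h.msg_congr (by omega) fun k hk => ?_
          have := h.par_le j k hk
          exact Function.update_of_ne (by omega) _ _
      rw [h3, prod_eq_prod_Ico_succ_bot hin, prod_congr rfl fun j hj => hloc j hj c]
      ring
    rw [h1, Finset.sum_congr rfl fun (c : Fin 4) _ =>
      (ih hin.le (Function.update σ i c)).trans (h2 c), ← mul_sum, prod_range_succ,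
      if_pos (Nat.succ_le_of_lt (h.lt_par i hin)), msg_eq, mul_assoc,
      ← Fin.sum_univ_eq_sum_range (fun c => loc i (Function.update σ i c) *
      ∏ j ∈ range i, if par j = i then msg loc par j (Function.update σ i c) else 1)]

/-- The sum over all assignments is the product of the values at the roots. -/
theorem Scheme.sum_eq (σ : ℕ → ℕ) :
    ∑ τ : Fin n → Fin 4, ∏ j ∈ range n, loc j (extend τ σ) =
      ∏ j ∈ range n, if par j = n then msg loc par j σ else 1 := by
  rw [h.sum_eq_partial n le_rfl, Ico_self, prod_empty, one_mul]
  refine prod_congr rfl fun j hj => if_congr ?_ rfl rfl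
  have := h.par_le_n j (mem_range.1 hj)
  omega

end Messages

/-! ### Digits in base four -/

/-- The digit of `a` in base four at the position `t`. -/
def digit (a t : ℕ) : ℕ := a / 4 ^ t % 4

theorem digit_lt (a t : ℕ) : digit a t < 4 := Nat.mod_lt _ (by norm_num)

/-- The number `a` with the digit at the position `t` replaced by `c`. -/
def setDigit (a t c : ℕ) : ℕ := a - digit a t * 4 ^ t + c * 4 ^ t

/-- Separating the parts above and below the digit shows that the truncated subtraction in
`setDigit` never truncates. -/
theorem setDigit_eq (a t c : ℕ) :
    setDigit a t c = a / (4 ^ t * 4) * (4 ^ t * 4) + c * 4 ^ t + a % 4 ^ t := by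
  have h1 := Nat.div_add_mod a (4 ^ t)
  have h2 := Nat.div_add_mod (a / 4 ^ t) 4
  rw [Nat.div_div_eq_div_mul] at h2
  have h3 : a = a / (4 ^ t * 4) * (4 ^ t * 4) + digit a t * 4 ^ t + a % 4 ^ t := by
    rw [digit]
    calc a = 4 ^ t * (a / 4 ^ t) + a % 4 ^ t := h1.symm
      _ = 4 ^ t * (4 * (a / (4 ^ t * 4)) + a / 4 ^ t % 4) + a % 4 ^ t := by rw [h2]
      _ = _ := by ring
  rw [setDigit]
  omega

theorem digit_setDigit (a t : ℕ) {c : ℕ} (hc : c < 4) : digit (setDigit a t c) t = c := by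
  rw [digit, setDigit_eq]
  have : (a / (4 ^ t * 4) * (4 ^ t * 4) + c * 4 ^ t + a % 4 ^ t) =
      a % 4 ^ t + 4 ^ t * (4 * (a / (4 ^ t * 4)) + c) := by ring
  rw [this, Nat.add_mul_div_left _ _ (by positivity), Nat.div_eq_of_lt (Nat.mod_lt _ (by positivity)),
    zero_add, Nat.mul_add_mod, Nat.mod_eq_of_lt hc]

theorem digit_setDigit_of_ne (a : ℕ) {t t' c : ℕ} (hc : c < 4) (h : t' ≠ t) :
    digit (setDigit a t c) t' = digit a t' := by
  rw [digit, digit, setDigit_eq]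
  have hlt : c * 4 ^ t + a % 4 ^ t < 4 ^ t * 4 := by
    have := Nat.mod_lt a (show 0 < 4 ^ t by positivity)
    have : c * 4 ^ t ≤ 3 * 4 ^ t := Nat.mul_le_mul_right _ (by omega)
    omega
  rcases lt_or_gt_of_ne h with h | h
  · obtain ⟨r, rfl⟩ := Nat.exists_eq_add_of_lt h
    have e1 : 4 ^ (t' + r + 1) = 4 ^ t' * 4 * 4 ^ r := by ring
    rw [← Nat.mod_mul_right_div_self, ← Nat.mod_mul_right_div_self]
    congr 1
    have : (a / (4 ^ (t' + r + 1) * 4) * (4 ^ (t' + r + 1) * 4) + c * 4 ^ (t' + r + 1) +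
        a % 4 ^ (t' + r + 1)) = a % 4 ^ (t' + r + 1) +
        4 ^ t' * 4 * (4 ^ r * (a / (4 ^ (t' + r + 1) * 4) * 4 + c)) := by
      rw [e1]; ring
    rw [this, Nat.add_mul_mod_self_left, e1, Nat.mod_mul_right_mod]
  · obtain ⟨r, rfl⟩ := Nat.exists_eq_add_of_lt h
    have e1 : 4 ^ (t + r + 1) = 4 ^ t * 4 * 4 ^ r := by ring
    rw [e1, ← Nat.div_div_eq_div_mul _ (4 ^ t * 4), ← Nat.div_div_eq_div_mul a (4 ^ t * 4) (4 ^ r)]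
    congr 2
    rw [add_assoc, mul_comm, Nat.mul_add_div (by positivity), Nat.div_eq_of_lt hlt, add_zero]

theorem setDigit_lt {a t c q : ℕ} (hc : c < 4) (ht : t < q) (ha : a < 4 ^ q) :
    setDigit a t c < 4 ^ q := by
  rw [setDigit_eq]
  obtain ⟨r, rfl⟩ := Nat.exists_eq_add_of_lt ht
  have e1 : 4 ^ (t + r + 1) = 4 ^ r * (4 ^ t * 4) := by ring
  rw [e1] at ha ⊢
  have h1 : a / (4 ^ t * 4) < 4 ^ r := Nat.div_lt_of_lt_mul (by rwa [mul_comm])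
  have h2 : c * 4 ^ t + a % 4 ^ t < 4 ^ t * 4 := by
    have := Nat.mod_lt a (show 0 < 4 ^ t by positivity)
    have : c * 4 ^ t ≤ 3 * 4 ^ t := Nat.mul_le_mul_right _ (by omega)
    omega
  have h3 : (a / (4 ^ t * 4) + 1) * (4 ^ t * 4) ≤ 4 ^ r * (4 ^ t * 4) := Nat.mul_le_mul_right _ h1
  rw [add_mul, one_mul] at h3
  omega

end Elimination

/-! ### Weights of assignments as products along an elimination order -/

namespace CutCount

open Finset Elimination

variable {K : Type*} [Field K]

/-- The state with a given number. -/
def stateOf (c : ℕ) : State := (decide (c < 2), decide (c % 2 = 1))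

/-- The states are numbered by `0, 1, 2, 3`. -/
def stateEquiv : Fin 4 ≃ State where
  toFun c := stateOf c
  invFun c := if c.1 then (if c.2 then 1 else 0) else if c.2 then 3 else 2
  left_inv := by decide
  right_inv := by decide

/-- The factor of an edge. -/
def edgeFactor (τ : K) (c c' : ℕ) : K :=
  halfEdge τ (stateOf c) (stateOf c') * halfEdge τ (stateOf c') (stateOf c)

/-- The two factors of an unordered pair are collected at its smaller element, so that every edge is
charged to the endpoint eliminated first. -/
theorem prod_prod_eq_prod_lt {M : Type*} [CommMonoid M] {n : ℕ} (f : Fin n → Fin n → M)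
    (hf : ∀ i, f i i = 1) :
    ∏ i, ∏ j, f i j = ∏ i, ∏ j, if i < j then f i j * f j i else 1 := by
  have h : ∀ i j : Fin n, (if i < j then f i j * f j i else 1) =
      (if i < j then f i j else 1) * if i < j then f j i else 1 := fun i j => by
    split_ifs <;> simp
  simp_rw [h, prod_mul_distrib]
  rw [prod_comm (f := fun i j => if i < j then f j i else 1)]
  simp_rw [← prod_mul_distrib]
  refine prod_congr rfl fun i _ => prod_congr rfl fun j _ => ?_
  rcases lt_trichotomy i j with h | h | h
  · rw [if_pos h, if_neg h.not_gt, mul_one]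
  · subst h
    simp [hf]
  · rw [if_neg h.not_gt, if_pos h, one_mul]

/-- The sum of the weights as a sum over assignments in the elimination order. -/
theorem sum_weight_eq_sum_prod {n : ℕ} (G : SimpleGraph (Fin n)) [DecidableRel G.Adj]
    (S : Finset (Fin n)) (s : Fin n) (τ : K) (x : Fin n → K) (ord : Fin n ≃ Fin n)
    (loc : ℕ → (ℕ → ℕ) → K)
    (hloc : ∀ i : Fin n, ∀ σ : ℕ → ℕ, (∀ j, σ j < 4) →
      loc i σ = vertexWeight S s τ x (ord i) (stateOf (σ i)) *
        ∏ j : Fin n, if i < j ∧ G.Adj (ord i) (ord j) then edgeFactor τ (σ i) (σ j) else 1) :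
    ∑ σ : Fin n → State, weight G S s τ x σ =
      ∑ t : Fin n → Fin 4, ∏ j ∈ range n, loc j (extend t fun _ => 0) := by
  symm
  refine Fintype.sum_equiv (Equiv.arrowCongr ord stateEquiv) _ _ fun t => ?_
  rw [← Fin.prod_univ_eq_prod_range (fun j => loc j (extend t fun _ => 0)) n, weight]
  have hlt : ∀ j, extend t (fun _ => 0) j < 4 := fun j => by
    rw [extend]
    split_ifs
    · exact Fin.is_lt _
    · omega
  have hval : ∀ i : Fin n, extend t (fun _ => 0) i = t i := fun i => by
    rw [extend, dif_pos i.2]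
  have hst : ∀ i : Fin n, Equiv.arrowCongr ord stateEquiv t (ord i) = stateOf (t i) := fun i => by
    simp [Equiv.arrowCongr, stateEquiv]
  rw [prod_congr rfl fun i _ => hloc i _ hlt, prod_mul_distrib]
  congr 1
  · rw [← ord.prod_comp fun v => vertexWeight S s τ x v (Equiv.arrowCongr ord stateEquiv t v)]
    refine prod_congr rfl fun i _ => ?_
    rw [hst, hval]
  · have hpair : ∏ v, ∏ u, (if G.Adj v u then halfEdge τ (Equiv.arrowCongr ord stateEquiv t v)
          (Equiv.arrowCongr ord stateEquiv t u) else 1) =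
        ∏ i, ∏ j, if G.Adj (ord i) (ord j) then halfEdge τ (stateOf (t i)) (stateOf (t j))
          else 1 := by
      rw [← ord.prod_comp]
      refine prod_congr rfl fun i _ => ?_
      rw [← ord.prod_comp]
      simp only [hst]
    rw [hpair, prod_prod_eq_prod_lt (fun i j => if G.Adj (ord i) (ord j) then
      halfEdge τ (stateOf (t i)) (stateOf (t j)) else 1) fun i => if_neg (G.loopless.irrefl _)]
    refine prod_congr rfl fun i _ => prod_congr rfl fun j _ => ?_
    simp only [hval, G.adj_comm (ord j) (ord i), edgeFactor]
    by_cases h1 : i < j <;> by_cases h2 : G.Adj (ord i) (ord j) <;> simp [h1, h2]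

end CutCount

/-! ### Random field elements -/

namespace RandomBits

open Finset MeasureTheory

/-- The number with the binary digits `f 0, …, f (q - 1)`, the most significant one first. -/
def bitsVal (f : ℕ → Bool) : ℕ → ℕ
  | 0 => 0
  | q + 1 => 2 * bitsVal f q + (f q).toNat

theorem bitsVal_lt (f : ℕ → Bool) (q : ℕ) : bitsVal f q < 2 ^ q := by
  induction q with
  | zero => simp [bitsVal]
  | succ q ih =>
    rw [bitsVal, pow_succ]
    have := Bool.toNat_lt (f q)
    omega

theorem bitsVal_congr {f f' : ℕ → Bool} {q : ℕ} (h : ∀ j < q, f j = f' j) :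
    bitsVal f q = bitsVal f' q := by
  induction q with
  | zero => rfl
  | succ q ih => rw [bitsVal, bitsVal, ih fun j hj => h j (by omega), h q (by omega)]

theorem bitsVal_inj {f f' : ℕ → Bool} {q : ℕ} (h : bitsVal f q = bitsVal f' q) :
    ∀ j < q, f j = f' j := by
  induction q with
  | zero => intro j hj; omega
  | succ q ih =>
    rw [bitsVal, bitsVal] at h
    have h1 := Bool.toNat_lt (f q)
    have h2 := Bool.toNat_lt (f' q)
    intro j hj
    rcases Nat.lt_succ_iff_lt_or_eq.1 hj with h3 | rfl
    · exact ih (by omega) j h3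
    · cases hb : f j <;> cases hb' : f' j <;> simp [hb, hb'] at h ⊢ <;> omega

theorem fairCoins_cylinder (L : ℕ) (b : Fin L → Bool) :
    WordRAM.fairCoins {c | ∀ l : Fin L, c l = b l} = (1 / 2) ^ L := by
  have hset : {c : ℕ → Bool | ∀ l : Fin L, c l = b l} =
      (range L : Set ℕ).pi fun l => if h : l < L then {b ⟨l, h⟩} else Set.univ := by
    ext c
    simp only [Set.mem_ofPred_eq, Set.mem_pi, coe_range, Set.mem_Iio]
    constructor
    · intro h l hl
      rw [dif_pos hl]
      exact h ⟨l, hl⟩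
    · intro h l
      have := h l l.2
      rw [dif_pos l.2] at this
      exact this
  have : ∀ c : Bool, (PMF.uniformOfFintype Bool).toMeasure {c} = 1 / 2 := by
    intro c
    rw [PMF.toMeasure_apply_singleton _ _ (measurableSet_singleton c)]
    simp
  rw [hset, WordRAM.fairCoins, Measure.infinitePi_pi _ fun l _ => by
    split_ifs
    exacts [measurableSet_singleton _, MeasurableSet.univ]]
  rw [prod_congr rfl fun l hl => by rw [dif_pos (mem_range.1 hl), this], prod_const, card_range]

/-- The random field elements drawn from the random bits. -/
def elements {K : Type} (val : ℕ → K) (n q : ℕ) (c : ℕ → Bool) (i : Fin n) : K :=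
  val (bitsVal (fun j => c (i * q + j)) q)

variable {K : Type} [Field K] [Fintype K]

/-- Only the first `n * q` bits matter, and different bit strings give different points. By
Schwartz–Zippel at most a fraction `n / 2 ^ q ≤ 1 / 2` of the strings is bad; the event is covered
by their cylinders, each of measure `(1 / 2) ^ (n * q)`. -/
theorem fairCoins_eval_eq_zero_le {val : ℕ → K} {n q : ℕ}
    (hval : Set.BijOn val {a | a < 2 ^ q} Set.univ) (hcard : Fintype.card K = 2 ^ q)
    (hq : 2 * n ≤ 2 ^ q) {p : MvPolynomial (Fin n) K} (hp : p ≠ 0) (hdeg : p.totalDegree ≤ n) :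
    WordRAM.fairCoins {c | MvPolynomial.eval (elements val n q c) p = 0} ≤ 1 / 2 := by
  classical
  let ext : (Fin (n * q) → Bool) → ℕ → Bool := fun b l => if h : l < n * q then b ⟨l, h⟩ else false
  let bad : Finset (Fin (n * q) → Bool) := {b | MvPolynomial.eval (elements val n q (ext b)) p = 0}
  have hidx : ∀ (i : Fin n) j, j < q → i * q + j < n * q := fun i j hj =>
    calc (i : ℕ) * q + j < (i + 1) * q := by rw [add_mul, one_mul]; omega
      _ ≤ n * q := Nat.mul_le_mul_right _ i.2
  have hsub : {c | MvPolynomial.eval (elements val n q c) p = 0} ⊆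
      ⋃ b ∈ bad, {c | ∀ l : Fin (n * q), c l = b l} := by
    intro c hc
    simp only [Set.mem_iUnion]
    refine ⟨fun l => c l, ?_, fun _ => rfl⟩
    simp only [bad, mem_filter, mem_univ, true_and]
    rw [Set.mem_ofPred_eq] at hc
    rw [← hc]
    congr 2
    funext i
    simp only [elements]
    congr 1
    refine bitsVal_congr fun j hj => ?_
    simp only [ext]
    rw [dif_pos (hidx i j hj)]
  have hinj : Set.InjOn (fun b => elements val n q (ext b)) (bad : Set (Fin (n * q) → Bool)) := by
    intro b _ b' _ h
    funext l
    have hl := l.2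
    have hq0 : 0 < q := Nat.pos_of_mul_pos_left (l.1.zero_le.trans_lt hl)
    have hi : l / q < n := Nat.div_lt_of_lt_mul (hl.trans_eq (mul_comm _ _))
    have h1 := congrFun h ⟨l / q, hi⟩
    have h2 := hval.injOn (bitsVal_lt _ q) (bitsVal_lt _ q) h1
    have h3 := bitsVal_inj h2 (l % q) (Nat.mod_lt _ hq0)
    have h4 : l / q * q + l % q = l := Nat.div_add_mod' _ _
    simpa only [h4, ext, hl, dif_pos] using h3
  have hbad : #bad ≤ #{f ∈ Fintype.piFinset fun _ : Fin n => (univ : Finset K) |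
      MvPolynomial.eval f p = 0} := by
    refine card_le_card_of_injOn (fun b => elements val n q (ext b)) (fun b hb => ?_) hinj
    simp only [bad, coe_filter, mem_univ, true_and, Set.mem_ofPred_eq] at hb
    simpa using hb
  have hsz := MvPolynomial.schwartz_zippel_totalDegree hp (univ : Finset K)
  rw [card_univ, hcard] at hsz
  have hcount : 2 * #bad ≤ 2 ^ (n * q) := by
    set Z := #{f ∈ Fintype.piFinset fun _ : Fin n => (univ : Finset K) | MvPolynomial.eval f p = 0}
    have hpos : (0 : ℚ≥0) < ((2 ^ q : ℕ) : ℚ≥0) := by positivity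
    have h1 : (Z : ℚ≥0) / ((2 ^ q : ℕ) : ℚ≥0) ^ n ≤ 1 / 2 := by
      refine hsz.trans ?_
      rw [div_le_div_iff₀ hpos (by norm_num)]
      have : p.totalDegree * 2 ≤ 1 * 2 ^ q := by omega
      exact_mod_cast this
    rw [div_le_div_iff₀ (by positivity) (by norm_num)] at h1
    have h2 : Z * 2 ≤ 1 * (2 ^ q) ^ n := by exact_mod_cast h1
    rw [← pow_mul, mul_comm q] at h2
    omega
  calc _ ≤ WordRAM.fairCoins (⋃ b ∈ bad, {c | ∀ l : Fin (n * q), c l = b l}) := measure_mono hsub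
    _ ≤ ∑ b ∈ bad, WordRAM.fairCoins {c | ∀ l : Fin (n * q), c l = b l} :=
        measure_biUnion_finset_le _ _
    _ = #bad * (1 / 2) ^ (n * q) := by
        simp_rw [fairCoins_cylinder, sum_const, nsmul_eq_mul]
    _ ≤ 1 / 2 := by
        have h1 : ((2 * #bad : ℕ) : ENNReal) ≤ ((2 ^ (n * q) : ℕ) : ENNReal) := by
          exact_mod_cast hcount
        push_cast at h1
        have h2 : (2 : ENNReal) * (#bad * (1 / 2) ^ (n * q)) ≤ 1 := by
          calc (2 : ENNReal) * (#bad * (1 / 2) ^ (n * q)) = (2 * #bad) * (1 / 2) ^ (n * q) := by ring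
            _ ≤ 2 ^ (n * q) * (1 / 2) ^ (n * q) := by gcongr
            _ = 1 := by
              rw [← mul_pow, one_div, ENNReal.mul_inv_cancel (by norm_num) (by norm_num), one_pow]
        rw [ENNReal.le_div_iff_mul_le (by norm_num) (by norm_num), mul_comm]
        exact h2

end RandomBits

/-! ### The solution polynomial -/

namespace CutCount

open Finset

open Classical in
/-- The polynomial whose monomials are the solutions. -/
noncomputable def solutionPoly (K : Type) [Field K] {n : ℕ} (G : SimpleGraph (Fin n))
    (S : Finset (Fin n)) (k : ℕ) (ord : Fin n ≃ Fin n) : MvPolynomial (Fin n) K :=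
  ∑ F : Finset (Fin n), if IsConstrainedCVCP3Solution G S k F then
    ∏ v ∈ F, MvPolynomial.X (ord.symm v) else 0

variable {K : Type} [Field K] {n : ℕ} (G : SimpleGraph (Fin n)) (S : Finset (Fin n)) (k : ℕ)
  (ord : Fin n ≃ Fin n)

open Classical in
theorem eval_solutionPoly (x : Fin n → K) : MvPolynomial.eval x (solutionPoly K G S k ord) =
    ∑ F : Finset (Fin n), if IsConstrainedCVCP3Solution G S k F then
      ∏ v ∈ F, x (ord.symm v) else 0 := by
  rw [solutionPoly, map_sum]
  refine sum_congr rfl fun F _ => ?_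
  split_ifs <;> simp

/-- At the indicator of a smallest solution `F₀` the monomial of `F` survives only if `F ⊆ F₀`, and
by minimality only `F₀` itself does, so the value is `1`. -/
theorem solutionPoly_ne_zero (h : ∃ F, IsConstrainedCVCP3Solution G S k F) :
    solutionPoly K G S k ord ≠ 0 := by
  classical
  have hne : ({F | IsConstrainedCVCP3Solution G S k F} : Finset (Finset (Fin n))).Nonempty :=
    h.imp fun F hF => by simpa using hF
  obtain ⟨F₀, hF₀, hmin⟩ := exists_min_image _ (fun F => #F) hne
  simp only [mem_filter, mem_univ, true_and] at hF₀ hmin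
  intro h0
  have := eval_solutionPoly (K := K) G S k ord fun i => if ord i ∈ F₀ then 1 else 0
  rw [h0, map_zero, sum_eq_single F₀] at this
  · rw [if_pos hF₀, prod_eq_one] at this
    · exact zero_ne_one this
    · intro v hv
      simp [hv]
  · intro F _ hF
    split_ifs with hs
    swap
    · rfl
    have : ¬ F ⊆ F₀ := fun hsub => hF (eq_of_subset_of_card_le hsub (hmin F hs))
    obtain ⟨v, hv, hv'⟩ := not_subset.1 this
    exact prod_eq_zero hv (by simp [hv'])
  · simp

theorem totalDegree_solutionPoly_le : (solutionPoly K G S k ord).totalDegree ≤ n := by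
  classical
  refine (MvPolynomial.totalDegree_finsetSum _ _).trans (Finset.sup_le fun F _ => ?_)
  split_ifs
  · refine (MvPolynomial.totalDegree_finsetProd _ _).trans ?_
    simp only [MvPolynomial.totalDegree_X, sum_const, smul_eq_mul, mul_one]
    exact (card_le_univ F).trans_eq (Fintype.card_fin n)
  · simp

end CutCount

set_option linter.constructorNameAsVariable false

/-! ### Determinism of the machine -/

namespace WordRAM

/-- The machine is deterministic: the random bits are part of the configuration. -/
theorem Exec.deterministic {w : ℕ} {P : Program} {s s₁ s₂ : Config} {t₁ t₂ : ℕ}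
    (h₁ : Exec w P s t₁ s₁) (h₂ : Exec w P s t₂ s₂) : t₁ = t₂ ∧ s₁ = s₂ := by
  induction h₁ generalizing t₂ s₂ with
  | skip | const | op | load | store | flip => cases h₂; exact ⟨rfl, rfl⟩
  | seq _ _ ih₁ ih₂ =>
    cases h₂ with
    | seq a b => obtain ⟨rfl, rfl⟩ := ih₁ a; obtain ⟨rfl, rfl⟩ := ih₂ b; exact ⟨rfl, rfl⟩
  | ite_true h _ ih =>
    cases h₂ with
    | ite_true _ a => obtain ⟨rfl, rfl⟩ := ih a; exact ⟨rfl, rfl⟩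
    | ite_false h' => exact absurd h' h
  | ite_false h _ ih =>
    cases h₂ with
    | ite_true h' => exact absurd h h'
    | ite_false _ a => obtain ⟨rfl, rfl⟩ := ih a; exact ⟨rfl, rfl⟩
  | while_true h _ _ ih₁ ih₂ =>
    cases h₂ with
    | while_true _ a b => obtain ⟨rfl, rfl⟩ := ih₁ a; obtain ⟨rfl, rfl⟩ := ih₂ b; exact ⟨rfl, rfl⟩
    | while_false h' => exact absurd h' h
  | while_false h =>
    cases h₂ with
    | while_true h' => exact absurd h h'
    | while_false => exact ⟨rfl, rfl⟩

/-- With this, a single run whose answer is known controls every run on the same random bits, as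
both error bounds require. -/
theorem Answers.deterministic {w : ℕ} {P : Program} {input : List ℕ} {coins : ℕ → Bool}
    {t₁ t₂ : ℕ} {b₁ b₂ : Bool} (h₁ : Answers w P input coins t₁ b₁)
    (h₂ : Answers w P input coins t₂ b₂) : b₁ = b₂ := by
  obtain ⟨s₁, e₁, rfl⟩ := h₁
  obtain ⟨s₂, e₂, rfl⟩ := h₂
  rw [(e₁.deterministic e₂).2]

end WordRAM

/-! ### A language of bounded loops over named variables and arrays -/

namespace Loop

open WordRAM

/-- The names of the variables. -/
inductive Var
  | ans | n | m | k | root | bd | fs | q | N | t | i | j | x | b | cur | sz | par | pp | psz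
  | u | v | sub | j2 | best | simp | u2 | r | d | flag | sl | Q | TS | pol | s | cand | si | kk
  | e | hs | ti | wx | ix | c | pr | id2 | tot | res | acc | g
  deriving DecidableEq

/-- The names of the arrays. -/
inductive Arr
  | X | PTR | MARK | H | DEAD | ORD | HO | GO | SLOT | PAR | PW | EXP | LOG | SB | EDG | WT | TBL
  deriving DecidableEq

theorem Var.ctorIdx_inj {x y : Var} : x.ctorIdx = y.ctorIdx ↔ x = y :=
  ⟨fun h => by rw [← Var.ofNat_ctorIdx x, h, Var.ofNat_ctorIdx], fun h => h ▸ rfl⟩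

theorem Arr.ctorIdx_inj {x y : Arr} : x.ctorIdx = y.ctorIdx ↔ x = y :=
  ⟨fun h => by rw [← Arr.ofNat_ctorIdx x, h, Arr.ofNat_ctorIdx], fun h => h ▸ rfl⟩

/-- The arrays are interleaved in the memory with stride `32`; as there are fewer of them, their
cells never collide. -/
theorem Arr.ctorIdx_lt (x : Arr) : x.ctorIdx < 32 := by cases x <;> decide

/-- Expressions. -/
inductive Expr
  | lit (c : ℕ)
  | var (x : Var)
  | op (o : BinOp) (e₁ e₂ : Expr)
  | get (c : Arr) (e : Expr)

instance : Coe Var Expr := ⟨.var⟩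
instance (c : ℕ) : OfNat Expr c := ⟨.lit c⟩
instance : Add Expr := ⟨.op .add⟩
instance : Sub Expr := ⟨.op .sub⟩
instance : Mul Expr := ⟨.op .mul⟩
instance : Div Expr := ⟨.op .div⟩
instance : Mod Expr := ⟨.op .mod⟩

/-- Bitwise exclusive or. -/
abbrev Expr.bxor (a b : Expr) : Expr := .op .xor a b
/-- The test `a = b`. -/
abbrev Expr.eq (a b : Expr) : Expr := .op .eq a b
/-- The test `a < b`. -/
abbrev Expr.lt (a b : Expr) : Expr := .op .lt a b

/-- Statements. The body of a loop `loop x e P` is executed for `x = 0, …, e - 1`. -/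
inductive Stmt
  | skip
  | set (x : Var) (e : Expr)
  | put (c : Arr) (e₁ e₂ : Expr)
  | inp (x : Var) (e : Expr)
  | flip (x : Var)
  | seq (P Q : Stmt)
  | ite (e : Expr) (P Q : Stmt)
  | loop (x : Var) (e : Expr) (P : Stmt)

infixr:30 " ;; " => Stmt.seq

/-- States. -/
structure St where
  v : Var → ℕ
  a : Arr → ℕ → ℕ
  coins : ℕ → Bool

/-- Assignment to a variable. -/
def St.setV (s : St) (x : Var) (c : ℕ) : St := { s with v := Function.update s.v x c }

/-- Assignment to an array cell. -/
def St.setA (s : St) (c : Arr) (i y : ℕ) : St :=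
  { s with a := Function.update s.a c (Function.update (s.a c) i y) }

/-- Moving the first unused random bit into a variable. -/
def St.flip (s : St) (x : Var) : St :=
  { s.setV x (s.coins 0).toNat with coins := fun i => s.coins (i + 1) }

/-- The value of an expression. -/
def Expr.eval (s : St) : Expr → ℕ
  | .lit c => c
  | .var x => s.v x
  | .op o e₁ e₂ => o.eval (e₁.eval s) (e₂.eval s)
  | .get c e => s.a c (e.eval s)

/-- The read-only data of a run: values are smaller than `2 ^ b`, and the input `I` occupies the
addresses below `base`. -/
structure Env where
  b : ℕ
  base : ℕ
  I : ℕ → ℕ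
  I_lt : ∀ i, I i < 2 ^ b
  b_pos : 1 ≤ b
  base_lt : base < 2 ^ b

/-- The strict bound on the values. -/
abbrev Env.B (E : Env) : ℕ := 2 ^ E.b

/-- The state after `i` rounds of a loop. -/
def iter (f : St → St) (x : Var) (s : St) : ℕ → St
  | 0 => s
  | i + 1 => f ((iter f x s i).setV x i)

/-- The effect of a statement. -/
def run (E : Env) : Stmt → St → St
  | .skip, s => s
  | .set x e, s => s.setV x (e.eval s)
  | .put c e₁ e₂, s => s.setA c (e₁.eval s) (e₂.eval s)
  | .inp x e, s => s.setV x (E.I (e.eval s))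
  | .flip x, s => s.flip x
  | .seq P Q, s => run E Q (run E P s)
  | .ite e P Q, s => if e.eval s ≠ 0 then run E P s else run E Q s
  | .loop x e P, s => iter (run E P) x s (e.eval s)

/-- The number of executed statements. -/
def cost (E : Env) : Stmt → St → ℕ
  | .skip, _ | .set _ _, _ | .put _ _ _, _ | .inp _ _, _ | .flip _, _ => 1
  | .seq P Q, s => cost E P s + cost E Q (run E P s)
  | .ite e P Q, s => (if e.eval s ≠ 0 then cost E P s else cost E Q s) + 1
  | .loop x e P, s =>
    (∑ i ∈ Finset.range (e.eval s), (cost E P ((iter (run E P) x s i).setV x i) + 1)) + 1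

/-- All assigned values are in range. -/
def ok (E : Env) : Stmt → St → Prop
  | .skip, _ | .flip _, _ => True
  | .set _ e, s => e.eval s < E.B
  | .put _ _ e, s => e.eval s < E.B
  | .inp _ e, s => e.eval s < E.base
  | .seq P Q, s => ok E P s ∧ ok E Q (run E P s)
  | .ite e P Q, s => if e.eval s ≠ 0 then ok E P s else ok E Q s
  | .loop x e P, s => e.eval s ≤ E.B ∧
      ∀ i < e.eval s, ok E P ((iter (run E P) x s i).setV x i)

/-- All values in the state are in range. -/
def Bdd (E : Env) (s : St) : Prop := (∀ x, s.v x < E.B) ∧ ∀ c i, s.a c i < E.B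

variable {E : Env}

theorem Bdd.setV {s : St} (h : Bdd E s) (x : Var) {c : ℕ} (hc : c < E.B) :
    Bdd E (s.setV x c) := by
  refine ⟨fun y => ?_, h.2⟩
  simp only [St.setV, Function.update_apply]
  split_ifs
  exacts [hc, h.1 y]

theorem Bdd.setA {s : St} (h : Bdd E s) (c : Arr) (i : ℕ) {y : ℕ} (hy : y < E.B) :
    Bdd E (s.setA c i y) := by
  refine ⟨h.1, fun d j => ?_⟩
  simp only [St.setA, Function.update_apply]
  split_ifs
  · simp only [Function.update_apply]; split_ifs; exacts [hy, h.2 c j]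
  · exact h.2 d j

theorem Bdd.run {P : Stmt} {s : St} (h : Bdd E s)
    (hok : ok E P s) : Bdd E (run E P s) := by
  induction P generalizing s with
  | skip => exact h
  | set x e => exact h.setV x hok
  | put c e₁ e₂ => exact h.setA c _ hok
  | inp x e => exact h.setV x (E.I_lt _)
  | flip x =>
    have := h.setV x (c := (s.coins 0).toNat)
      ((Bool.toNat_lt _).trans_le (Nat.le_self_pow (by have := E.b_pos; omega) 2))
    exact ⟨this.1, this.2⟩
  | seq P Q ihP ihQ => exact ihQ (ihP h hok.1) hok.2
  | ite e P Q ihP ihQ =>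
    simp only [Loop.run, ok] at hok ⊢
    split_ifs at hok ⊢ with h'
    exacts [ihP h hok, ihQ h hok]
  | loop x e P ih =>
    simp only [Loop.run]
    have : ∀ i ≤ e.eval s, Bdd E (iter (Loop.run E P) x s i) := by
      intro i
      induction i with
      | zero => exact fun _ => h
      | succ i ih' =>
        intro hi
        exact ih ((ih' (by omega)).setV x (by have := hok.1; omega)) (hok.2 i (by omega))
    exact this _ le_rfl

/-! ### Compilation -/

/-- The register of a variable. -/
abbrev Var.reg (x : Var) : ℕ := 2 * x.ctorIdx

/-- The registers of the compiler. -/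
abbrev tmp (d : ℕ) : ℕ := 2 * d + 3

/-- Code that replaces the index in `tmp d` by the address of that cell of the array `c`. -/
def Arr.addr (c : Arr) (d : ℕ) : Program :=
  .seq (.const (tmp (d + 1)) 32) (.seq (.op .mul (tmp d) (tmp d) (tmp (d + 1)))
    (.seq (.const (tmp (d + 1)) c.ctorIdx) (.seq (.op .add (tmp d) (tmp d) (tmp (d + 1)))
      (.op .add (tmp d) 1 (tmp d)))))

/-- Code that evaluates an expression into the register `tmp d`. -/
def Expr.compile : Expr → ℕ → Program
  | .lit c, d => .const (tmp d) c
  | .var x, d => .op .or (tmp d) x.reg x.reg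
  | .op o e₁ e₂, d =>
    .seq (e₁.compile d) (.seq (e₂.compile (d + 1)) (.op o (tmp d) (tmp d) (tmp (d + 1))))
  | .get c e, d =>
    .seq (e.compile d) (.seq (c.addr d) (.load (tmp d) (tmp d)))

/-- Code for a statement that uses the registers `tmp d, tmp (d + 1), …`. -/
def Stmt.compile : Stmt → ℕ → Program
  | .skip, _ => .skip
  | .set x e, d => .seq (e.compile d) (.op .or x.reg (tmp d) (tmp d))
  | .put c e₁ e₂, d =>
    .seq (e₁.compile d) (.seq (c.addr d) (.seq (e₂.compile (d + 1))
      (.store (tmp d) (tmp (d + 1)))))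
  | .inp x e, d => .seq (e.compile d) (.load x.reg (tmp d))
  | .flip x, _ => .flip x.reg
  | .seq P Q, d => .seq (P.compile d) (Q.compile d)
  | .ite e P Q, d => .seq (e.compile d) (.ite (tmp d) (P.compile d) (Q.compile d))
  | .loop x e P, d =>
    .seq (e.compile d) (.seq (.const (tmp (d + 1)) 0)
      (.seq (.op .lt (tmp (d + 2)) (tmp (d + 1)) (tmp d))
        (.while (tmp (d + 2))
          (.seq (.op .or x.reg (tmp (d + 1)) (tmp (d + 1)))
          (.seq (P.compile (d + 3))
          (.seq (.const (tmp (d + 2)) 1)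
          (.seq (.op .add (tmp (d + 1)) (tmp (d + 1)) (tmp (d + 2)))
            (.op .lt (tmp (d + 2)) (tmp (d + 1)) (tmp d)))))))))

/-- The intermediate values of the evaluation of `e` are smaller than `B ^ e.deg`. -/
def Expr.deg : Expr → ℕ
  | .lit c => c + 1
  | .var _ => 1
  | .op _ e₁ e₂ => e₁.deg + e₂.deg + 1
  | .get _ e => e.deg + 15

/-- The time of the evaluation of `e`. -/
def Expr.time : Expr → ℕ
  | .lit _ => 1
  | .var _ => 1
  | .op _ e₁ e₂ => e₁.time + e₂.time + 1
  | .get _ e => e.time + 6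

/-- A bound on the degrees of the values in the compiled code, as polynomials in the bound on the
values. -/
def Stmt.deg : Stmt → ℕ
  | .skip | .flip _ => 1
  | .set _ e | .inp _ e => e.deg + 1
  | .put _ e₁ e₂ => e₁.deg + e₂.deg + 15
  | .seq P Q => P.deg + Q.deg
  | .ite e P Q => e.deg + P.deg + Q.deg
  | .loop _ e P => e.deg + P.deg + 3

/-- The slowdown of the compiled code. -/
def Stmt.slowdown : Stmt → ℕ
  | .skip | .flip _ => 1
  | .set _ e | .inp _ e => e.time + 1
  | .put _ e₁ e₂ => e₁.time + e₂.time + 6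
  | .seq P Q => P.slowdown + Q.slowdown
  | .ite e P Q => e.time + P.slowdown + Q.slowdown + 1
  | .loop _ e P => e.time + P.slowdown + 5

/-- The relation between a state and a configuration that represents it. -/
structure Sim (E : Env) (s : St) (σ : Config) : Prop where
  reg : ∀ x : Var, σ.reg x.reg = s.v x
  mem : ∀ (c : Arr) i, σ.mem (E.base + 32 * i + c.ctorIdx) = s.a c i
  inp : ∀ i < E.base, σ.mem i = E.I i
  base : σ.reg 1 = E.base
  coins : σ.coins = s.coins

end Loop

/-! ### Correctness of the compiler -/

namespace Loop

open WordRAM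

variable {E : Env}

/-- Variables live in the even registers and the base address in register `1`, while the temporaries
are odd and at least `3`; changing temporaries is invisible to the state. -/
theorem Sim.of_reg {s : St} {σ : Config} (h : Sim E s σ) {d : ℕ} {r : ℕ → ℕ}
    (hr : ∀ x, (∀ j ≥ d, x ≠ tmp j) → r x = σ.reg x) : Sim E s { σ with reg := r } where
  reg x := by rw [← h.reg x]; exact hr _ fun j _ => by simp only [Var.reg, tmp]; omega
  mem := h.mem
  inp := h.inp
  base := by rw [← h.base]; exact hr _ fun j _ => by simp only [tmp]; omega
  coins := h.coins

theorem Expr.one_le_deg (e : Expr) : 1 ≤ e.deg := by cases e <;> simp [Expr.deg]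

/-- Products add the degrees. The extra `1` pays for a factor of two, which suffices for sums and
comparisons; the bitwise operations stay within the number of bits. -/
theorem binOp_lt {b : ℕ} (hb : 1 ≤ b) (o : BinOp) {x y i j : ℕ} (hx : x < (2 ^ b) ^ i)
    (hy : y < (2 ^ b) ^ j) : o.eval x y < (2 ^ b) ^ (i + j + 1) := by
  have h2 : 2 ≤ 2 ^ b := Nat.le_self_pow (by omega) 2
  have hx' : x < (2 ^ b) ^ (i + j) := hx.trans_le (Nat.pow_le_pow_right (by omega) (by omega))
  have hy' : y < (2 ^ b) ^ (i + j) := hy.trans_le (Nat.pow_le_pow_right (by omega) (by omega))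
  have h1 : 1 ≤ (2 ^ b) ^ (i + j) := Nat.one_le_pow _ _ (by omega)
  have hs : 2 * (2 ^ b) ^ (i + j) ≤ (2 ^ b) ^ (i + j + 1) := by
    rw [pow_succ]; nlinarith
  cases o <;> simp only [BinOp.eval]
  · omega
  · omega
  · calc x * y < (2 ^ b) ^ i * (2 ^ b) ^ j := Nat.mul_lt_mul'' hx hy
      _ = (2 ^ b) ^ (i + j) := (pow_add _ _ _).symm
      _ ≤ _ := by omega
  · exact (Nat.div_le_self _ _).trans_lt (by omega)
  · exact (Nat.mod_le _ _).trans_lt (by omega)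
  · exact (Nat.and_le_left).trans_lt (by omega)
  · have : x ||| y < _ := Nat.or_lt_two_pow (n := b * (i + j)) (by rwa [pow_mul]) (by rwa [pow_mul])
    rw [pow_mul] at this
    omega
  · have : x ^^^ y < _ := Nat.xor_lt_two_pow (n := b * (i + j)) (by rwa [pow_mul]) (by rwa [pow_mul])
    rw [pow_mul] at this
    omega
  · split_ifs <;> omega
  · split_ifs <;> omega

theorem Expr.eval_lt {s : St} (h : Bdd E s) (e : Expr) :
    e.eval s < E.B ^ e.deg := by
  have hb := E.b_pos
  have h2 : 2 ≤ E.B := Nat.le_self_pow (by omega) 2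
  induction e with
  | lit c =>
    calc c < 2 ^ c := Nat.lt_two_pow_self
      _ ≤ 2 ^ (c + 1) := Nat.pow_le_pow_right (by omega) (by omega)
      _ ≤ _ := Nat.pow_le_pow_left h2 _
  | var x => simpa [Expr.deg, Expr.eval] using h.1 x
  | op o e₁ e₂ ih₁ ih₂ => exact binOp_lt hb o ih₁ ih₂
  | get c e ih => exact (h.2 c _).trans_le (Nat.le_self_pow (by simp [Expr.deg]) _)

/-- Base, index and array number together stay below `(1 + 32 + 32) * (2 ^ b) ^ i`; the exponent
`15` is a generous allowance for this constant. -/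
theorem addr_lt {b base x i c : ℕ} (hb : 1 ≤ b) (hx : x < (2 ^ b) ^ i) (hc : c < 32)
    (hbase : base < 2 ^ b) (hi : 1 ≤ i) : base + 32 * x + c < (2 ^ b) ^ (i + 15) := by
  have h2 : 2 ≤ 2 ^ b := Nat.le_self_pow (by omega) 2
  have h3 : 2 ^ b ≤ (2 ^ b) ^ i := Nat.le_self_pow (by omega) _
  have h4 : 2 ^ 15 ≤ (2 ^ b) ^ 15 := Nat.pow_le_pow_left h2 _
  rw [pow_add]
  have h5 : (2 ^ b) ^ i * 2 ^ 15 ≤ (2 ^ b) ^ i * (2 ^ b) ^ 15 := Nat.mul_le_mul_left _ h4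
  omega

theorem exec_op {w : ℕ} (σ : Config) {r : ℕ → ℕ} {o : BinOp} {x y z a b : ℕ} (ha : r y = a)
    (hb : r z = b) (h : o.eval a b < 2 ^ w) : Exec w (.op o x y z) { σ with reg := r } 1
      { σ with reg := Function.update r x (o.eval a b) } := by
  subst ha hb
  exact Exec.op _ _ _ _ _ h

theorem exec_const {w : ℕ} (σ : Config) {r : ℕ → ℕ} {x c : ℕ} (h : c < 2 ^ w) :
    Exec w (.const x c) { σ with reg := r } 1 { σ with reg := Function.update r x c } :=
  Exec.const _ _ _ h

theorem exec_addr (c : Arr) {b base i deg : ℕ} (hb : 1 ≤ b) (hbase : base < 2 ^ b)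
    (hi : i < (2 ^ b) ^ deg) (hdeg : 1 ≤ deg) {w : ℕ} (hw : (2 ^ b) ^ (deg + 15) ≤ 2 ^ w) (d : ℕ)
    (σ : Config) (r : ℕ → ℕ) (hr : r (tmp d) = i) (hr1 : r 1 = base) :
    ∃ r' : ℕ → ℕ, Exec w (c.addr d) { σ with reg := r } 5 { σ with reg := r' } ∧
      (∀ x, x ≠ tmp d → x ≠ tmp (d + 1) → r' x = r x) ∧
      r' (tmp d) = base + 32 * i + c.ctorIdx := by
  have h2 : 2 ≤ 2 ^ b := Nat.le_self_pow (by omega) 2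
  have hlt := (addr_lt hb hi c.ctorIdx_lt hbase hdeg).trans_le hw
  have hc := c.ctorIdx_lt
  have h32 : 32 < 2 ^ w := by
    calc 32 < 2 ^ 6 := by norm_num
      _ ≤ 2 ^ (deg + 15) := Nat.pow_le_pow_right (by omega) (by omega)
      _ ≤ (2 ^ b) ^ (deg + 15) := Nat.pow_le_pow_left h2 _
      _ ≤ _ := hw
  have n1 : tmp (d + 1) ≠ tmp d := by simp only [tmp]; omega
  have n2 : 1 ≠ tmp d := by simp only [tmp]; omega
  have n3 : 1 ≠ tmp (d + 1) := by simp only [tmp]; omega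
  refine ⟨_, .seq (exec_const σ h32) (.seq (exec_op σ (a := i) (b := 32) ?_ ?_ ?_)
    (.seq (exec_const σ (by omega)) (.seq (exec_op σ (a := i * 32) (b := c.ctorIdx) ?_ ?_ ?_)
      (exec_op σ (a := base) (b := i * 32 + c.ctorIdx) ?_ ?_ ?_)))), ?_, ?_⟩
  all_goals try
    simp only [BinOp.eval, Function.update_self, Function.update_of_ne n1.symm, Function.update_of_ne n2, Function.update_of_ne n3, hr, hr1]
  all_goals try omega
  intro x h1 h2
  simp only [Function.update_of_ne h1, Function.update_of_ne h2]

/-- Evaluation at depth `d` writes only to temporaries from `tmp d` on. So a left operand held in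
`tmp d` survives the evaluation of the right operand at depth `d + 1`. -/
theorem Expr.exec_compile {s : St} (h : Bdd E s) {w : ℕ}
    (e : Expr) (hw : E.B ^ e.deg ≤ 2 ^ w) (d : ℕ) {σ : Config} (hσ : Sim E s σ) :
    ∃ r : ℕ → ℕ, Exec w (e.compile d) σ e.time { σ with reg := r } ∧
      (∀ x, (∀ j ≥ d, x ≠ tmp j) → r x = σ.reg x) ∧ r (tmp d) = e.eval s := by
  have hb := E.b_pos
  have hbase := E.base_lt
  have h2 : 2 ≤ E.B := Nat.le_self_pow (by omega) 2
  induction e generalizing d σ with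
  | lit c =>
    refine ⟨Function.update σ.reg (tmp d) c, .const _ _ _ ?_, fun x hx => ?_, ?_⟩
    · exact ((Expr.lit c).eval_lt h).trans_le hw
    · exact Function.update_of_ne (hx d le_rfl) _ _
    · simp [Expr.eval]
  | var x =>
    refine ⟨Function.update σ.reg (tmp d) (σ.reg x.reg), ?_, fun y hy => ?_, ?_⟩
    · have := Exec.op (w := w) σ .or (tmp d) x.reg x.reg
      simp only [BinOp.eval, Nat.or_self] at this
      refine this ?_
      rw [hσ.reg]
      exact ((Expr.var x).eval_lt h).trans_le hw
    · exact Function.update_of_ne (hy d le_rfl) _ _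
    · simp [Expr.eval, hσ.reg]
  | op o e₁ e₂ ih₁ ih₂ =>
    have hB := Nat.pow_le_pow_right (n := E.B) (by omega : 0 < E.B)
      (by simp [Expr.deg]; omega : e₁.deg ≤ (Expr.op o e₁ e₂).deg)
    have hB' := Nat.pow_le_pow_right (n := E.B) (by omega : 0 < E.B)
      (by simp [Expr.deg]; omega : e₂.deg ≤ (Expr.op o e₁ e₂).deg)
    obtain ⟨r₁, x₁, f₁, v₁⟩ := ih₁ (hB.trans hw) d hσ
    obtain ⟨r₂, x₂, f₂, v₂⟩ := ih₂ (hB'.trans hw) (d + 1) (hσ.of_reg f₁)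
    have hv : r₂ (tmp d) = e₁.eval s := by
      rw [← v₁]; exact f₂ _ fun j hj => by simp only [tmp]; omega
    refine ⟨Function.update r₂ (tmp d) (o.eval (e₁.eval s) (e₂.eval s)), ?_, fun x hx => ?_, ?_⟩
    · have x₃ := Exec.op (w := w) { σ with reg := r₂ } o (tmp d) (tmp d) (tmp (d + 1))
      simp only [hv, v₂] at x₃
      have := Exec.seq x₁ (Exec.seq x₂
        (x₃ (((Expr.op o e₁ e₂).eval_lt h).trans_le hw)))
      simpa only [Expr.time, Expr.compile, Config.setReg, ← add_assoc] using this
    · rw [Function.update_of_ne (hx d le_rfl), f₂ x fun j hj => hx j (by omega)]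
      exact f₁ x hx
    · simp [Expr.eval]
  | get c e ih =>
    have hB := Nat.pow_le_pow_right (n := E.B) (by omega : 0 < E.B)
      (by simp [Expr.deg] : e.deg ≤ (Expr.get c e).deg)
    obtain ⟨r, x₁, f₁, v₁⟩ := ih (hB.trans hw) d hσ
    have hb1 : r 1 = E.base := by
      rw [← hσ.base]; exact f₁ _ fun j _ => by simp only [tmp]; omega
    obtain ⟨r', x₂, f₂, v₂⟩ := exec_addr c hb hbase ((e.eval_lt h)) e.one_le_deg
      (w := w) (by simpa [Expr.deg] using hw) d σ r v₁ hb1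
    refine ⟨Function.update r' (tmp d) (s.a c (e.eval s)), ?_, fun x hx => ?_, ?_⟩
    · have x₃ := Exec.load (w := w) { σ with reg := r' } (tmp d) (tmp d)
      simp only [v₂, hσ.mem] at x₃
      exact .seq x₁ (.seq x₂ x₃)
    · rw [Function.update_of_ne (hx d le_rfl), f₂ x (hx d le_rfl) (hx (d + 1) (by omega)), f₁ x hx]
    · simp [Expr.eval]

/-- The result of simulating a statement: the final configuration and its running time. -/
def Simulates (E : Env) (w : ℕ) (P : Program) (d : ℕ) (σ : Config) (T : ℕ) (s' : St) : Prop :=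
  ∃ (t : ℕ) (σ' : Config), Exec w P σ t σ' ∧ t ≤ T ∧ Sim E s' σ' ∧
    ∀ j < d, σ'.reg (tmp j) = σ.reg (tmp j)

theorem one_le_cost (P : Stmt) (s : St) : 1 ≤ cost E P s := by
  induction P generalizing s with
  | seq P Q ih _ => simp only [cost]; have := ih s; omega
  | _ => simp [cost]

theorem Sim.setReg {s : St} {σ : Config} (h : Sim E s σ) (x : Var) (c : ℕ) :
    Sim E (s.setV x c) (σ.setReg x.reg c) where
  reg y := by
    simp only [Config.setReg, St.setV, Function.update_apply, Var.reg]
    have : 2 * y.ctorIdx = 2 * x.ctorIdx ↔ y = x := by rw [← Var.ctorIdx_inj]; omega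
    simp only [this, ← h.reg]
  mem := h.mem
  inp := h.inp
  base := by
    rw [← h.base]; exact Function.update_of_ne (by simp only [Var.reg]; omega) _ _
  coins := h.coins

theorem Sim.setMem {s : St} {σ : Config} (h : Sim E s σ) (c : Arr) (i y : ℕ) :
    Sim E (s.setA c i y) (σ.setMem (E.base + 32 * i + c.ctorIdx) y) where
  reg := h.reg
  mem d j := by
    have hc := c.ctorIdx_lt
    have hd := d.ctorIdx_lt
    simp only [Config.setMem, St.setA, Function.update_apply]
    by_cases hcd : d = c
    · subst hcd
      simp only [Function.update_apply, if_true]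
      have : E.base + 32 * j + d.ctorIdx = E.base + 32 * i + d.ctorIdx ↔ j = i := by omega
      simp only [this, ← h.mem]
    · have : d.ctorIdx ≠ c.ctorIdx := fun h => hcd (Arr.ctorIdx_inj.1 h)
      rw [if_neg (by omega), if_neg hcd, h.mem]
  inp j hj := by
    rw [← h.inp j hj]; exact Function.update_of_ne (by omega) _ _
  base := h.base
  coins := h.coins

theorem Sim.flip {s : St} {σ : Config} (h : Sim E s σ) (x : Var) :
    Sim E (s.flip x) (σ.flip x.reg) := by
  have h' := h.setReg x (s.coins 0).toNat
  rw [← h.coins] at h'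
  exact ⟨fun y => by simpa [St.flip, Config.flip, h.coins] using h'.reg y, h.mem, h.inp,
    h'.base, by simp [St.flip, Config.flip, h.coins]⟩

theorem B_pow_le {i j w : ℕ} (h : E.B ^ j ≤ 2 ^ w) (hij : i ≤ j) : E.B ^ i ≤ 2 ^ w :=
  (Nat.pow_le_pow_right (by positivity) hij).trans h

/-- Compiled code simulates the statement with a constant slowdown. -/
theorem Stmt.simulates_compile {w : ℕ} (P : Stmt) (hw : E.B ^ P.deg ≤ 2 ^ w) (d : ℕ) {s : St} (h : Bdd E s) (hok : ok E P s)
    {σ : Config} (hσ : Sim E s σ) :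
    Simulates E w (P.compile d) d σ (P.slowdown * cost E P s) (run E P s) := by
  have hb := E.b_pos
  have hbase := E.base_lt
  have h2 : 2 ≤ E.B := Nat.le_self_pow (by omega) 2
  induction P generalizing d s σ with
  | skip => exact ⟨1, σ, .skip _, by simp [slowdown, cost], hσ, fun _ _ => rfl⟩
  | set x e =>
    obtain ⟨r, x₁, f₁, v₁⟩ := e.exec_compile h (B_pow_le hw (by simp [deg])) d hσ
    refine ⟨_, _, .seq x₁ (exec_op σ v₁ v₁ ?_), by simp [slowdown, cost], ?_, fun j hj => ?_⟩
    · simp only [BinOp.eval, Nat.or_self]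
      exact (e.eval_lt h).trans_le (B_pow_le hw (by simp [deg]))
    · simp only [BinOp.eval, Nat.or_self]
      exact (hσ.of_reg f₁).setReg x _
    · simp only [Var.reg, tmp] at *
      rw [Function.update_of_ne (by omega)]
      exact f₁ _ fun i hi => by omega
  | put c e₁ e₂ =>
    have d1 := e₁.one_le_deg
    obtain ⟨r, x₁, f₁, v₁⟩ := e₁.exec_compile h
      (B_pow_le hw (by simp only [deg]; omega)) d hσ
    have hb1 : r 1 = E.base := by
      rw [← hσ.base]; exact f₁ _ fun j _ => by simp only [tmp]; omega
    obtain ⟨r', x₂, f₂, v₂⟩ := exec_addr c hb hbase (e₁.eval_lt h) d1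
      (w := w) (B_pow_le hw (by simp only [deg]; omega)) d σ r v₁ hb1
    have f₃ : ∀ x, (∀ j ≥ d, x ≠ tmp j) → r' x = σ.reg x := fun x hx => by
      rw [f₂ x (hx d le_rfl) (hx (d + 1) (by omega)), f₁ x hx]
    obtain ⟨r'', x₄, f₄, v₄⟩ := e₂.exec_compile h
      (B_pow_le hw (by simp only [deg]; omega)) (d + 1) (hσ.of_reg f₃)
    have f₅ : ∀ x, (∀ j ≥ d, x ≠ tmp j) → r'' x = σ.reg x := fun x hx => by
      exact (f₄ x fun j hj => hx j (by omega)).trans (f₃ x hx)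
    have v₅ : r'' (tmp d) = E.base + 32 * e₁.eval s + c.ctorIdx := by
      rw [← v₂]; exact f₄ _ fun j hj => by simp only [tmp]; omega
    have x₅ := Exec.store (w := w) { σ with reg := r'' } (tmp d) (tmp (d + 1))
    simp only [v₅, v₄] at x₅
    refine ⟨_, _, .seq x₁ (.seq x₂ (.seq x₄ x₅)), ?_, (hσ.of_reg f₅).setMem _ _ _, fun j hj => ?_⟩
    · simp only [slowdown, cost]; omega
    · exact f₅ _ fun i hi => by simp only [tmp]; omega
  | inp x e =>
    obtain ⟨r, x₁, f₁, v₁⟩ := e.exec_compile h (B_pow_le hw (by simp [deg])) d hσ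
    have x₂ := Exec.load (w := w) { σ with reg := r } x.reg (tmp d)
    simp only [v₁, hσ.inp _ hok] at x₂
    refine ⟨_, _, .seq x₁ x₂, by simp [slowdown, cost], (hσ.of_reg f₁).setReg x _, fun j hj => ?_⟩
    simp only [Config.setReg, Var.reg, tmp] at *
    rw [Function.update_of_ne (by omega)]
    exact f₁ _ fun i hi => by omega
  | flip x =>
    refine ⟨1, _, .flip _ _, by simp [slowdown, cost], hσ.flip x, fun j hj => ?_⟩
    simp only [Config.flip, Config.setReg, Var.reg, tmp]
    rw [Function.update_of_ne (by omega)]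
  | seq P Q ihP ihQ =>
    obtain ⟨t₁, σ₁, x₁, l₁, s₁, f₁⟩ := ihP (B_pow_le hw (by simp [deg])) d h hok.1 hσ
    obtain ⟨t₂, σ₂, x₂, l₂, s₂, f₂⟩ := ihQ (B_pow_le hw (by simp [deg])) d
      (h.run hok.1) hok.2 s₁
    refine ⟨_, σ₂, .seq x₁ x₂, ?_, s₂, fun j hj => by rw [f₂ j hj, f₁ j hj]⟩
    simp only [slowdown, cost]
    nlinarith
  | ite e P Q ihP ihQ =>
    obtain ⟨r, x₁, f₁, v₁⟩ := e.exec_compile h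
      (B_pow_le hw (by simp only [deg]; omega)) d hσ
    simp only [ok, run, cost] at hok ⊢
    split_ifs at hok ⊢ with h'
    · obtain ⟨t₁, σ₁, x₂, l₁, s₁, f₂⟩ := ihP (B_pow_le hw (by simp only [deg]; omega)) d h hok
        (hσ.of_reg f₁)
      refine ⟨_, σ₁, .seq x₁ (.ite_true (by simpa [v₁]) x₂), ?_, s₁, fun j hj => ?_⟩
      · have := one_le_cost (E := E) P s
        simp only [slowdown]
        nlinarith
      · rw [f₂ j hj]; exact f₁ _ fun i hi => by simp only [tmp]; omega
    · obtain ⟨t₁, σ₁, x₂, l₁, s₁, f₂⟩ := ihQ (B_pow_le hw (by simp only [deg]; omega)) d h hok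
        (hσ.of_reg f₁)
      refine ⟨_, σ₁, .seq x₁ (.ite_false (by simpa [v₁] using h') x₂), ?_, s₁, fun j hj => ?_⟩
      · have := one_le_cost (E := E) Q s
        simp only [slowdown]
        nlinarith
      · rw [f₂ j hj]; exact f₁ _ fun i hi => by simp only [tmp]; omega
  | loop x e P ih =>
    obtain ⟨r, x₁, f₁, v₁⟩ := e.exec_compile h
      (B_pow_le hw (by simp only [deg]; omega)) d hσ
    obtain ⟨hN, hok⟩ := hok
    simp only [run, cost]
    set N := e.eval s with hNdef
    have hBw : E.B ^ 2 ≤ 2 ^ w := B_pow_le hw (by simp only [deg]; omega)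
    -- The number of rounds may equal the bound `E.B` itself, so the counter can leave the range of
    -- values; the surplus `3` in the degree of a loop makes room for it.
    have hNw : N + 1 < 2 ^ w := by nlinarith
    -- the body of the loop
    let body : Program := .seq (.op .or x.reg (tmp (d + 1)) (tmp (d + 1)))
          (.seq (P.compile (d + 3)) (.seq (.const (tmp (d + 2)) 1)
          (.seq (.op .add (tmp (d + 1)) (tmp (d + 1)) (tmp (d + 2)))
            (.op .lt (tmp (d + 2)) (tmp (d + 1)) (tmp d)))))
    let s' : ℕ → St := iter (run E P) x s
    have hs' : ∀ i ≤ N, Bdd E (s' i) := by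
      intro i
      induction i with
      | zero => exact fun _ => h
      | succ i ih' =>
        intro hi
        exact Bdd.run ((ih' (by omega)).setV x (by omega)) (hok i (by omega))
    -- Induction on the number of remaining rounds. The bound, the counter and the test sit in `tmp
    -- d`, `tmp (d + 1)` and `tmp (d + 2)`, out of reach of the body, which uses temporaries from
    -- `tmp (d + 3)` on. The `5` units per round are the copy, the constant, the increment, the
    -- comparison and the test of the loop.
    have loop : ∀ k i, i + k = N → ∀ σ : Config, Sim E (s' i) σ → σ.reg (tmp d) = N →
        σ.reg (tmp (d + 1)) = i → σ.reg (tmp (d + 2)) = (if i < N then 1 else 0) →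
        Simulates E w (.while (tmp (d + 2)) body) d σ
          ((∑ j ∈ Finset.Ico i N, (P.slowdown * cost E P ((s' j).setV x j) + 5)) + 1) (s' N) := by
      intro k
      induction k with
      | zero =>
        intro i hi σ hσ _ _ h3
        obtain rfl : i = N := by omega
        exact ⟨1, σ, .while_false (by simpa using h3), by simp, hσ, fun _ _ => rfl⟩
      | succ k ihk =>
        intro i hi σ hσ h0 h1 h3
        have hiN : i < N := by omega
        rw [if_pos hiN] at h3
        have y₁ : Exec w (.op .or x.reg (tmp (d + 1)) (tmp (d + 1))) σ 1 (σ.setReg x.reg i) := by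
          have := exec_op (w := w) σ (r := σ.reg) (o := .or) (x := x.reg) h1 h1
          simp only [BinOp.eval, Nat.or_self] at this
          exact this (by omega)
        obtain ⟨t, σ₂, y₂, l₂, z₂, g₂⟩ := ih (B_pow_le hw (by simp only [deg]; omega)) (d + 3)
          ((hs' i hiN.le).setV x (by omega)) (hok i hiN) (hσ.setReg x i)
        have g₂' : ∀ j < d + 3, σ₂.reg (tmp j) = σ.reg (tmp j) := fun j hj => by
          rw [g₂ j hj]; exact Function.update_of_ne (by simp only [tmp, Var.reg]; omega) _ _
        have n1 : tmp (d + 1) ≠ tmp (d + 2) := by simp only [tmp]; omega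
        have n2 : tmp d ≠ tmp (d + 1) := by simp only [tmp]; omega
        have n3 : tmp d ≠ tmp (d + 2) := by simp only [tmp]; omega
        have y₃ := exec_const (w := w) σ₂ (r := σ₂.reg) (x := tmp (d + 2)) (c := 1) (by omega)
        have y₄ := exec_op (w := w) σ₂ (r := Function.update σ₂.reg (tmp (d + 2)) 1) (o := .add)
          (x := tmp (d + 1)) (y := tmp (d + 1)) (z := tmp (d + 2)) (a := i) (b := 1)
          (by rw [Function.update_of_ne n1, g₂' _ (by omega), h1]) (by simp)
          (by simp only [BinOp.eval]; omega)
        have y₅ := exec_op (w := w) σ₂ (r := Function.update (Function.update σ₂.reg (tmp (d + 2)) 1)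
            (tmp (d + 1)) (i + 1)) (o := .lt)
          (x := tmp (d + 2)) (y := tmp (d + 1)) (z := tmp d) (a := i + 1) (b := N)
          (by simp) (by rw [Function.update_of_ne n2, Function.update_of_ne n3, g₂' _ (by omega), h0])
          (by simp only [BinOp.eval]; split_ifs <;> omega)
        simp only [BinOp.eval] at y₄ y₅
        set r₅ := Function.update (Function.update (Function.update σ₂.reg (tmp (d + 2)) 1)
            (tmp (d + 1)) (i + 1)) (tmp (d + 2)) (if i + 1 < N then 1 else 0) with hr₅
        have hf : ∀ y, (∀ j ≥ d + 1, y ≠ tmp j) → r₅ y = σ₂.reg y := fun y hy => by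
          simp only [hr₅, Function.update_of_ne (hy (d + 1) (by omega)),
            Function.update_of_ne (hy (d + 2) (by omega))]
        have hlow : ∀ j < d + 1, r₅ (tmp j) = σ.reg (tmp j) := fun j hj => by
          rw [hf _ fun i hi => by simp only [tmp]; omega, g₂' j (by omega)]
        obtain ⟨t', σ', y₆, l₆, z₆, g₆⟩ := ihk (i + 1) (by omega) { σ₂ with reg := r₅ }
          (z₂.of_reg hf) (by simp only [hlow d (by omega), h0])
          (by simp [hr₅]) (by simp [hr₅])
        refine ⟨_, σ', .while_true (by omega) (.seq y₁ (.seq y₂ (.seq y₃ (.seq y₄ y₅)))) y₆, ?_, z₆,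
          fun j hj => by rw [g₆ j hj]; exact hlow j (by omega)⟩
        rw [Finset.sum_eq_sum_Ico_succ_bot hiN]
        simp only [s'] at l₂ l₆ ⊢
        omega
    have n1 : tmp d ≠ tmp (d + 1) := by simp only [tmp]; omega
    have n2 : tmp d ≠ tmp (d + 2) := by simp only [tmp]; omega
    have n3 : tmp (d + 1) ≠ tmp (d + 2) := by simp only [tmp]; omega
    have x₂ := exec_const (w := w) σ (r := r) (x := tmp (d + 1)) (c := 0) (by omega)
    have x₃ := exec_op (w := w) σ (r := Function.update r (tmp (d + 1)) 0) (o := .lt)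
      (x := tmp (d + 2)) (y := tmp (d + 1)) (z := tmp d) (a := 0) (b := N)
      (by simp) (by rw [Function.update_of_ne n1, v₁])
      (by simp only [BinOp.eval]; split_ifs <;> omega)
    set r₃ := Function.update (Function.update r (tmp (d + 1)) 0) (tmp (d + 2))
      (BinOp.eval .lt 0 N) with hr₃
    have hf : ∀ y, (∀ j ≥ d, y ≠ tmp j) → r₃ y = σ.reg y := fun y hy => by
      simp only [hr₃, Function.update_of_ne (hy (d + 1) (by omega)),
        Function.update_of_ne (hy (d + 2) (by omega)), f₁ y hy]
    obtain ⟨t, σ', x₄, l₄, z₄, g₄⟩ := loop N 0 (by omega) { σ with reg := r₃ } (hσ.of_reg hf)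
      (by simp only [hr₃, Function.update_of_ne n1, Function.update_of_ne n2, v₁])
      (by simp only [hr₃, Function.update_of_ne n3, Function.update_self])
      (by simp only [hr₃, Function.update_self, BinOp.eval])
    refine ⟨_, σ', .seq x₁ (.seq x₂ (.seq x₃ x₄)), ?_, z₄, fun j hj => ?_⟩
    · rw [Nat.Ico_zero_eq_range] at l₄
      have : ∑ j ∈ Finset.range N, (P.slowdown * cost E P ((s' j).setV x j) + 5) ≤
          (Stmt.loop x e P).slowdown * ∑ j ∈ Finset.range N, (cost E P ((s' j).setV x j) + 1) := by
        rw [Finset.mul_sum]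
        refine Finset.sum_le_sum fun j _ => ?_
        simp only [slowdown]
        have := Nat.zero_le (e.time * (cost E P ((s' j).setV x j) + 1))
        nlinarith
      rw [mul_add, mul_one]
      simp only [s'] at this l₄
      have hsl : (Stmt.loop x e P).slowdown = e.time + P.slowdown + 5 := rfl
      omega
    · rw [g₄ j hj]; exact hf _ fun i hi => by simp only [tmp]; omega

end Loop

namespace Loop

open WordRAM

variable {E : Env}

/-! ### Frames -/

/-- The variables a statement may change. -/
def Stmt.writesV : Stmt → Var → Bool
  | .skip, _ | .put _ _ _, _ => false
  | .set x _, y | .inp x _, y | .flip x, y => decide (x = y)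
  | .seq P Q, y | .ite _ P Q, y => P.writesV y || Q.writesV y
  | .loop x _ P, y => decide (x = y) || P.writesV y

/-- The arrays a statement may change. -/
def Stmt.writesA : Stmt → Arr → Bool
  | .skip, _ | .set _ _, _ | .inp _ _, _ | .flip _, _ => false
  | .put c _ _, d => decide (c = d)
  | .seq P Q, d | .ite _ P Q, d => P.writesA d || Q.writesA d
  | .loop _ _ P, d => P.writesA d

/-- `s'` agrees with `s` on everything that `P` cannot change. -/
structure Frame (P : Stmt) (s s' : St) : Prop where
  v : ∀ x, P.writesV x = false → s'.v x = s.v x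
  a : ∀ c, P.writesA c = false → s'.a c = s.a c

theorem Frame.iter {P : Stmt} (h : ∀ s, Frame P s (run E P s)) (x : Var) (e : Expr) (s : St)
    (i : ℕ) : Frame (.loop x e P) s (iter (run E P) x s i) := by
  induction i with
  | zero => exact ⟨fun _ _ => rfl, fun _ _ => rfl⟩
  | succ i ih =>
    refine ⟨fun y hy => ?_, fun c hc => ?_⟩
    · have hy' := hy
      simp only [Stmt.writesV, Bool.or_eq_false_iff, decide_eq_false_iff_not] at hy'
      simp only [Loop.iter]
      rw [(h _).v y hy'.2, ← ih.v y hy]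
      simp only [St.setV, Function.update_apply, if_neg (Ne.symm hy'.1)]
    · simp only [Loop.iter]
      rw [(h _).a c hc, ← ih.a c hc]
      rfl

theorem run_frame (P : Stmt) (s : St) : Frame P s (run E P s) := by
  induction P generalizing s with
  | skip => exact ⟨fun _ _ => rfl, fun _ _ => rfl⟩
  | set x e | inp x e | flip x =>
    refine ⟨fun y hy => ?_, fun _ _ => rfl⟩
    simp only [Stmt.writesV, decide_eq_false_iff_not] at hy
    simp only [run, St.flip, St.setV, Function.update_apply, if_neg (Ne.symm hy)]
  | put c e₁ e₂ =>
    refine ⟨fun _ _ => rfl, fun d hd => ?_⟩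
    simp only [Stmt.writesA, decide_eq_false_iff_not] at hd
    simp only [run, St.setA, Function.update_apply, if_neg (Ne.symm hd)]
  | seq P Q ihP ihQ =>
    refine ⟨fun y hy => ?_, fun c hc => ?_⟩
    · simp only [Stmt.writesV, Bool.or_eq_false_iff] at hy
      rw [run, (ihQ _).v y hy.2, (ihP _).v y hy.1]
    · simp only [Stmt.writesA, Bool.or_eq_false_iff] at hc
      rw [run, (ihQ _).a c hc.2, (ihP _).a c hc.1]
  | ite e P Q ihP ihQ =>
    refine ⟨fun y hy => ?_, fun c hc => ?_⟩
    · simp only [Stmt.writesV, Bool.or_eq_false_iff] at hy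
      rw [run]; split_ifs
      exacts [(ihP _).v y hy.1, (ihQ _).v y hy.2]
    · simp only [Stmt.writesA, Bool.or_eq_false_iff] at hc
      rw [run]; split_ifs
      exacts [(ihP _).a c hc.1, (ihQ _).a c hc.2]
  | loop x e P ih => exact Frame.iter ih x e s _

/-! ### Total correctness with running times -/

/-- Started in `s`, the statement `P` keeps all values in range, executes at most `T` statements
and ends in a state that satisfies `R`. -/
def WP (E : Env) (P : Stmt) (T : ℕ) (R : St → Prop) (s : St) : Prop :=
  Bdd E s → ok E P s ∧ cost E P s ≤ T ∧ R (run E P s)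

theorem WP.mono {P : Stmt} {T T' : ℕ} {R R' : St → Prop} {s : St} (h : WP E P T R s) (hT : T ≤ T')
    (hR : ∀ s', Frame P s s' → Bdd E s' → R s' → R' s') : WP E P T' R' s := fun hs =>
  ⟨(h hs).1, (h hs).2.1.trans hT, hR _ (run_frame P s) (hs.run (h hs).1) (h hs).2.2⟩

theorem WP.le {P : Stmt} {T T' : ℕ} {R : St → Prop} {s : St} (h : WP E P T R s) (hT : T ≤ T') :
    WP E P T' R s := h.mono hT fun _ _ _ h => h

theorem WP.seq {P Q : Stmt} {T T' : ℕ} {R R' : St → Prop} {s : St} (h : WP E P T R s)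
    (h' : ∀ s', Frame P s s' → R s' → WP E Q T' R' s') : WP E (P ;; Q) (T + T') R' s := fun hs => by
  obtain ⟨h1, h2, h3⟩ := h hs
  obtain ⟨h4, h5, h6⟩ := h' _ (run_frame P s) h3 (hs.run h1)
  exact ⟨⟨h1, h4⟩, by simp only [cost]; omega, h6⟩

theorem WP.ite {e : Expr} {P Q : Stmt} {T : ℕ} {R : St → Prop} {s : St}
    (h : e.eval s ≠ 0 → WP E P T R s) (h' : e.eval s = 0 → WP E Q T R s) :
    WP E (.ite e P Q) (T + 1) R s := fun hs => by
  simp only [ok, cost, run]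
  split_ifs with hc
  · exact ⟨(h hc hs).1, by have := (h hc hs).2.1; omega, (h hc hs).2.2⟩
  · exact ⟨(h' (not_not.1 hc) hs).1, by have := (h' (not_not.1 hc) hs).2.1; omega,
      (h' (not_not.1 hc) hs).2.2⟩

/-- The time allowed for a round may depend on its index. The completion needs this, since only few
nodes pay for inserting a clique. -/
theorem WP.for_sum {x : Var} {e : Expr} {P : Stmt} {s : St} (N : ℕ) (I : ℕ → St → Prop)
    (T : ℕ → ℕ) (hN : e.eval s = N) (hNB : N ≤ E.B) (h0 : I 0 s)
    (hI : ∀ i < N, ∀ s', Frame (.loop x e P) s s' → Bdd E s' → I i s' →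
      WP E P (T i) (I (i + 1)) (s'.setV x i)) :
    WP E (.loop x e P) ((∑ i ∈ Finset.range N, (T i + 1)) + 1) (I N) s := fun hs => by
  subst hN
  set s' : ℕ → St := iter (run E P) x s with hs'
  have key : ∀ i ≤ e.eval s, Bdd E (s' i) ∧ I i (s' i) ∧ ∀ j < i, ok E P ((s' j).setV x j) ∧
      cost E P ((s' j).setV x j) ≤ T j := by
    intro i
    induction i with
    | zero => exact fun _ => ⟨hs, h0, fun j hj => absurd hj (by omega)⟩
    | succ i ih =>
      intro hi
      obtain ⟨k1, k2, k3⟩ := ih (by omega)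
      have k4 := k1.setV x (c := i) (by omega)
      obtain ⟨k5, k6, k7⟩ := hI i (by omega) (s' i) (Frame.iter (run_frame P) x e s i) k1 k2 k4
      refine ⟨k4.run k5, k7, fun j hj => ?_⟩
      rcases Nat.lt_succ_iff_lt_or_eq.1 hj with h | rfl
      exacts [k3 j h, ⟨k5, k6⟩]
  obtain ⟨-, k2, k3⟩ := key _ le_rfl
  refine ⟨⟨hNB, fun i hi => (k3 i hi).1⟩, ?_, k2⟩
  simp only [cost]
  refine Nat.add_le_add_right (Finset.sum_le_sum fun i hi => ?_) 1
  exact Nat.add_le_add_right (k3 i (Finset.mem_range.1 hi)).2 1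

theorem WP.loop {x : Var} {e : Expr} {P : Stmt} {s : St} (N : ℕ) (I : ℕ → St → Prop)
    (T : ℕ) (hN : e.eval s = N) (hNB : N ≤ E.B) (h0 : I 0 s)
    (hI : ∀ i < N, ∀ s', Frame (.loop x e P) s s' → Bdd E s' → I i s' →
      WP E P T (I (i + 1)) (s'.setV x i)) :
    WP E (.loop x e P) (N * (T + 1) + 1) (I N) s := by
  have := WP.for_sum N I (fun _ => T) hN hNB h0 hI
  simpa using this

theorem WP.set {x : Var} {e : Expr} {R : St → Prop} {s : St} (c : ℕ) (h : e.eval s = c)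
    (hc : c < E.B) (hR : R (s.setV x c)) : WP E (.set x e) 1 R s := fun _ => by
  subst h; exact ⟨hc, le_rfl, hR⟩

theorem WP.put {c : Arr} {e₁ e₂ : Expr} {R : St → Prop} {s : St} (i y : ℕ) (h₁ : e₁.eval s = i)
    (h₂ : e₂.eval s = y) (hy : y < E.B) (hR : R (s.setA c i y)) : WP E (.put c e₁ e₂) 1 R s :=
  fun _ => by subst h₁ h₂; exact ⟨hy, le_rfl, hR⟩

theorem WP.inp {x : Var} {e : Expr} {R : St → Prop} {s : St} (i : ℕ) (h : e.eval s = i)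
    (hi : i < E.base) (hR : R (s.setV x (E.I i))) : WP E (.inp x e) 1 R s := fun _ => by
  subst h; exact ⟨hi, le_rfl, hR⟩

theorem WP.skip {R : St → Prop} {s : St} (hR : R s) : WP E .skip 1 R s :=
  fun _ => ⟨trivial, le_rfl, hR⟩

theorem WP.flip {x : Var} {R : St → Prop} {s : St} (hR : R (s.flip x)) : WP E (.flip x) 1 R s :=
  fun _ => ⟨trivial, le_rfl, hR⟩

theorem WP.seq' {P Q : Stmt} {T T' : ℕ} {R : St → Prop} {s : St}
    (h : WP E P T (WP E Q T' R) s) : WP E (P ;; Q) (T + T') R s := WP.seq h fun _ _ h => h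

theorem Frame.trans {P Q : Stmt} {s s' s'' : St} (h : Frame P s s') (h' : Frame Q s' s'') :
    Frame (P ;; Q) s s'' := by
  refine ⟨fun x hx => ?_, fun c hc => ?_⟩
  · simp only [Stmt.writesV, Bool.or_eq_false_iff] at hx
    rw [h'.v x hx.2, h.v x hx.1]
  · simp only [Stmt.writesA, Bool.or_eq_false_iff] at hc
    rw [h'.a c hc.2, h.a c hc.1]

/-- The statement uses no random bits. -/
def Stmt.flipFree : Stmt → Bool
  | .flip _ => false
  | .skip | .set _ _ | .put _ _ _ | .inp _ _ => true
  | .seq P Q | .ite _ P Q => P.flipFree && Q.flipFree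
  | .loop _ _ P => P.flipFree

theorem eval_coins (s : St) (c : ℕ → Bool) (e : Expr) :
    e.eval { s with coins := c } = e.eval s := by
  induction e with
  | lit | var => rfl
  | op o e₁ e₂ h₁ h₂ => simp only [Expr.eval, h₁, h₂]
  | get d e h => simp only [Expr.eval, h]

/-- Such a statement never looks at the random bits, so its results are the same for all of them;
this lets the outcome of the preparation be fixed before the bits are drawn. -/
theorem run_coins {P : Stmt} (hP : P.flipFree = true) (s : St) (c : ℕ → Bool) :
    run E P { s with coins := c } = { run E P s with coins := c } := by
  induction P generalizing s with
  | skip => rfl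
  | set x e | inp x e => simp only [run, eval_coins]; rfl
  | put d e₁ e₂ => simp only [run, eval_coins]; rfl
  | flip x => simp [Stmt.flipFree] at hP
  | seq P Q ihP ihQ =>
    simp only [Stmt.flipFree, Bool.and_eq_true] at hP
    simp only [run, ihP hP.1, ihQ hP.2]
  | ite e P Q ihP ihQ =>
    simp only [Stmt.flipFree, Bool.and_eq_true] at hP
    simp only [run, eval_coins, ihP hP.1, ihQ hP.2]
    split_ifs <;> rfl
  | loop x e P ih =>
    simp only [run, eval_coins]
    generalize e.eval s = i
    induction i with
    | zero => rfl
    | succ i ih' =>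
      simp only [iter, ih']
      exact ih hP ((iter (run E P) x s i).setV x i)

/-! ### Simplification of straight-line code -/

@[simp] theorem eval_ofNat (s : St) (c : ℕ) :
    Expr.eval s (no_index (@OfNat.ofNat Expr c (instOfNatExpr c))) = c := rfl
@[simp] theorem eval_var (s : St) (x : Var) : Expr.eval s (.var x) = s.v x := rfl
@[simp] theorem eval_get (s : St) (c : Arr) (e : Expr) :
    Expr.eval s (.get c e) = s.a c (e.eval s) := rfl
@[simp] theorem eval_add (s : St) (a b : Expr) : Expr.eval s (a + b) = a.eval s + b.eval s := rfl
@[simp] theorem eval_sub (s : St) (a b : Expr) : Expr.eval s (a - b) = a.eval s - b.eval s := rfl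
@[simp] theorem eval_mul (s : St) (a b : Expr) : Expr.eval s (a * b) = a.eval s * b.eval s := rfl
@[simp] theorem eval_div (s : St) (a b : Expr) : Expr.eval s (a / b) = a.eval s / b.eval s := rfl
@[simp] theorem eval_mod (s : St) (a b : Expr) : Expr.eval s (a % b) = a.eval s % b.eval s := rfl
@[simp] theorem eval_bxor (s : St) (a b : Expr) :
    Expr.eval s (.bxor a b) = a.eval s ^^^ b.eval s := rfl
@[simp] theorem eval_eq (s : St) (a b : Expr) :
    Expr.eval s (.eq a b) = if a.eval s = b.eval s then 1 else 0 := rfl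
@[simp] theorem eval_lt (s : St) (a b : Expr) :
    Expr.eval s (.lt a b) = if a.eval s < b.eval s then 1 else 0 := rfl

@[simp] theorem setV_v (s : St) (x y : Var) (c : ℕ) :
    (s.setV x c).v y = if y = x then c else s.v y := Function.update_apply _ _ _ _
@[simp] theorem setV_a (s : St) (x : Var) (c : ℕ) : (s.setV x c).a = s.a := rfl
@[simp] theorem setV_coins (s : St) (x : Var) (c : ℕ) : (s.setV x c).coins = s.coins := rfl
@[simp] theorem setA_v (s : St) (c : Arr) (i y : ℕ) : (s.setA c i y).v = s.v := rfl
@[simp] theorem setA_coins (s : St) (c : Arr) (i y : ℕ) : (s.setA c i y).coins = s.coins := rfl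
@[simp] theorem setA_a (s : St) (c d : Arr) (i y : ℕ) :
    (s.setA c i y).a d = if d = c then Function.update (s.a c) i y else s.a d :=
  Function.update_apply _ _ _ _

end Loop

/-! ### The program -/

namespace Loop

section Program

open Loop.Var Loop.Arr Loop.Expr Loop.Stmt

/-- Read the parameters of the instance. -/
def header : Stmt :=
  inp n 0 ;; inp m 1 ;; inp k 2 ;; inp root (3 + n * n + n)

/-- Find the least power `fs = 2 ^ q` of two that exceeds `(n + 2) ^ 3`. -/
def fieldSize : Stmt :=
  set bd ((n + 2) * (n + 2) * (n + 2)) ;; set fs 2 ;; set q 1 ;;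
  .loop t bd (.ite (.lt bd fs) .skip (set fs (2 * fs) ;; set q (q + 1))) ;;
  set N (fs - 1)

/-- Draw `n` random field elements. -/
def randomElements : Stmt :=
  .loop i n (set x 0 ;; .loop j q (.flip b ;; set x (2 * x + b)) ;; put X i x)

/-- Find the positions of the bags in the input. -/
def bagPointers : Stmt :=
  set cur (4 + n * n + n + m) ;;
  .loop i m (put PTR i cur ;; inp sz cur ;; set cur (cur + sz + 1))

/-- Mark the vertices in the bag of the parent of the node `i`. -/
def markParent : Stmt :=
  inp par (4 + n * n + n + i) ;; set pp (get PTR par) ;; inp psz pp ;;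
  .ite (.eq i root) (set psz 0) .skip ;;
  .loop j psz (inp u (pp + 1 + j) ;; put MARK u (i + 1))

/-- Compute whether the bag of the node `i` is contained in the bag of the parent. -/
def testSubset : Stmt :=
  set pp (get PTR i) ;; inp sz pp ;; set sub 1 ;;
  .loop j sz (inp u (pp + 1 + j) ;; .ite (.eq (get MARK u) (i + 1)) .skip (set sub 0))

/-- Make the bag of the node `i` a clique. -/
def addClique : Stmt :=
  .loop j sz (inp u (pp + 1 + j) ;;
    .loop j2 sz (inp v (pp + 1 + j2) ;; put H (u * n + v) 1))

/-- Compute the graph in which two vertices are adjacent if they share a bag. -/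
def completion : Stmt :=
  .loop i m (markParent ;; testSubset ;; .ite sub .skip addClique)

/-- Test whether the vertex `v` is simplicial among the vertices that have not been eliminated. -/
def testSimplicial : Stmt :=
  set simp (1 - get DEAD v) ;;
  .loop u n (.loop u2 n
    (.ite ((1 - get DEAD u) * (1 - get DEAD u2) * get H (v * n + u) * get H (v * n + u2) *
      (1 - get H (u * n + u2))) (set simp 0) .skip))

/-- Compute a perfect elimination order. -/
def elimination : Stmt :=
  .loop i n (set best 0 ;; .loop v n (testSimplicial ;; .ite simp (set best v) .skip) ;;
    put ORD i best ;; put DEAD best 1)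

/-- Compute the adjacency of later vertices in the elimination order. -/
def laterMatrices : Stmt :=
  .loop i n (.loop j n (
    put HO (i * n + j) (.lt i j * get H (get ORD i * n + get ORD j)) ;;
    inp g (3 + get ORD i * n + get ORD j) ;;
    put GO (i * n + j) (.lt i j * g)))

/-- Test whether the slot `d` is used by a later neighbour of `i`. -/
def testSlot : Stmt :=
  set flag 1 ;; .loop j n (.ite (get HO (i * n + j) * .eq (get SLOT j) d) (set flag 0) .skip)

/-- Give different slots to adjacent vertices, and compute the parents in the elimination tree. -/
def slots : Stmt :=
  .loop r n (set i (n - 1 - r) ;; put PAR i n ;;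
    .loop t n (set d (n - 1 - t) ;; testSlot ;; .ite flag (set sl d) .skip ;;
      .ite (get HO (i * n + d)) (put PAR i d) .skip) ;;
    put SLOT i sl ;; .ite (.lt sl Q) .skip (set Q (sl + 1)))

/-- Compute the powers of four. -/
def powers : Stmt :=
  put PW 0 1 ;; .loop t Q (put PW (t + 1) (4 * get PW t)) ;; set TS (get PW Q)

/-- One step of the shift register with feedback polynomial `f`. -/
def shift (f : Expr) : Stmt :=
  set s (2 * s) ;; .ite (.lt s fs) .skip (set s (.bxor s f))

/-- Test whether the shift register with feedback `fs + cand` has full period. -/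
def testPeriod : Stmt :=
  set flag 1 ;; set s 1 ;;
  .loop i N (shift (fs + cand) ;; .ite (.eq (.eq s 1) (.eq (i + 1) N)) .skip (set flag 0))

/-- Find a primitive polynomial. -/
def findPolynomial : Stmt :=
  .loop cand fs (testPeriod ;; .ite flag (set pol (fs + cand)) .skip)

/-- Compute the tables of powers and discrete logarithms. -/
def fieldTables : Stmt :=
  put LOG 0 (2 * N) ;; set s 1 ;; .loop i (2 * N) (put EXP i s ;; put LOG s (i % N) ;; shift pol)

/-- The product of field elements. -/
def fmul (a b : Expr) : Expr := get EXP (get LOG a + get LOG b)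

/-- Read the set `S`. -/
def sources : Stmt :=
  .loop i n (inp g (3 + n * n + get ORD i) ;; put SB i g ;; .ite g (set si i) .skip) ;;
  set kk k ;; .ite (.lt n k) (set kk n) .skip ;; set kk (kk + 1)

/-- The weight of the current field element in the final sum. -/
def filterWeight : Stmt :=
  set hs 0 ;; .loop j kk (set hs (.bxor hs (get EXP (e * (N - j) % N))))

/-- The factors of the edges. -/
def edgeFactors : Stmt :=
  put EDG 0 1 ;; put EDG 1 0 ;; put EDG 2 1 ;; put EDG 3 1 ;;
  put EDG 4 0 ;; put EDG 5 1 ;; put EDG 6 1 ;; put EDG 7 1 ;;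
  put EDG 8 1 ;; put EDG 9 1 ;; put EDG 10 (get EXP (e * (2 * (n + 1)) % N)) ;; put EDG 11 0 ;;
  put EDG 12 1 ;; put EDG 13 1 ;; put EDG 14 0 ;; put EDG 15 0

/-- The weights of the vertices. -/
def vertexWeights : Stmt :=
  set ti (get EXP (e * (N - (n + 1)) % N)) ;;
  .loop i n (set wx (fmul (get X i) (get EXP e)) ;; put WT (4 * i) wx ;;
    .ite (.eq i si) (put WT (4 * i + 1) 0) (put WT (4 * i + 1) wx) ;;
    .ite (get SB i) (put WT (4 * i + 2) 0 ;; put WT (4 * i + 3) 0)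
      (put WT (4 * i + 2) ti ;; put WT (4 * i + 3) (.bxor 1 ti)))

/-- The contribution of the state `c` of the vertex `i` to an entry of its table. -/
def stateProduct : Stmt :=
  set pr (get WT (4 * i + c)) ;;
  set id2 (ix - ix / get PW (get SLOT i) % 4 * get PW (get SLOT i) + c * get PW (get SLOT i)) ;;
  .loop j n (.ite (get GO (i * n + j))
    (set pr (fmul pr (get EDG (4 * c + id2 / get PW (get SLOT j) % 4)))) .skip) ;;
  .loop j i (.ite (.eq (get PAR j) i) (set pr (fmul pr (get TBL (j * TS + id2)))) .skip)

/-- The tables of the vertices. -/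
def vertexTables : Stmt :=
  .loop i n (.loop ix TS (set tot 0 ;;
    .loop c 4 (stateProduct ;; set tot (.bxor tot pr)) ;; put TBL (i * TS + ix) tot))

/-- The product of the tables of the roots of the elimination forest. -/
def rootProduct : Stmt :=
  set res 1 ;; .loop j n (.ite (.eq (get PAR j) n) (set res (fmul res (get TBL (j * TS)))) .skip)

/-- The sum over all nonzero field elements. -/
def mainLoop : Stmt :=
  .loop e N (filterWeight ;; edgeFactors ;; vertexWeights ;; vertexTables ;; rootProduct ;;
    set acc (.bxor acc (fmul res hs)))

/-- The deterministic part of the algorithm before the main loop. -/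
def preparation : Stmt :=
  header ;; fieldSize ;; bagPointers ;; completion ;; elimination ;; laterMatrices ;; slots ;;
  powers ;; findPolynomial ;; fieldTables ;; sources

/-- The algorithm. -/
def algorithm : Stmt :=
  preparation ;; randomElements ;; mainLoop ;; set ans (.lt 0 acc)

end Program

@[simp] theorem eval_fmul (s : St) (a b : Expr) :
    Expr.eval s (fmul a b) = s.a .EXP (s.a .LOG (a.eval s) + s.a .LOG (b.eval s)) := rfl

end Loop

/-! ### The input -/

section Lists

theorem List.getD_flatten (l : List (List ℕ)) (i : ℕ) (hi : i < l.length) (r : ℕ)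
    (hr : r < l[i].length) :
    l.flatten.getD (((l.take i).map List.length).sum + r) 0 = l[i].getD r 0 := by
  induction l generalizing i with
  | nil => simp at hi
  | cons a l ih =>
    cases i with
    | zero =>
      simp only [List.take_zero, List.map_nil, List.sum_nil, zero_add, List.flatten_cons,
        List.getElem_cons_zero] at hr ⊢
      exact List.getD_append _ _ _ _ hr
    | succ i =>
      simp only [List.take_succ_cons, List.map_cons, List.sum_cons, List.flatten_cons,
        List.getElem_cons_succ] at hr ⊢
      rw [List.getD_append_right _ _ _ _ (by omega), ← ih i (by simpa using hi) hr]
      congr 1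
      omega

theorem List.getD_flatMap_finRange {m : ℕ} (f : Fin m → List ℕ) (len : ℕ → ℕ)
    (hlen : ∀ i, (f i).length = len i) (i : Fin m) (r : ℕ) (hr : r < len i) :
    ((List.finRange m).flatMap f).getD ((∑ j ∈ Finset.range i, len j) + r) 0 = (f i).getD r 0 := by
  have hsum : ∀ i ≤ m, ((((List.finRange m).map f).take i).map List.length).sum =
      ∑ j ∈ Finset.range i, len j := by
    intro i hi
    induction i with
    | zero => simp
    | succ i ih =>
      rw [Finset.sum_range_succ, ← ih (by omega), List.take_succ_eq_append_getElem (by simpa using hi)]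
      simp [hlen]
  have := List.getD_flatten ((List.finRange m).map f) i (by simp) r (by simp [hlen, hr])
  rw [hsum i i.2.le] at this
  rw [List.flatMap_def, this]
  simp

theorem List.length_flatMap_finRange {m : ℕ} (f : Fin m → List ℕ) (len : ℕ → ℕ)
    (hlen : ∀ i, (f i).length = len i) :
    ((List.finRange m).flatMap f).length = ∑ j ∈ Finset.range m, len j := by
  rw [List.length_flatMap, ← Fin.sum_univ_eq_sum_range, List.finRange_eq_pmap_range, ← List.finRange_eq_pmap_range]
  simp [hlen, ← List.sum_ofFn, List.ofFn_eq_map]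

end Lists

namespace TreeDecomposition

variable {n m : ℕ} {G : SimpleGraph (Fin n)} (D : TreeDecomposition G m)

/-- The size of the bag of a node with a given number. -/
def bagSize (i : ℕ) : ℕ := if h : i < m then (D.bag ⟨i, h⟩).card else 0

/-- The position of the bag of a node in the input. -/
def bagOffset (i : ℕ) : ℕ := 4 + n * n + n + m + ∑ j ∈ Finset.range i, (D.bagSize j + 1)

theorem bagSize_eq (i : Fin m) : D.bagSize i = (D.bag i).card := by rw [bagSize, dif_pos i.2]

theorem bagOffset_succ (i : ℕ) : D.bagOffset (i + 1) = D.bagOffset i + D.bagSize i + 1 := by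
  rw [bagOffset, bagOffset, Finset.sum_range_succ]
  ring

theorem bagOffset_mono : Monotone D.bagOffset := monotone_nat_of_le_succ fun i => by
  rw [bagOffset_succ]; omega

/-- The exact length of the input depends on the bag sizes, whereas this bound needs only `n` and
`m`; it is the address at which the arrays are placed. -/
theorem bagOffset_le : D.bagOffset m ≤ 4 + n * n + n + m + m * (n + 1) := by
  rw [bagOffset]
  refine Nat.add_le_add_left ?_ _
  calc _ ≤ ∑ _j ∈ Finset.range m, (n + 1) := Finset.sum_le_sum fun j hj => by
        rw [bagSize, dif_pos (Finset.mem_range.1 hj)]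
        exact Nat.add_le_add_right ((Finset.card_le_univ _).trans_eq (Fintype.card_fin n)) 1
    _ = _ := by simp

end TreeDecomposition

namespace Loop

variable {n m : ℕ} {G : SimpleGraph (Fin n)}

/-- The environment contains the given instance. -/
structure Input (E : Env) (G : SimpleGraph (Fin n)) (D : TreeDecomposition G m)
    (S : Finset (Fin n)) (k : ℕ) : Prop where
  n_eq : E.I 0 = n
  m_eq : E.I 1 = m
  k_eq : E.I 2 = k
  adj : ∀ u v : Fin n, (G.Adj u v → E.I (3 + u * n + v) = 1) ∧
    (¬ G.Adj u v → E.I (3 + u * n + v) = 0)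
  mem_S : ∀ v : Fin n, (v ∈ S → E.I (3 + n * n + v) = 1) ∧ (v ∉ S → E.I (3 + n * n + v) = 0)
  root : E.I (3 + n * n + n) = D.root
  parent : ∀ i : Fin m, E.I (4 + n * n + n + i) = D.parent i
  size : ∀ i : Fin m, E.I (D.bagOffset i) = (D.bag i).card
  bag : ∀ (i : Fin m), ∀ r < (D.bag i).card, ∃ v ∈ D.bag i, E.I (D.bagOffset i + 1 + r) = (v : ℕ)
  bag_surj : ∀ (i : Fin m), ∀ v ∈ D.bag i, ∃ r < (D.bag i).card,
    E.I (D.bagOffset i + 1 + r) = (v : ℕ)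
  base : D.bagOffset m ≤ E.base

variable (D : TreeDecomposition G m) (S : Finset (Fin n)) (k : ℕ)

theorem input_encodeInstance {E : Env} (hI : ∀ i, E.I i = (encodeInstance G D S k).getD i 0)
    (hbase : D.bagOffset m ≤ E.base) : Input E G D S k := by
  classical
  set A := (List.finRange n).flatMap (fun u => (List.finRange n).map fun v =>
        if G.Adj u v then 1 else 0) with hA
  set B := (List.finRange n).map (fun v => if v ∈ S then 1 else 0) with hB
  set P := (List.finRange m).map (fun i => (D.parent i : ℕ)) with hP
  set T := (List.finRange m).flatMap (fun i =>
        (D.bag i).card :: ((D.bag i).sort (· ≤ ·)).map fun v => (v : ℕ)) with hT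
  have hL : encodeInstance G D S k = [n, m, k] ++ (A ++ (B ++ ([(D.root : ℕ)] ++ (P ++ T)))) := by
    simp only [encodeInstance, List.append_assoc, hA, hB, hP, hT]
  have lA : A.length = n * n := by
    rw [hA, List.length_flatMap_finRange _ (fun _ => n) (by simp)]
    simp
  have lB : B.length = n := by simp [hB]
  have lP : P.length = m := by simp [hP]
  have eA : ∀ i < n * n, E.I (3 + i) = A.getD i 0 := fun i hi => by
    rw [hI, hL, List.getD_append_right _ _ _ _ (by simp), List.getD_append _ _ _ _ (by simp; omega)]
    simp
  have eB : ∀ i < n, E.I (3 + n * n + i) = B.getD i 0 := fun i hi => by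
    rw [hI, hL, List.getD_append_right _ _ _ _ (by simp; omega),
      List.getD_append_right _ _ _ _ (by simp; omega), List.getD_append _ _ _ _ (by simp; omega)]
    congr 1
    simp
    omega
  have eP : ∀ i < m, E.I (4 + n * n + n + i) = P.getD i 0 := fun i hi => by
    rw [hI, hL, List.getD_append_right _ _ _ _ (by simp; omega),
      List.getD_append_right _ _ _ _ (by simp; omega),
      List.getD_append_right _ _ _ _ (by simp; omega),
      List.getD_append_right _ _ _ _ (by simp; omega), List.getD_append _ _ _ _ (by simp; omega)]
    congr 1
    simp
    omega
  have eT : ∀ i, E.I (4 + n * n + n + m + i) = T.getD i 0 := fun i => by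
    rw [hI, hL, List.getD_append_right _ _ _ _ (by simp; omega),
      List.getD_append_right _ _ _ _ (by simp; omega),
      List.getD_append_right _ _ _ _ (by simp; omega),
      List.getD_append_right _ _ _ _ (by simp; omega),
      List.getD_append_right _ _ _ _ (by simp; omega)]
    congr 1
    simp
    omega
  have hrow : ∀ i : Fin m, ((D.bag i).card :: ((D.bag i).sort (· ≤ ·)).map fun v => (v : ℕ)).length =
      D.bagSize i + 1 := fun i => by simp [D.bagSize_eq]
  have eBag : ∀ (i : Fin m) r, r < (D.bag i).card + 1 → E.I (D.bagOffset i + r) =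
      ((D.bag i).card :: ((D.bag i).sort (· ≤ ·)).map fun v => (v : ℕ)).getD r 0 := by
    intro i r hr
    rw [TreeDecomposition.bagOffset, add_assoc, eT, hT]
    exact List.getD_flatMap_finRange _ (fun j => D.bagSize j + 1) hrow i r (by rwa [D.bagSize_eq])
  have hsort : ∀ i, ((D.bag i).sort (· ≤ ·)).length = (D.bag i).card := fun i => by simp
  have eElt : ∀ (i : Fin m) r (hr : r < (D.bag i).card), E.I (D.bagOffset i + 1 + r) =
      (((D.bag i).sort (· ≤ ·))[r]'(by rwa [hsort]) : Fin n) := by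
    intro i r hr
    rw [add_assoc, add_comm 1 r, eBag i (r + 1) (by omega), List.getD_cons_succ,
      List.getD_eq_getElem _ _ (by simpa using hr)]
    simp [← List.map_eq_flatMap]
  have eAdj : ∀ u v : Fin n, E.I (3 + u * n + v) = if G.Adj u v then 1 else 0 := by
    intro u v
    have hu : (u : ℕ) * n + v < n * n :=
      calc (u : ℕ) * n + v < (u + 1) * n := by rw [add_mul, one_mul]; have := v.2; omega
        _ ≤ n * n := Nat.mul_le_mul_right _ u.2
    have := List.getD_flatMap_finRange (fun u : Fin n => (List.finRange n).map fun v =>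
        if G.Adj u v then 1 else 0) (fun _ => n) (by simp) u v v.2
    simp only [Finset.sum_const, Finset.card_range, smul_eq_mul] at this
    rw [add_assoc, eA _ hu, hA, this, List.getD_eq_getElem _ _ (by simp)]
    simp
  have eS : ∀ v : Fin n, E.I (3 + n * n + v) = if v ∈ S then 1 else 0 := by
    intro v
    rw [eB v v.2, hB, List.getD_eq_getElem _ _ (by simp)]
    simp
  refine ⟨?_, ?_, ?_, fun u v => ?_, fun v => ?_, ?_, fun i => ?_, fun i => ?_, fun i r hr => ?_,
    fun i v hv => ?_, hbase⟩
  · rw [hI, hL]; simp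
  · rw [hI, hL]; simp
  · rw [hI, hL]; simp
  · rw [eAdj]
    exact ⟨fun h => if_pos h, fun h => if_neg h⟩
  · rw [eS]
    exact ⟨fun h => if_pos h, fun h => if_neg h⟩
  · rw [hI, hL, List.getD_append_right _ _ _ _ (by simp; omega),
      List.getD_append_right _ _ _ _ (by simp; omega),
      List.getD_append_right _ _ _ _ (by simp; omega), List.getD_append _ _ _ _ (by simp; omega)]
    have : 3 + n * n + n - [n, m, k].length - A.length - B.length = 0 := by simp; omega
    rw [this]
    simp
  · rw [eP i i.2, hP, List.getD_eq_getElem _ _ (by simp)]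
    simp
  · have := eBag i 0 (by omega)
    simpa using this
  · refine ⟨_, ?_, eElt i r hr⟩
    rw [← Finset.mem_sort (· ≤ ·)]
    exact List.getElem_mem _
  · rw [← Finset.mem_sort (· ≤ ·)] at hv
    obtain ⟨r, hr, h⟩ := List.getElem_of_mem hv
    rw [hsort] at hr
    exact ⟨r, hr, by rw [eElt i r hr, h]⟩

theorem mem_encodeInstance_le {a : ℕ} (ha : a ∈ encodeInstance G D S k) : a ≤ n + m + k + 1 := by
  simp only [encodeInstance, List.mem_append, List.mem_cons, List.not_mem_nil, or_false,
    List.mem_flatMap, List.mem_map] at ha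
  rcases ha with (((((h | h | h) | ⟨u, -, v, -, h⟩) | ⟨v, -, h⟩) | h) | ⟨i, -, h⟩) |
    ⟨i, -, h | ⟨v, h', h⟩⟩
  · omega
  · omega
  · omega
  · split_ifs at h <;> omega
  · split_ifs at h <;> omega
  · have := D.root.2; omega
  · have := (D.parent i).2; omega
  · have := (Finset.card_le_univ (D.bag i)).trans_eq (Fintype.card_fin n); omega
  · simp only [List.bind_eq_flatMap, List.mem_flatMap, List.pure_def, List.mem_singleton] at h'
    obtain ⟨x, -, h'⟩ := h'
    omega

theorem length_encodeInstance : (encodeInstance G D S k).length = D.bagOffset m := by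
  rw [TreeDecomposition.bagOffset]
  simp only [encodeInstance, List.length_append]
  rw [List.length_flatMap_finRange _ (fun _ => n) (by simp),
    List.length_flatMap_finRange _ (fun i => D.bagSize i + 1) (by simp [D.bagSize_eq])]
  simp
  ring

end Loop

/-! ### Reading the input and choosing the field -/

namespace Loop

variable {E : Env}

/-- The words of the machine are large enough. -/
structure Room (E : Env) (n m k p : ℕ) : Prop where
  cube : 8 * (n + 2) ^ 3 < E.B
  sum : E.base + n + m + k + 3 < E.B
  pow : 4 ^ (p + 2) < E.B

/-- The parameters have been read. -/
structure Header (n m k : ℕ) (s : St) : Prop where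
  n : s.v .n = n
  m : s.v .m = m
  k : s.v .k = k

theorem Header.of_frame {n m k : ℕ} {s s' : St} {P : Stmt} (h : Header n m k s)
    (hf : Frame P s s') (hn : P.writesV .n = false) (hm : P.writesV .m = false)
    (hk : P.writesV .k = false) : Header n m k s' :=
  ⟨(hf.v _ hn).trans h.n, (hf.v _ hm).trans h.m, (hf.v _ hk).trans h.k⟩

theorem wp_header {n m : ℕ} {G : SimpleGraph (Fin n)} {D : TreeDecomposition G m}
    {S : Finset (Fin n)} {k : ℕ} (hI : Input E G D S k) (s : St) :
    WP E header 4 (fun s' => Header n m k s' ∧ s'.v .root = D.root) s := by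
  intro _
  have h := hI.base
  rw [TreeDecomposition.bagOffset] at h
  have : 2 < E.base := by omega
  have : 1 < E.base := by omega
  have : 0 < E.base := by omega
  have : 3 + n * n + n < E.base := by omega
  refine ⟨?_, ?_, ⟨?_, ?_, ?_⟩, ?_⟩ <;>
    simp [ok, cost, run, header, hI.n_eq, hI.m_eq, hI.k_eq, hI.root, *]

/-- As long as doubling continues, the power exceeds the number of rounds, so `(n + 2) ^ 3` rounds
suffice. Doubling stops at the first power beyond this bound, hence the factor two in the upper
estimate. -/
theorem wp_fieldSize {n m k p : ℕ} (hE : Room E n m k p) {s : St} (hs : Header n m k s) :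
    WP E fieldSize (4 * (n + 2) ^ 3 + 5) (fun s' => ∃ q, 1 ≤ q ∧ s'.v .q = q ∧ s'.v .fs = 2 ^ q ∧
      s'.v .N = 2 ^ q - 1 ∧ (n + 2) ^ 3 < 2 ^ q ∧ 2 ^ q ≤ 2 * (n + 2) ^ 3) s := by
  have hc := hE.cube
  have h2 : 2 ^ 3 ≤ (n + 2) ^ 3 := Nat.pow_le_pow_left (by omega) 3
  set c := (n + 2) ^ 3 with hcd
  let I : ℕ → St → Prop := fun t s' => (∃ q, 1 ≤ q ∧ s'.v .q = q ∧ s'.v .fs = 2 ^ q ∧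
      (c < 2 ^ q ∨ t < 2 ^ q) ∧ 2 ^ q ≤ 2 * c) ∧ s'.v .bd = c
  refine WP.le (T := 1 + (1 + (1 + ((c * (3 + 1) + 1) + 1)))) ?_ (by omega)
  refine WP.seq' (WP.set c (by simp [hs.n, hcd]; ring) (by omega) ?_)
  refine WP.seq' (WP.set 2 rfl (by omega) ?_)
  refine WP.seq' (WP.set 1 rfl (by omega) ?_)
  refine WP.seq (WP.loop c I _ rfl (by omega) ⟨⟨1, le_rfl, rfl, rfl, by simp, by omega⟩, rfl⟩
    fun t ht s' hf hb ⟨⟨q, hq, h1, h2, h3, h4⟩, h5⟩ => WP.ite (T := 1 + 1) (fun h => ?_) (fun h => ?_)) ?_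
  · simp [h2, h5] at h
    exact WP.le (WP.skip ⟨⟨q, hq, h1, h2, .inl h, h4⟩, h5⟩) (by omega)
  · simp [h2, h5] at h
    have hqB : q + 1 < E.B := (Nat.succ_le_of_lt q.lt_two_pow_self).trans_lt (by omega)
    refine WP.seq' (WP.set (2 ^ (q + 1)) (by simp [h2, pow_succ']) (by rw [pow_succ]; omega) ?_)
    refine WP.set (q + 1) (by simp [h1]) (by omega) ⟨⟨q + 1, by omega, rfl, rfl, ?_, ?_⟩, h5⟩
    all_goals rw [pow_succ]; omega
  · rintro s' hf ⟨⟨q, hq, h1, h2, h3, h4⟩, h5⟩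
    exact WP.set (2 ^ q - 1) (by simp [h2]) (by omega) ⟨q, hq, h1, h2, rfl, by omega, h4⟩

theorem wp_randomElements {n m k p : ℕ} (hE : Room E n m k p) {s : St} (hs : Header n m k s)
    {q : ℕ} (hq : s.v .q = q) (hq' : 2 ^ q < E.B) :
    WP E randomElements (n * (3 * q + 4) + 1) (fun s' => ∀ i < n, s'.a .X i =
      RandomBits.bitsVal (fun j => s.coins (i * q + j)) q) s := by
  have hn := hE.sum
  have hbits (f) : ∀ j ≤ q, RandomBits.bitsVal f j < E.B := fun j hj =>
    (RandomBits.bitsVal_lt _ _).trans_le ((Nat.pow_le_pow_right (by omega) hj).trans hq'.le)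
  refine WP.mono (WP.loop n (fun i s' => (∀ i' < i, s'.a .X i' =
      RandomBits.bitsVal (fun j => s.coins (i' * q + j)) q) ∧
      s'.coins = fun j => s.coins (i * q + j)) (1 + ((q * (1 + 1 + 1) + 1) + 1)) hs.n (by omega) (by simp)
      fun i hi s' hf hb ⟨h1, h2⟩ => ?_) ?_ fun _ _ _ h => h.1
  · refine WP.seq' (WP.set 0 rfl (by omega) ?_)
    refine WP.seq (WP.loop q (fun j s'' => s''.v .x = RandomBits.bitsVal s'.coins j ∧
      s''.a .X = s'.a .X ∧ s''.coins = fun r => s'.coins (j + r))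
      _ ((hf.v .q rfl).trans hq) (q.lt_two_pow_self.trans hq').le ⟨rfl, rfl, by simp⟩
      fun j hj s'' hf' hb' ⟨h3, h4, h6⟩ => ?_) ?_
    · have hx : 2 * s''.v .x + (s''.coins 0).toNat = RandomBits.bitsVal s'.coins (j + 1) := by
        rw [h3, h6]; rfl
      refine WP.seq' (WP.flip (WP.set _ hx (hbits _ _ hj) ⟨rfl, h4, funext fun r => ?_⟩))
      change s''.coins (r + 1) = _
      rw [h6]
      exact congrArg _ (by ring)
    · rintro s'' hf' ⟨h3, h4, h6⟩
      refine WP.put i _ (hf'.v .i rfl) h3 (hbits _ _ le_rfl) ⟨fun i' hi' => ?_, ?_⟩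
      · rw [setA_a, if_pos rfl, Function.update_apply]
        split_ifs with h
        · rw [h2, h]
        · rw [h4]
          exact h1 i' (by omega)
      · rw [setA_coins, h6, h2]
        funext r
        exact congrArg _ (by ring)
  · rw [show 1 + (q * (1 + 1 + 1) + 1 + 1) + 1 = 3 * q + 4 by ring]

theorem wp_bagPointers {n m k p : ℕ} {G : SimpleGraph (Fin n)} {D : TreeDecomposition G m}
    {S : Finset (Fin n)} (hE : Room E n m k p) (hI : Input E G D S k) {s : St}
    (hs : Header n m k s) :
    WP E bagPointers (4 * m + 2) (fun s' => ∀ i < m, s'.a .PTR i = D.bagOffset i) s := by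
  have hb := hI.base
  have h := hE.sum
  have hle : ∀ i ≤ m, D.bagOffset i ≤ E.base := fun i hi => (D.bagOffset_mono hi).trans hb
  refine WP.le (T := 1 + (m * ((1 + (1 + 1)) + 1) + 1)) ?_ (by omega)
  refine WP.seq' (WP.set (D.bagOffset 0) ?_ ((hle 0 (by omega)).trans_lt (by omega)) ?_)
  · simp [hs.n, hs.m, TreeDecomposition.bagOffset]
  refine WP.mono (WP.loop m (fun i s' => (∀ i' < i, s'.a .PTR i' = D.bagOffset i') ∧
    s'.v .cur = D.bagOffset i) (1 + (1 + 1)) hs.m (by omega) ⟨by simp, rfl⟩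
    fun i hi s' hf hb ⟨h1, h2⟩ => ?_) le_rfl fun _ _ _ h => h.1
  have h3 := D.bagOffset_succ i
  have h4 := hle (i + 1) hi
  refine WP.seq' (WP.put i _ rfl h2 (by omega) ?_)
  refine WP.seq' (WP.inp (D.bagOffset i) h2 (by omega) ?_)
  have h5 : E.I (D.bagOffset i) = D.bagSize i := by
    have := hI.size ⟨i, hi⟩
    rwa [← D.bagSize_eq] at this
  refine WP.set (D.bagOffset (i + 1)) (by simp [h2, h5, h3]) (by omega) ⟨fun i' hi' => ?_, rfl⟩
  simp only [setV_a, setA_a, if_true, Function.update_apply]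
  split_ifs with h6
  · rw [h6]
  · exact h1 i' (by omega)

end Loop

/-! ### The chordal completion -/

theorem Nat.mul_add_inj {n u v u' v' : ℕ} (hv : v < n) (hv' : v' < n) :
    u * n + v = u' * n + v' ↔ u = u' ∧ v = v' := by
  refine ⟨fun h => ?_, by rintro ⟨rfl, rfl⟩; rfl⟩
  have h1 := congrArg (· / n) h
  have h2 := congrArg (· % n) h
  have hn : 0 < n := by omega
  simp only [Nat.mul_comm _ n, Nat.mul_add_div hn, Nat.mul_add_mod, Nat.div_eq_of_lt hv,
    Nat.div_eq_of_lt hv', Nat.mod_eq_of_lt hv, Nat.mod_eq_of_lt hv', add_zero] at h1 h2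
  exact ⟨h1, h2⟩

theorem Nat.mul_add_lt_mul {n u v a : ℕ} (hu : u < a) (hv : v < n) : u * n + v < a * n :=
  calc u * n + v < (u + 1) * n := by rw [add_mul, one_mul]; omega
    _ ≤ a * n := Nat.mul_le_mul_right _ hu

theorem ite_exists_lt_succ {α : Type*} {P : ℕ → Prop} {j : ℕ} [Decidable (P j)]
    [Decidable (∃ r < j, P r)] [Decidable (∃ r < j + 1, P r)] (a b : α) :
    (if ∃ r < j + 1, P r then a else b) = if P j then a else if ∃ r < j, P r then a else b := by
  have h : (∃ r < j + 1, P r) ↔ (∃ r < j, P r) ∨ P j := Nat.exists_lt_succ_right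
  by_cases h1 : P j
  · rw [if_pos h1, if_pos (h.2 (.inr h1))]
  · rw [if_neg h1]
    exact if_congr (h.trans (or_iff_left h1)) rfl rfl

namespace Loop

variable {E : Env} {n m k p : ℕ} {G : SimpleGraph (Fin n)} {D : TreeDecomposition G m}
    {S : Finset (Fin n)}

theorem Input.offset_add_lt (hI : Input E G D S k) (i : Fin m) {r : ℕ} (hr : r < (D.bag i).card) :
    D.bagOffset i + 1 + r < E.base := by
  have h1 := D.bagOffset_succ i
  have h2 := D.bagOffset_mono (show (i : ℕ) + 1 ≤ m from i.2)
  have h3 := hI.base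
  rw [D.bagSize_eq] at h1
  omega

theorem Input.offset_lt (hI : Input E G D S k) (i : Fin m) : D.bagOffset i < E.base := by
  have h1 := D.bagOffset_succ i
  have h2 := D.bagOffset_mono (show (i : ℕ) + 1 ≤ m from i.2)
  have h3 := hI.base
  omega

/-- The mark `i + 1` is a time stamp: all earlier marks are at most `i`, so the array is never
cleared and the cost is linear in the bag. The root is its own parent, so its parent bag is treated
as empty. -/
theorem wp_markParent (hE : Room E n m k p) (hI : Input E G D S k) (hp : D.width ≤ p) {s : St}
    (hs : Header n m k s) (hroot : s.v .root = D.root) (hptr : ∀ i < m, s.a .PTR i = D.bagOffset i)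
    (i : Fin m) (hi : s.v .i = i) (hmark : ∀ a, s.a .MARK a ≤ i) :
    WP E markParent (3 * p + 9) (fun s' => (∀ a, s'.a .MARK a ≤ i + 1) ∧
      ∀ v : Fin n, s'.a .MARK v = i + 1 ↔ i ≠ D.root ∧ v ∈ D.bag (D.parent i)) s := by
  have hsum := hE.sum
  have hbase := hI.base
  have hi' := i.2
  have hpar := (D.parent i).2
  set c := D.parent i with hc
  have hcard := (D.card_bag_le c).trans (Nat.add_le_add_right hp 1)
  have hcn := (Finset.card_le_univ (D.bag c)).trans_eq (Fintype.card_fin n)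
  set l := if i = D.root then 0 else (D.bag c).card with hl
  have hlc : l ≤ (D.bag c).card := by rw [hl]; split_ifs <;> omega
  refine WP.le (T := 1 + (1 + (1 + ((1 + 1) + (l * ((1 + 1) + 1) + 1))))) ?_ (by omega)
  refine WP.seq' (WP.inp (4 + n * n + n + i) (by simp [hs.n, hi])
    (by rw [TreeDecomposition.bagOffset] at hbase; omega) ?_)
  rw [hI.parent, ← hc]
  refine WP.seq' (WP.set (D.bagOffset c) (hptr c hpar) ((hI.offset_lt c).trans (by omega)) ?_)
  refine WP.seq' (WP.inp (D.bagOffset c) rfl (hI.offset_lt c) ?_)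
  rw [hI.size]
  refine WP.seq (R := fun s' => s'.v .psz = l ∧ s'.v .pp = D.bagOffset c ∧ s'.v .i = i ∧
    s'.a .MARK = s.a .MARK) (WP.ite (fun h => ?_) fun h => ?_) ?_
  · have : i = D.root := by
      simpa [hi, hroot, Fin.ext_iff] using h
    refine WP.set 0 rfl (by omega) ⟨?_, rfl, hi, rfl⟩
    rw [hl, if_pos this]; rfl
  · have : i ≠ D.root := by
      simpa [hi, hroot, Fin.ext_iff] using h
    refine WP.skip ⟨?_, rfl, hi, rfl⟩
    rw [hl, if_neg this]; rfl
  · rintro s₁ - ⟨h1, h2, h3, h4⟩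
    refine WP.mono (WP.loop l (fun j s' => ∀ a, s'.a .MARK a =
      if ∃ r < j, a = E.I (D.bagOffset c + 1 + r) then (i : ℕ) + 1 else s.a .MARK a) (1 + 1) h1
      (by omega) (by simp [h4]) fun j hj s' hf hb h => ?_) le_rfl ?_
    · refine WP.seq' (WP.inp (D.bagOffset c + 1 + j) ?_ (hI.offset_add_lt c (by omega)) ?_)
      · simp [(hf.v .pp rfl).trans h2]
      · refine WP.put (E.I (D.bagOffset c + 1 + j)) (i + 1) rfl ?_ (by omega) fun a => ?_
        · simp [(hf.v .i rfl).trans h3]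
        · simp only [setA_a, if_true, Function.update_apply, setV_a, h, ite_exists_lt_succ]
    · intro s' _ _ h
      refine ⟨fun a => ?_, fun v => ?_⟩
      · rw [h]
        have := hmark a
        split_ifs <;> omega
      · rw [h]
        have := hmark v
        by_cases hr : i = D.root
        · have : ¬ ∃ r < l, (v : ℕ) = E.I (D.bagOffset c + 1 + r) := by
            rintro ⟨r, h, -⟩
            rw [hl, if_pos hr] at h
            exact absurd h (Nat.not_lt_zero r)
          rw [if_neg this]
          simp only [hr, ne_eq, not_true_eq_false, false_and, iff_false]
          rw [← hr]
          omega
        · have : (∃ r < l, (v : ℕ) = E.I (D.bagOffset c + 1 + r)) ↔ v ∈ D.bag c := by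
            rw [hl, if_neg hr]
            constructor
            · rintro ⟨r, h1, h2⟩
              obtain ⟨v', h3, h4⟩ := hI.bag c r h1
              rwa [Fin.ext (h2.trans h4)]
            · intro hv
              obtain ⟨r, h1, h2⟩ := hI.bag_surj c v hv
              exact ⟨r, h1, h2.symm⟩
          simp only [this]
          split_ifs with h5
          · simp [hr, h5]
          · simp [h5]; omega

theorem wp_testSubset (hE : Room E n m k p) (hI : Input E G D S k) (hp : D.width ≤ p) {s : St}
    (hptr : ∀ i < m, s.a .PTR i = D.bagOffset i) (i : Fin m) (hi : s.v .i = i)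
    (hmark : ∀ v : Fin n, s.a .MARK v = i + 1 ↔ i ≠ D.root ∧ v ∈ D.bag (D.parent i)) :
    WP E testSubset (4 * p + 8) (fun s' => s'.v .sz = (D.bag i).card ∧ s'.v .pp = D.bagOffset i ∧
      (s'.v .sub = 0 ↔ ∃ x, D.IsTop i x)) s := by
  have hsum := hE.sum
  have hcard := (D.card_bag_le i).trans (Nat.add_le_add_right hp 1)
  have hcn := (Finset.card_le_univ (D.bag i)).trans_eq (Fintype.card_fin n)
  refine WP.le (T := 1 + (1 + (1 + ((D.bag i).card * ((1 + (1 + 1)) + 1) + 1)))) ?_ (by omega)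
  refine WP.seq' (WP.set (D.bagOffset i) (by simp [hi, hptr i i.2])
    ((hI.offset_lt i).trans (by omega)) ?_)
  refine WP.seq' (WP.inp (D.bagOffset i) rfl (hI.offset_lt i) ?_)
  rw [hI.size]
  refine WP.seq' (WP.set 1 rfl (by omega) ?_)
  refine WP.mono (WP.loop (D.bag i).card (fun j s' => (s'.v .sub = 0 ↔ ∃ r < j,
    s.a .MARK (E.I (D.bagOffset i + 1 + r)) ≠ i + 1)) (1 + (1 + 1)) rfl
    (by omega) (by simp) fun j hj s' hf hb h => ?_) le_rfl ?_
  · refine WP.seq' (WP.inp (D.bagOffset i + 1 + j) ?_ (hI.offset_add_lt i (by omega)) ?_)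
    · have : s'.v .pp = D.bagOffset i := hf.v .pp rfl
      simp [this]
    · have h1 : s'.v .i = i := (hf.v .i rfl).trans hi
      have h2 : s'.a .MARK = s.a .MARK := hf.a .MARK rfl
      refine WP.ite (fun h' => WP.skip ?_) fun h' => WP.set 0 rfl (by omega) ?_
      · simp only [eval_eq, eval_get, eval_var, setV_v, setV_a, if_true, h2] at h'
        simp [h1] at h'
        simp only [setV_v]
        simp only [reduceCtorEq, if_false, h, Nat.lt_succ_iff_lt_or_eq]
        refine ⟨fun ⟨r, hr, hr'⟩ => ⟨r, .inl hr, hr'⟩, ?_⟩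
        rintro ⟨r, hr | rfl, hr'⟩
        exacts [⟨r, hr, hr'⟩, absurd h' hr']
      · simp only [eval_eq, eval_get, eval_var, setV_v, setV_a, if_true, h2] at h'
        simp [h1] at h'
        simp only [setV_v, if_true, true_iff]
        exact ⟨j, by omega, h'⟩
  · intro s' hf _ h
    refine ⟨hf.v .sz rfl, hf.v .pp rfl, h.trans ?_⟩
    constructor
    · rintro ⟨r, hr, hr'⟩
      obtain ⟨x, h1, h2⟩ := hI.bag i r hr
      rw [h2, Ne, hmark] at hr'
      refine ⟨x, h1, ?_⟩
      tauto
    · rintro ⟨x, h1, h2⟩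
      obtain ⟨r, hr, hr'⟩ := hI.bag_surj i x h1
      refine ⟨r, hr, ?_⟩
      rw [hr', Ne, hmark]
      tauto

theorem wp_addClique (hE : Room E n m k p) (hI : Input E G D S k) (hp : D.width ≤ p) {s : St}
    (hs : Header n m k s) (i : Fin m) (hsz : s.v .sz = (D.bag i).card)
    (hpp : s.v .pp = D.bagOffset i) :
    WP E addClique (9 * (p + 1) ^ 2) (fun s' => ∀ u v : Fin n, s'.a .H (u * n + v) =
      if u ∈ D.bag i ∧ v ∈ D.bag i then 1 else s.a .H (u * n + v)) s := by
  have hsum := hE.sum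
  have hcard := (D.card_bag_le i).trans (Nat.add_le_add_right hp 1)
  have hcn := (Finset.card_le_univ (D.bag i)).trans_eq (Fintype.card_fin n)
  set l := (D.bag i).card with hl
  have hT : l * ((1 + (l * ((1 + 1) + 1) + 1)) + 1) + 1 ≤ 9 * (p + 1) ^ 2 := by nlinarith
  refine WP.le ?_ hT
  set x : ℕ → ℕ := fun r => E.I (D.bagOffset i + 1 + r) with hx
  have hxr (r) (hr : r < l) : ∃ v ∈ D.bag i, x r = (v : ℕ) := hI.bag i r hr
  classical
  refine WP.mono (WP.loop l (fun j s' => ∀ a, s'.a .H a = if ∃ r < j, ∃ r' < l, a = x r * n + x r'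
    then 1 else s.a .H a) _ hsz (by omega) (by simp) fun j hj s' hf hb h => ?_) le_rfl ?_
  · refine WP.seq' (WP.inp (D.bagOffset i + 1 + j) ?_ (hI.offset_add_lt i (by omega)) ?_)
    · simp [(hf.v .pp rfl).trans hpp]
    refine WP.mono (WP.loop l (fun j' s'' => ∀ a, s''.a .H a = if ∃ r' < j', a = x j * n + x r'
      then 1 else s'.a .H a) (1 + 1) ((hf.v .sz rfl).trans hsz) (by omega) (by simp)
      fun j' hj' s'' hf' hb' h' => ?_) le_rfl ?_
    · refine WP.seq' (WP.inp (D.bagOffset i + 1 + j') ?_ (hI.offset_add_lt i (by omega)) ?_)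
      · simp [(hf'.v .pp rfl).trans ((hf.v .pp rfl).trans hpp)]
      refine WP.put (x j * n + x j') 1 ?_ rfl (by omega) fun a => ?_
      · have h1 : s''.v .u = x j := hf'.v .u rfl
        have h2 : s''.v .n = n := (hf'.v .n rfl).trans ((hf.v .n rfl).trans hs.n)
        simp [h1, h2, hx]
      · simp only [setA_a, if_true, Function.update_apply, setV_a, h', ite_exists_lt_succ]
    · intro s'' _ _ h' a
      rw [h', h, ite_exists_lt_succ]
  · intro s' _ _ h u v
    rw [h]
    congr 1
    refine propext ⟨?_, fun ⟨hu, hv⟩ => ?_⟩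
    · rintro ⟨r, hr, r', hr', h⟩
      obtain ⟨u', h1, h2⟩ := hxr r hr
      obtain ⟨v', h3, h4⟩ := hxr r' hr'
      rw [h2, h4, Nat.mul_add_inj v.2 v'.2] at h
      rw [Fin.ext h.1, Fin.ext h.2]
      exact ⟨h1, h3⟩
    · obtain ⟨r, h1, h2⟩ := hI.bag_surj i u hu
      obtain ⟨r', h3, h4⟩ := hI.bag_surj i v hv
      exact ⟨r, h1, r', h3, by rw [hx]; simp only [h2, h4]⟩

-- By `share_iff_exists_isTop`, bags contained in the bag of their parent contribute nothing new.
-- Only the others, at most `n` by `card_isTop_le`, pay the quadratic price of a clique, while every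
-- node pays `O(p + 1)`.
open Classical in
theorem wp_completion (hE : Room E n m k p) (hI : Input E G D S k) (hp : D.width ≤ p) {s : St}
    (hs : Header n m k s) (hroot : s.v .root = D.root) (hptr : ∀ i < m, s.a .PTR i = D.bagOffset i)
    (hmark : ∀ a, s.a .MARK a = 0) (hH : ∀ a, s.a .H a = 0) :
    WP E completion (20 * (m * (p + 1) + n * (p + 1) ^ 2) + 1) (fun s' => ∀ u v : Fin n,
      s'.a .H (u * n + v) = if D.Share u v then 1 else 0) s := by
  have hsum := hE.sum
  set T : ℕ → ℕ := fun i => if ∃ h : i < m, ∃ x, D.IsTop ⟨i, h⟩ x then 9 * (p + 1) ^ 2 else 0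
    with hT
  have hTsum : ∑ i ∈ Finset.range m, T i ≤ n * (9 * (p + 1) ^ 2) := by
    rw [← Fin.sum_univ_eq_sum_range]
    have : ∀ i : Fin m, T i = if ∃ x, D.IsTop i x then 9 * (p + 1) ^ 2 else 0 := fun i => by
      simp [hT]
    rw [Finset.sum_congr rfl fun i _ => this i, ← Finset.sum_filter, Finset.sum_const, smul_eq_mul]
    refine Nat.mul_le_mul_right _ (D.card_isTop_le.trans_eq (Fintype.card_fin n))
  refine WP.mono (T := (∑ i ∈ Finset.range m, (((3 * p + 9) + ((4 * p + 8) + ((T i + 1) + 1))) + 1)) + 1)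
    (WP.for_sum m (fun i s' => (∀ a, s'.a .MARK a ≤ i) ∧ ∀ u v : Fin n,
      s'.a .H (u * n + v) = if ∃ j : Fin m, (j : ℕ) < i ∧ (∃ x, D.IsTop j x) ∧ u ∈ D.bag j ∧ v ∈ D.bag j
      then 1 else 0) _ hs.m (by omega) (by simp [hmark, hH]) fun i hi s' hf hb ⟨h1, h2⟩ => ?_) ?_ ?_
  · have hs' : Header n m k (s'.setV .i i) := hs.of_frame (s' := s'.setV .i i)
      ⟨fun x hx => ?_, fun c hc => hf.a c hc⟩ rfl rfl rfl
    · refine WP.seq (wp_markParent hE hI hp hs' ((hf.v .root rfl).trans hroot)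
        (fun j hj => (congrFun (hf.a .PTR rfl) j).trans (hptr j hj)) ⟨i, hi⟩ rfl h1) ?_
      rintro s₁ hf₁ ⟨h3, h4⟩
      refine WP.seq (wp_testSubset hE hI hp (fun j hj => (congrFun (hf₁.a .PTR rfl) j).trans
        ((congrFun (hf.a .PTR rfl) j).trans (hptr j hj))) ⟨i, hi⟩ (hf₁.v .i rfl) h4) ?_
      rintro s₂ hf₂ ⟨h5, h6, h7⟩
      have hs₂ : Header n m k s₂ := (hs'.of_frame hf₁ rfl rfl rfl).of_frame hf₂ rfl rfl rfl
      have hH₂ : s₂.a .H = s'.a .H := (hf₂.a .H rfl).trans (hf₁.a .H rfl)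
      have hM₂ : s₂.a .MARK = s₁.a .MARK := hf₂.a .MARK rfl
      have step (u v : Fin n) : (∃ j : Fin m, (j : ℕ) < i + 1 ∧ (∃ x, D.IsTop j x) ∧ u ∈ D.bag j ∧ v ∈ D.bag j) ↔
          ((∃ x, D.IsTop ⟨i, hi⟩ x) ∧ u ∈ D.bag ⟨i, hi⟩ ∧ v ∈ D.bag ⟨i, hi⟩) ∨
          ∃ j : Fin m, (j : ℕ) < i ∧ (∃ x, D.IsTop j x) ∧ u ∈ D.bag j ∧ v ∈ D.bag j := by
        constructor
        · rintro ⟨j, hj, h⟩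
          rcases Nat.lt_succ_iff_lt_or_eq.1 hj with hj | hj
          · exact .inr ⟨j, hj, h⟩
          · obtain rfl : j = ⟨i, hi⟩ := Fin.ext hj
            exact .inl h
        · rintro (h | ⟨j, hj, h⟩)
          exacts [⟨⟨i, hi⟩, by simp, h⟩, ⟨j, by omega, h⟩]
      refine WP.ite (T := T i + 1) (fun h => ?_) fun h => ?_
      · refine WP.le (WP.skip ⟨fun a => by rw [hM₂]; exact h3 a, fun u v => ?_⟩) (by omega)
        rw [hH₂, h2]
        congr 1
        rw [step, ← h7]
        simp only [eval_var] at h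
        simp [h]
      · have hTi : T i = 9 * (p + 1) ^ 2 := if_pos ⟨hi, h7.1 h⟩
        refine WP.mono (wp_addClique hE hI hp hs₂ ⟨i, hi⟩ h5 h6) (by omega) fun s₃ hf₃ _ h8 =>
          ⟨fun a => ?_, fun u v => ?_⟩
        · rw [hf₃.a .MARK rfl, hM₂]; exact h3 a
        · rw [h8, hH₂, h2]
          simp only [step]
          have := h7.1 h
          by_cases h9 : u ∈ D.bag ⟨i, hi⟩ ∧ v ∈ D.bag ⟨i, hi⟩
          · simp [h9, this]
          · simp [h9]
    · rw [← hf.v x hx]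
      have : x ≠ .i := by rintro rfl; simp [Stmt.writesV] at hx
      simp [this]
  · simp only [Finset.sum_add_distrib, Finset.sum_const, Finset.card_range, smul_eq_mul]
    nlinarith
  · rintro s' _ _ ⟨-, h⟩ u v
    rw [h]
    congr 1
    rw [D.share_iff_exists_isTop]
    refine propext ⟨fun ⟨j, _, h⟩ => ⟨j, h⟩, fun ⟨j, h⟩ => ⟨j, j.2, h⟩⟩

end Loop

/-! ### The elimination order -/

namespace Loop

variable {E : Env} {n m k p : ℕ} {G : SimpleGraph (Fin n)} {D : TreeDecomposition G m}
    {S : Finset (Fin n)}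

/-- The vertex `v` is simplicial in the completion of the graph on `R`. -/
def Simplicial (D : TreeDecomposition G m) (R : Finset (Fin n)) (v : Fin n) : Prop :=
  v ∈ R ∧ ∀ u ∈ R, ∀ u' ∈ R, D.Share v u → D.Share v u' → D.Share u u'

/-- The array `H` holds the adjacency matrix of the completion. -/
def Completed (D : TreeDecomposition G m) (h : ℕ → ℕ) : Prop :=
  ∀ u v : Fin n, (D.Share u v → h (u * n + v) = 1) ∧ (¬ D.Share u v → h (u * n + v) = 0)

theorem Completed.eq_one_iff {h : ℕ → ℕ} (hh : Completed D h) (u v : Fin n) :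
    h (u * n + v) = 1 ↔ D.Share u v := by
  by_cases hs : D.Share u v
  · simp [hs, (hh u v).1 hs]
  · simp [hs, (hh u v).2 hs]

theorem Completed.ne_zero_iff {h : ℕ → ℕ} (hh : Completed D h) (u v : Fin n) :
    h (u * n + v) ≠ 0 ↔ D.Share u v := by
  by_cases hs : D.Share u v
  · simp [hs, (hh u v).1 hs]
  · simp [hs, (hh u v).2 hs]

theorem wp_testSimplicial (hE : Room E n m k p) {s : St} (hs : Header n m k s)
    (hH : Completed D (s.a .H)) (R : Finset (Fin n))
    (hR : ∀ v : Fin n, (v ∈ R → s.a .DEAD v = 0) ∧ (v ∉ R → s.a .DEAD v = 1))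
    (v : Fin n) (hv : s.v .v = v) :
    WP E testSimplicial (8 * (n + 1) ^ 2) (fun s' => s'.v .simp ≠ 0 ↔ Simplicial D R v) s := by
  have hsum := hE.sum
  set bad : ℕ → ℕ → ℕ := fun a a' => (1 - s.a .DEAD a) * (1 - s.a .DEAD a') *
    s.a .H (v * n + a) * s.a .H (v * n + a') * (1 - s.a .H (a * n + a')) with hbad
  refine WP.le (T := 1 + (n * ((n * ((1 + 1) + 1) + 1) + 1) + 1)) ?_ (by nlinarith)
  have h01 : 1 - s.a .DEAD v ≤ 1 := by omega
  refine WP.seq' (WP.set (1 - s.a .DEAD v) (by simp [hv]) (by omega) ?_)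
  refine WP.mono (WP.loop n (fun i s' => s'.v .simp = 0 ↔ s.a .DEAD v ≠ 0 ∨ ∃ a < i, ∃ a' < n, bad a a' ≠ 0)
    (n * ((1 + 1) + 1) + 1) hs.n (by omega) ?_ fun i hi s₁ hf hb h => ?_) le_rfl ?_
  · simp; omega
  · refine WP.mono (WP.loop n (fun j s' => s'.v .simp = 0 ↔ s₁.v .simp = 0 ∨ ∃ a' < j, bad i a' ≠ 0)
      (1 + 1) ((hf.v .n rfl).trans hs.n) (by omega) (by simp) fun j hj s₂ hf' hb' h' => ?_) le_rfl ?_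
    · have e1 : s₂.v .u = i := hf'.v .u rfl
      have e2 : s₂.v .v = v := (hf'.v .v rfl).trans ((hf.v .v rfl).trans hv)
      have e3 : s₂.v .n = n := (hf'.v .n rfl).trans ((hf.v .n rfl).trans hs.n)
      have e4 : s₂.a .H = s.a .H := (hf'.a .H rfl).trans (hf.a .H rfl)
      have e5 : s₂.a .DEAD = s.a .DEAD := (hf'.a .DEAD rfl).trans (hf.a .DEAD rfl)
      refine WP.ite (fun hc => WP.set 0 rfl (by omega) ?_) fun hc => WP.skip ?_
      · have hc' : bad i j ≠ 0 := by simpa [hbad, e1, e2, e3, e4, e5] using hc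
        simp only [setV_v, if_true, true_iff]
        exact .inr ⟨j, by omega, hc'⟩
      · have hc' : bad i j = 0 := by simpa [hbad, e1, e2, e3, e4, e5] using hc
        simp only [setV_v, reduceCtorEq, if_false, h', Nat.exists_lt_succ_right, hc', ne_eq,
          not_true_eq_false, or_false]
    · intro s₂ _ _ h'
      rw [h', h, Nat.exists_lt_succ_right, or_assoc]
  · intro s' _ _ h
    rw [Ne, h, Simplicial]
    have hD (u : Fin n) : 1 - s.a .DEAD u ≠ 0 ↔ u ∈ R := by
      by_cases hu : u ∈ R
      · simp [hu, (hR u).1 hu]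
      · simp [hu, (hR u).2 hu]
    have hS (u u' : Fin n) : 1 - s.a .H (u * n + u') ≠ 0 ↔ ¬ D.Share u u' := by
      by_cases hu : D.Share u u'
      · simp [hu, (hH u u').1 hu]
      · simp [hu, (hH u u').2 hu]
    have hB (u u' : Fin n) : bad u u' ≠ 0 ↔ u ∈ R ∧ u' ∈ R ∧ D.Share v u ∧ D.Share v u' ∧ ¬ D.Share u u' := by
      simp only [hbad, mul_ne_zero_iff, hD, hS, hH.ne_zero_iff, and_assoc]
    have hv' : s.a .DEAD v ≠ 0 ↔ v ∉ R := by
      by_cases hu : v ∈ R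
      · simp [hu, (hR v).1 hu]
      · simp [hu, (hR v).2 hu]
    rw [hv', not_or, not_not]
    refine and_congr_right fun _ => ?_
    push Not
    constructor
    · intro h u hu u' hu' h1 h2
      by_contra h3
      exact (hB u u').2 ⟨hu, hu', h1, h2, h3⟩ (h u u.2 u' u'.2)
    · intro h a ha a' ha'
      by_contra h3
      obtain ⟨h4, h5, h6, h7, h8⟩ := (hB ⟨a, ha⟩ ⟨a', ha'⟩).1 h3
      exact h8 (h _ h4 _ h5 h6 h7)

/-- The invariant records that each chosen vertex was simplicial among the vertices not chosen
before; `exists_simplicial` supplies the next one. Simpliciality at the time of choice is exactly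
the perfect elimination property. -/
theorem wp_elimination (hE : Room E n m k p) {s : St} (hs : Header n m k s)
    (hH : Completed D (s.a .H)) (hdead : ∀ a, s.a .DEAD a = 0) :
    WP E elimination (16 * (n + 1) ^ 4) (fun s' => ∃ ord : Fin n ≃ Fin n,
      (∀ i : Fin n, s'.a .ORD i = ord i) ∧ ∀ i j j', i < j → i < j' → D.Share (ord i) (ord j) →
        D.Share (ord i) (ord j') → D.Share (ord j) (ord j')) s := by
  classical
  have hsum := hE.sum
  have hT : n * ((1 + ((n * ((8 * (n + 1) ^ 2 + (1 + 1)) + 1) + 1) + (1 + 1))) + 1) + 1 ≤ 16 * (n + 1) ^ 4 := by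
    nlinarith [pow_pos (Nat.succ_pos n) 3, pow_pos (Nat.succ_pos n) 2]
  let rest (f : ℕ → ℕ) (i : ℕ) : Finset (Fin n) := Finset.univ.filter fun v => ∀ j < i, f j ≠ v
  refine WP.mono (WP.loop n (fun i s' =>
    (∀ j < i, ∃ v : Fin n, s'.a .ORD j = v ∧ Simplicial D (rest (s'.a .ORD) j) v) ∧
    (∀ v : Fin n, (v ∈ rest (s'.a .ORD) i → s'.a .DEAD v = 0) ∧ (v ∉ rest (s'.a .ORD) i → s'.a .DEAD v = 1)))
    (1 + ((n * ((8 * (n + 1) ^ 2 + (1 + 1)) + 1) + 1) + (1 + 1))) hs.n (by omega)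
    (by simp [rest, hdead]) fun i hi s₁ hf hb ⟨h1, h2⟩ => ?_) hT ?_
  · set R := rest (s₁.a .ORD) i with hR
    have hne : R.Nonempty := by
      by_contra hne
      rw [Finset.not_nonempty_iff_eq_empty] at hne
      have : (Finset.univ : Finset (Fin n)).map Fin.valEmbedding ⊆ (Finset.range i).image (s₁.a .ORD) := by
        intro a ha
        obtain ⟨v, -, rfl⟩ := Finset.mem_map.1 ha
        by_contra hcon
        have : v ∈ R := by
          rw [hR]
          simp only [rest, Finset.mem_filter, Finset.mem_univ, true_and]
          intro j hj h
          exact hcon (Finset.mem_image.2 ⟨j, Finset.mem_range.2 hj, h⟩)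
        rw [hne] at this
        exact absurd this (Finset.notMem_empty _)
      have := (Finset.card_le_card this).trans Finset.card_image_le
      simp at this
      omega
    obtain ⟨v₀, hv₀, hsimp⟩ := D.exists_simplicial R hne
    have hv₀ : Simplicial D R v₀ := ⟨hv₀, hsimp⟩
    refine WP.seq' (WP.set 0 rfl (by omega) ?_)
    -- The variable `best` is meaningful only after a simplicial vertex has been met, so the
    -- invariant is an implication; the existence of `v₀` discharges it at the end.
    refine WP.seq (WP.loop n (fun j s' => (∃ v : Fin n, (v : ℕ) < j ∧ Simplicial D R v) →
      ∃ v : Fin n, s'.v .best = v ∧ Simplicial D R v) (8 * (n + 1) ^ 2 + (1 + 1))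
      ((hf.v .n rfl).trans hs.n) (by omega) (by simp) fun j hj s₂ hf' hb' h => ?_) ?_
    · refine WP.seq (wp_testSimplicial (D := D) hE (s := s₂.setV .v j) (k := k) (m := m) (p := p) ?_ ?_ R ?_ ⟨j, hj⟩ rfl) ?_
      · exact ⟨(hf'.v .n rfl).trans ((hf.v .n rfl).trans hs.n),
          (hf'.v .m rfl).trans ((hf.v .m rfl).trans hs.m), (hf'.v .k rfl).trans ((hf.v .k rfl).trans hs.k)⟩
      · have : (s₂.setV .v j).a .H = s.a .H := (hf'.a .H rfl).trans (hf.a .H rfl)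
        rwa [this]
      · have : (s₂.setV .v j).a .DEAD = s₁.a .DEAD := hf'.a .DEAD rfl
        rwa [this]
      · intro s₃ hf₃ h3
        refine WP.ite (fun hc => ?_) fun hc => WP.skip ?_
        · exact WP.set j (hf₃.v .v rfl) (by omega) fun _ => ⟨⟨j, hj⟩, rfl, h3.1 hc⟩
        · rintro ⟨v, hv, hv'⟩
          have hb₃ : s₃.v .best = s₂.v .best := hf₃.v .best rfl
          rw [hb₃]
          refine h ⟨v, ?_, hv'⟩
          rcases Nat.lt_succ_iff_lt_or_eq.1 hv with hv | hv
          · exact hv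
          · exact absurd (h3.2 (by rwa [← show v = ⟨j, hj⟩ from Fin.ext hv])) (not_not.2 hc)
    · intro s₂ hf₂ h
      obtain ⟨v, hv, hsv⟩ := h ⟨v₀, v₀.2, hv₀⟩
      have eO : s₂.a .ORD = s₁.a .ORD := hf₂.a .ORD rfl
      have eD : s₂.a .DEAD = s₁.a .DEAD := hf₂.a .DEAD rfl
      refine WP.seq' (WP.put i v (hf₂.v .i rfl) hv (by have := v.2; omega) ?_)
      refine WP.put v 1 hv rfl (by omega) ?_
      have hrest : ∀ j ≤ i, rest (Function.update (s₁.a .ORD) i v) j = rest (s₁.a .ORD) j := by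
        intro j hj
        simp only [rest]
        refine Finset.filter_congr fun u _ => forall₂_congr fun j' hj' => ?_
        rw [Function.update_of_ne (by omega)]
      have e1 : (((s₂.setA .ORD i v).setA .DEAD v 1).a .ORD) = Function.update (s₁.a .ORD) i v := by
        simp [eO]
      have e2 : (((s₂.setA .ORD i v).setA .DEAD v 1).a .DEAD) = Function.update (s₁.a .DEAD) v 1 := by
        simp [eD]
      simp only [e1, e2]
      refine ⟨fun j hj => ?_, fun u => ?_⟩
      · rw [hrest j (by omega)]
        rcases Nat.lt_succ_iff_lt_or_eq.1 hj with hj | rfl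
        · rw [Function.update_of_ne (by omega)]
          exact h1 j hj
        · exact ⟨v, by simp, hsv⟩
      · have : u ∈ rest (Function.update (s₁.a .ORD) i v) (i + 1) ↔ u ∈ R ∧ u ≠ v := by
          rw [hR, ← hrest i le_rfl]
          simp only [rest, Finset.mem_filter, Finset.mem_univ, true_and]
          constructor
          · intro h
            refine ⟨fun j hj => h j (by omega), fun huv => h i (by omega) (by simp [huv])⟩
          · rintro ⟨h, h'⟩ j hj
            rcases Nat.lt_succ_iff_lt_or_eq.1 hj with hj | rfl
            · exact h j hj
            · simpa [Fin.ext_iff, eq_comm] using h'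
        rw [this]
        by_cases huv : u = v
        · subst huv
          simp
        · have : (u : ℕ) ≠ v := fun h => huv (Fin.ext h)
          simp only [huv, ne_eq, not_false_eq_true, and_true, Function.update_of_ne this]
          exact h2 u
  · rintro s' - - ⟨h1, -⟩
    choose f hf hf' using fun j : Fin n => h1 j j.2
    have hlt : ∀ i j : Fin n, i < j → f i ≠ f j := fun i j hij h => by
      have h3 := (hf' j).1
      simp only [rest, Finset.mem_filter, Finset.mem_univ, true_and] at h3
      exact h3 i hij (by rw [hf, h])
    have hinj : Function.Injective f := fun i j h => by
      rcases lt_trichotomy i j with hij | hij | hij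
      exacts [absurd h (hlt i j hij), hij, absurd h.symm (hlt j i hij)]
    refine ⟨Equiv.ofBijective f (Finite.injective_iff_bijective.1 hinj), hf, fun i j j' hij hij' h3 h4 => ?_⟩
    have hmem : ∀ j, i < j → f j ∈ rest (s'.a .ORD) i := fun j hij => by
      simp only [rest, Finset.mem_filter, Finset.mem_univ, true_and]
      intro i' hi' h
      have := hf ⟨i', hi'.trans i.2⟩
      simp only [h] at this
      exact hlt ⟨i', hi'.trans i.2⟩ j (lt_trans (Fin.mk_lt_of_lt_val hi') hij) (Fin.ext this.symm)
    exact (hf' i).2 _ (hmem j hij) _ (hmem j' hij') h3 h4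

/-- The arrays `HO` and `GO` hold the adjacencies in the elimination order `ord`. -/
structure Later (D : TreeDecomposition G m) (ord : Fin n ≃ Fin n) (s : St) : Prop where
  ho : ∀ i j : Fin n, (i < j ∧ D.Share (ord i) (ord j) → s.a .HO (i * n + j) = 1) ∧
    (¬ (i < j ∧ D.Share (ord i) (ord j)) → s.a .HO (i * n + j) = 0)
  go : ∀ i j : Fin n, (i < j ∧ G.Adj (ord i) (ord j) → s.a .GO (i * n + j) = 1) ∧
    (¬ (i < j ∧ G.Adj (ord i) (ord j)) → s.a .GO (i * n + j) = 0)

theorem wp_laterMatrices (hE : Room E n m k p) (hI : Input E G D S k) {s : St}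
    (hs : Header n m k s) (hH : Completed D (s.a .H)) {ord : Fin n ≃ Fin n}
    (hord : ∀ i : Fin n, s.a .ORD i = ord i) :
    WP E laterMatrices (6 * (n + 1) ^ 2) (Later D ord) s := by
  have hsum := hE.sum
  have hbase := hI.base
  rw [TreeDecomposition.bagOffset] at hbase
  set φ : ℕ → ℕ → ℕ := fun i j => (if i < j then 1 else 0) * s.a .H (s.a .ORD i * n + s.a .ORD j)
  set γ : ℕ → ℕ → ℕ := fun i j => (if i < j then 1 else 0) * E.I (3 + s.a .ORD i * n + s.a .ORD j)
  have hφ : ∀ i < n, ∀ j < n, φ i j ≤ 1 := fun i hi j hj => by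
    have h1 := hord ⟨i, hi⟩
    have h2 := hord ⟨j, hj⟩
    simp only at h1 h2
    simp only [φ, h1, h2]
    by_cases h : D.Share (ord ⟨i, hi⟩) (ord ⟨j, hj⟩)
    · rw [(hH _ _).1 h]; split_ifs <;> simp
    · rw [(hH _ _).2 h]; simp
  have hγ : ∀ i < n, ∀ j < n, γ i j ≤ 1 := fun i hi j hj => by
    have h1 := hord ⟨i, hi⟩
    have h2 := hord ⟨j, hj⟩
    simp only at h1 h2
    simp only [γ, h1, h2]
    by_cases h : G.Adj (ord ⟨i, hi⟩) (ord ⟨j, hj⟩)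
    · rw [(hI.adj _ _).1 h]; split_ifs <;> simp
    · rw [(hI.adj _ _).2 h]; simp
  -- The entries written so far form an initial segment in row-major order, so the same inequality
  -- between addresses serves as the invariant of both loops.
  refine WP.mono (T := n * ((n * ((1 + (1 + 1)) + 1) + 1) + 1) + 1) (WP.loop n (fun i s' => ∀ i' j', j' < n → i' * n + j' < i * n →
    s'.a .HO (i' * n + j') = φ i' j' ∧ s'.a .GO (i' * n + j') = γ i' j') _ hs.n (by omega)
    (by simp) fun i hi s₁ hf hb h => ?_) (by nlinarith) ?_
  · refine WP.mono (WP.loop n (fun j s' => ∀ i' j', j' < n → i' * n + j' < i * n + j →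
      s'.a .HO (i' * n + j') = φ i' j' ∧ s'.a .GO (i' * n + j') = γ i' j') (1 + (1 + 1))
      ((hf.v .n rfl).trans hs.n) (by omega) h fun j hj s₂ hf' hb' h' => ?_) le_rfl
      fun s₂ _ _ h' => by rwa [add_mul, one_mul]
    have e1 : s₂.v .i = i := hf'.v .i rfl
    have e3 : s₂.v .n = n := (hf'.v .n rfl).trans ((hf.v .n rfl).trans hs.n)
    have e4 : s₂.a .H = s.a .H := (hf'.a .H rfl).trans (hf.a .H rfl)
    have e5 : s₂.a .ORD = s.a .ORD := (hf'.a .ORD rfl).trans (hf.a .ORD rfl)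
    have hφ' := hφ i hi j hj
    have hγ' := hγ i hi j hj
    refine WP.seq' (WP.put (i * n + j) (φ i j) (by simp [e1, e3]) (by simp [φ, e1, e3, e4, e5])
      (by omega) ?_)
    refine WP.seq' (WP.inp (3 + s.a .ORD i * n + s.a .ORD j) (by simp [e1, e3, e5]) ?_ ?_)
    · have h1 := hord ⟨i, hi⟩
      have h2 := hord ⟨j, hj⟩
      simp only at h1 h2
      rw [h1, h2]
      have := Nat.mul_add_lt_mul (ord ⟨i, hi⟩).2 (ord ⟨j, hj⟩).2
      omega
    · refine WP.put (i * n + j) (γ i j) (by simp [e1, e3]) (by simp [γ, e1]) (by omega) ?_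
      intro i' j' hj' hlt
      simp only [setV_a, setA_a, reduceCtorEq, if_true, if_false, Function.update_apply]
      by_cases heq : i' * n + j' = i * n + j
      · obtain ⟨rfl, rfl⟩ := (Nat.mul_add_inj hj' hj).1 heq
        simp
      · simp only [heq, if_false]
        exact h' i' j' hj' (by omega)
  · intro s' _ _ h
    have h' : ∀ i j : Fin n, s'.a .HO (i * n + j) = φ i j ∧ s'.a .GO (i * n + j) = γ i j := fun i j =>
      h i j j.2 (Nat.mul_add_lt_mul i.2 j.2)
    refine ⟨fun i j => ?_, fun i j => ?_⟩
    · rw [(h' i j).1]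
      simp only [φ, hord, Fin.lt_def]
      refine ⟨fun h => by rw [if_pos h.1, (hH _ _).1 h.2], fun h => ?_⟩
      by_cases hs : D.Share (ord i) (ord j)
      · rw [if_neg fun h' => h ⟨h', hs⟩, zero_mul]
      · rw [(hH _ _).2 hs, mul_zero]
    · rw [(h' i j).2]
      simp only [γ, hord, Fin.lt_def]
      refine ⟨fun h => by rw [if_pos h.1, (hI.adj _ _).1 h.2], fun h => ?_⟩
      by_cases hs : G.Adj (ord i) (ord j)
      · rw [if_neg fun h' => h ⟨h', hs⟩, zero_mul]
      · rw [(hI.adj _ _).2 hs, mul_zero]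

end Loop

/-! ### The elimination forest and the slots of the tables -/

namespace Loop

variable {E : Env} {n m k p : ℕ} {G : SimpleGraph (Fin n)} {D : TreeDecomposition G m}
    {S : Finset (Fin n)}

theorem wp_testSlot (hE : Room E n m k p) {s : St} (hs : Header n m k s) {i d : ℕ}
    (hi : s.v .i = i) (hd : s.v .d = d) :
    WP E testSlot (3 * n + 2) (fun s' => s'.v .flag ≠ 0 ↔
      ∀ j < n, s.a .HO (i * n + j) ≠ 0 → s.a .SLOT j ≠ d) s := by
  have hsum := hE.sum
  refine WP.le (T := 1 + (n * ((1 + 1) + 1) + 1)) ?_ (by omega)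
  refine WP.seq' (WP.set 1 rfl (by omega) ?_)
  refine WP.mono (WP.loop n (fun j s' => s'.v .flag = 0 ↔
      ∃ j' < j, s.a .HO (i * n + j') ≠ 0 ∧ s.a .SLOT j' = d) (1 + 1) hs.n (by omega)
      (by simp) fun j hj s₁ hf hb h => ?_) le_rfl fun s' _ _ h => ?_
  · have e1 : s₁.v .i = i := (hf.v .i rfl).trans hi
    have e2 : s₁.v .d = d := (hf.v .d rfl).trans hd
    have e3 : s₁.v .n = n := (hf.v .n rfl).trans hs.n
    have e4 : s₁.a .HO = s.a .HO := hf.a .HO rfl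
    have e5 : s₁.a .SLOT = s.a .SLOT := hf.a .SLOT rfl
    refine WP.ite (fun hc => WP.set 0 rfl (by omega) ?_) fun hc => WP.skip ?_
    · have : s.a .HO (i * n + j) ≠ 0 ∧ s.a .SLOT j = d := by
        simpa [e1, e2, e3, e4, e5, and_comm] using hc
      simp only [setV_v, if_true, true_iff]
      exact ⟨j, by omega, this⟩
    · have : ¬ (s.a .HO (i * n + j) ≠ 0 ∧ s.a .SLOT j = d) := by
        rw [and_comm]
        simpa [e1, e2, e3, e4, e5] using hc
      simp only [setV_v, reduceCtorEq, if_false, h, Nat.exists_lt_succ_right, this, or_false]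
  · rw [Ne, h]
    push Not
    rfl

/-- The tables of a vertex are indexed by the states of its later neighbours, each of which has
its own slot. -/
structure Slots (D : TreeDecomposition G m) (ord : Fin n ≃ Fin n) (Q : ℕ) (s : St) : Prop where
  slot_lt : ∀ i < n, s.a .SLOT i < Q
  slot_ne : ∀ i j : Fin n, i < j → D.Share (ord i) (ord j) → s.a .SLOT i ≠ s.a .SLOT j
  lt_par : ∀ i < n, i < s.a .PAR i
  par_le_n : ∀ i < n, s.a .PAR i ≤ n
  par_rel : ∀ i < n, ∀ h : s.a .PAR i < n, ∀ i' : Fin n, i' = i →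
    D.Share (ord i') (ord ⟨s.a .PAR i, h⟩)
  par_le : ∀ i j : Fin n, i < j → D.Share (ord i) (ord j) → s.a .PAR i ≤ j

/-- Greedy colouring from the last vertex backwards. A vertex and its later neighbours form a clique
in the sharing graph, so there are at most `p` of the latter and some slot in `{0, …, p}` is free.
-/
theorem wp_slots (hE : Room E n m k p) (hp : D.width ≤ p) {s : St}
    (hs : Header n m k s) (hQ : s.v .Q = 0) {ord : Fin n ≃ Fin n} (hl : Later D ord s)
    (hord : ∀ i j j', i < j → i < j' → D.Share (ord i) (ord j) →
        D.Share (ord i) (ord j') → D.Share (ord j) (ord j')) :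
    WP E slots (20 * (n + 1) ^ 3) (fun s' => ∃ Q ≤ p + 1, s'.v .Q = Q ∧ Slots D ord Q s') s := by
  classical
  have hsum := hE.sum
  have hpow := hE.pow
  have hpB : p + 2 < E.B := (p + 2).lt_two_pow_self.trans_le
    ((Nat.pow_le_pow_left (by omega) _).trans hpow.le)
  have hho : ∀ i j : Fin n, s.a .HO (i * n + j) ≠ 0 ↔ i < j ∧ D.Share (ord i) (ord j) :=
    fun i j => by
      by_cases h : i < j ∧ D.Share (ord i) (ord j)
      · rw [(hl.ho i j).1 h]; simp [h]
      · rw [(hl.ho i j).2 h]; simp [h]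
  set nb : Fin n → Finset (Fin n) := fun i => Finset.univ.filter fun j => i < j ∧ D.Share (ord i) (ord j)
    with hnb
  have hnb_mem : ∀ i j, j ∈ nb i ↔ i < j ∧ D.Share (ord i) (ord j) := fun i j => by simp [hnb]
  have hnb_card : ∀ i, (nb i).card ≤ p ∧ (nb i).card < n := fun i => by
    have h1 : i ∉ nb i := fun h => lt_irrefl _ ((hnb_mem i i).1 h).1
    have h2 := D.card_clique_le ((insert i (nb i)).map ord.toEmbedding) (by
      simp only [Finset.mem_map, Finset.mem_insert, hnb_mem, Equiv.coe_toEmbedding]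
      rintro _ ⟨u, hu, rfl⟩ _ ⟨v, hv, rfl⟩
      rcases hu with rfl | ⟨h1, h2⟩
      · rcases hv with rfl | ⟨h3, h4⟩
        exacts [D.share_refl _, h4]
      · rcases hv with rfl | ⟨h3, h4⟩
        exacts [h2.symm, hord i u v h1 h3 h2 h4])
    have h3 := (Finset.card_le_univ (insert i (nb i))).trans_eq (Fintype.card_fin n)
    rw [Finset.card_map, Finset.card_insert_of_notMem h1] at h2
    rw [Finset.card_insert_of_notMem h1] at h3
    omega
  set body : ℕ := 1 + (1 + ((n * ((1 + ((3 * n + 2) + ((1 + 1) + (1 + 1)))) + 1) + 1) + (1 + (1 + 1)))) with hbody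
  refine WP.mono (T := n * (body + 1) + 1) (WP.loop n (fun r s' => s'.v .Q ≤ p + 1 ∧
    ∀ i : Fin n, n ≤ i + r → s'.a .SLOT i < s'.v .Q ∧
      (∀ j ∈ nb i, s'.a .SLOT i ≠ s'.a .SLOT j) ∧ s'.a .PAR i ≤ n ∧
      (∀ h : s'.a .PAR i < n, ⟨s'.a .PAR i, h⟩ ∈ nb i) ∧ ∀ j ∈ nb i, s'.a .PAR i ≤ j) body
    hs.n (by omega) ⟨by rw [hQ]; omega, fun i hi => absurd hi (by omega)⟩
    fun r hr s₁ hf hb ⟨h1, h2⟩ => ?_) (by rw [hbody]; nlinarith) ?_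
  · have e0 : s₁.v .n = n := (hf.v .n rfl).trans hs.n
    have e0' : s₁.a .HO = s.a .HO := hf.a .HO rfl
    set i : Fin n := ⟨n - 1 - r, by omega⟩ with hi
    have hi' : (i : ℕ) = n - 1 - r := rfl
    set free : ℕ → Prop := fun d => ∀ j ∈ nb i, s₁.a .SLOT j ≠ d with hfree
    refine WP.seq' (WP.set i (by simp [e0, hi']) (by omega) ?_)
    refine WP.seq' (WP.put i n rfl e0 (by omega) ?_)
    -- The candidates `d` descend from `n - 1`, so the last success is the least one, both for the
    -- free slot and for the first later neighbour. Until a free slot is met `sl` still has an old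
    -- value, whence the implication.
    refine WP.seq (WP.loop n (fun t s' => s'.v .i = i ∧ (∀ j : ℕ, j ≠ i → s'.a .PAR j = s₁.a .PAR j) ∧
      ((∃ d < n, n ≤ d + t ∧ free d) → free (s'.v .sl) ∧
        ∀ d < n, n ≤ d + t → free d → s'.v .sl ≤ d) ∧ s'.a .PAR i ≤ n ∧
      (∀ h : s'.a .PAR i < n, ⟨s'.a .PAR i, h⟩ ∈ nb i) ∧
      ∀ j ∈ nb i, n ≤ j + t → s'.a .PAR i ≤ j)
      (1 + ((3 * n + 2) + ((1 + 1) + (1 + 1)))) e0 (by omega)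
      ⟨rfl, fun j hj => by simp [hj], ?_, by simp, ?_, ?_⟩ fun t ht s₂ hf' hb' ⟨g0, g1, g2, g3, g4, g5⟩ => ?_) ?_
    · rintro ⟨d, hd, hd', -⟩; omega
    · intro h; exact absurd h (by simp)
    · intro j _ hj; have := j.2; omega
    · set d : Fin n := ⟨n - 1 - t, by omega⟩ with hd
      have hd' : (d : ℕ) = n - 1 - t := rfl
      have f0 : s₂.v .n = n := (hf'.v .n rfl).trans e0
      have f1 : s₂.a .HO = s.a .HO := (hf'.a .HO rfl).trans e0'
      have f2 : s₂.a .SLOT = s₁.a .SLOT := hf'.a .SLOT rfl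
      refine WP.seq' (WP.set d (by simp [f0, hd']) (by omega) ?_)
      refine WP.seq (wp_testSlot hE (s := (s₂.setV .t t).setV .d d) (i := i) (d := d) (k := k) (m := m) ⟨f0, (hf'.v .m rfl).trans ((hf.v .m rfl).trans hs.m),
        (hf'.v .k rfl).trans ((hf.v .k rfl).trans hs.k)⟩ g0 rfl) ?_
      intro s₃ hf₃ h3
      have h3 : s₃.v .flag ≠ 0 ↔ free d := by
        rw [h3]
        simp only [setV_a, f1, f2]
        constructor
        · intro h j hj
          exact h j j.2 ((hho i j).2 ((hnb_mem i j).1 hj))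
        · intro h j hj h4
          exact h ⟨j, hj⟩ ((hnb_mem i _).2 ((hho i ⟨j, hj⟩).1 h4))
      have k1 : s₃.v .i = i := (hf₃.v .i rfl).trans g0
      have k2 : s₃.v .d = d := hf₃.v .d rfl
      have k3 : s₃.v .n = n := (hf₃.v .n rfl).trans f0
      have k4 : s₃.a .HO = s.a .HO := (hf₃.a .HO rfl).trans f1
      have k5 : s₃.a .PAR = s₂.a .PAR := hf₃.a .PAR rfl
      have k6 : s₃.v .sl = s₂.v .sl := hf₃.v .sl rfl
      refine WP.seq (R := fun s' => (∃ d' < n, n ≤ d' + (t + 1) ∧ free d') → free (s'.v .sl) ∧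
        ∀ d' < n, n ≤ d' + (t + 1) → free d' → s'.v .sl ≤ d')
        (WP.ite (fun hc => WP.set d k2 (by omega) ?_) fun hc => WP.skip ?_) ?_
      · intro _
        refine ⟨h3.1 hc, fun d' _ h5 _ => ?_⟩
        change (d : ℕ) ≤ d'
        omega
      · have hc' : ¬ free d := fun h => h3.2 h hc
        have hd'' : ∀ d' < n, n ≤ d' + (t + 1) → free d' → n ≤ d' + t := fun d' h5 h6 h7 => by
          by_contra h8
          have : d' = d := by omega
          exact hc' (this ▸ h7)
        rintro ⟨d', h5, h6, h7⟩
        rw [k6]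
        have := g2 ⟨d', h5, hd'' d' h5 h6 h7, h7⟩
        exact ⟨this.1, fun d' h5 h6 h7 => this.2 d' h5 (hd'' d' h5 h6 h7) h7⟩
      · intro s₄ hf₄ h4
        have l1 : s₄.v .i = i := (hf₄.v .i rfl).trans k1
        have l2 : s₄.v .d = d := (hf₄.v .d rfl).trans k2
        have l3 : s₄.v .n = n := (hf₄.v .n rfl).trans k3
        have l4 : s₄.a .HO = s.a .HO := (hf₄.a .HO rfl).trans k4
        have l5 : s₄.a .PAR = s₂.a .PAR := (hf₄.a .PAR rfl).trans k5
        refine WP.ite (fun hc => WP.put i d l1 l2 (by omega) ⟨l1, fun j hj => ?_, h4, ?_, fun h => ?_, fun j _ hj => ?_⟩)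
          fun hc => WP.skip ⟨l1, fun j hj => ?_, h4, ?_, ?_, fun j hj hj' => ?_⟩
        · simp only [setA_a, if_true, Function.update_of_ne hj]
          rw [l5]; exact g1 j hj
        · simp
        · simp only [setA_a, if_true, Function.update_self]
          have : s.a .HO (i * n + d) ≠ 0 := by simpa [l1, l2, l3, l4] using hc
          exact (hnb_mem _ _).2 ((hho _ _).1 this)
        · simp; omega
        · rw [l5]; exact g1 j hj
        · rw [l5]; exact g3
        · rw [l5]; exact g4
        · rw [l5]
          refine g5 j hj ?_
          have : s.a .HO (i * n + d) = 0 := by simpa [l1, l2, l3, l4] using hc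
          have : ¬ d ∈ nb i := fun h => ((hho _ _).2 ((hnb_mem _ _).1 h)) this
          have : j ≠ d := fun h => this (h ▸ hj)
          have : (j : ℕ) ≠ d := fun h => this (Fin.ext h)
          omega
    · rintro s₂ hf₂ ⟨g0, g1, g2, g3, g4, g5⟩
      have f2 : s₂.a .SLOT = s₁.a .SLOT := hf₂.a .SLOT rfl
      have f3 : s₂.v .Q = s₁.v .Q := hf₂.v .Q rfl
      -- Pigeonhole: occupied slots belong to different later neighbours. This gives both the
      -- existence of a free slot below `n` and the bound `p` on the least one.
      have hused : ∀ N, (∀ d < N, ¬ free d) → N ≤ (nb i).card := fun N hN => by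
        have : Finset.range N ⊆ (nb i).image fun j : Fin n => s₁.a .SLOT j := fun d hd => by
          have := hN d (Finset.mem_range.1 hd)
          simp only [hfree, not_forall, not_not] at this
          obtain ⟨j, hj, h⟩ := this
          exact Finset.mem_image.2 ⟨j, hj, h⟩
        simpa using (Finset.card_le_card this).trans Finset.card_image_le
      have hex : ∃ d < n, n ≤ d + n ∧ free d := by
        by_contra hcon
        have := hused n fun d hd h => hcon ⟨d, hd, by omega, h⟩
        have := (hnb_card i).2
        omega
      obtain ⟨g6, g7⟩ := g2 hex
      have hsl : s₂.v .sl ≤ p := by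
        refine (hused _ fun d hd h => ?_).trans (hnb_card i).1
        obtain ⟨d₀, h8, -, h9⟩ := hex
        have := g7 d₀ h8 (by omega) h9
        have := g7 d (by omega) (by omega) h
        omega
      refine WP.seq' (WP.put i (s₂.v .sl) g0 rfl (by omega) ?_)
      have hmain : ∀ j : Fin n, n ≤ j + (r + 1) →
          (Function.update (s₂.a .SLOT) i (s₂.v .sl)) j < max (s₁.v .Q) (s₂.v .sl + 1) ∧
          (∀ j' ∈ nb j, (Function.update (s₂.a .SLOT) i (s₂.v .sl)) j ≠ (Function.update (s₂.a .SLOT) i (s₂.v .sl)) j') ∧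
          s₂.a .PAR j ≤ n ∧ (∀ h : s₂.a .PAR j < n, ⟨s₂.a .PAR j, h⟩ ∈ nb j) ∧ ∀ j' ∈ nb j, s₂.a .PAR j ≤ j' := by
        intro j hj
        by_cases hji : j = i
        · rw [hji]
          refine ⟨by simp, fun j' hj' => ?_, g3, g4, fun j' hj' => g5 j' hj' (by omega)⟩
          have : (j' : ℕ) ≠ i := fun h => ((hnb_mem i j').1 hj').1.ne' (Fin.ext h)
          rw [Function.update_self, Function.update_of_ne this, f2]
          exact (g6 j' hj').symm
        · have hji' : (j : ℕ) ≠ i := fun h => hji (Fin.ext h)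
          obtain ⟨h3, h4, h5, h6, h7⟩ := h2 j (by omega)
          rw [Function.update_of_ne hji', f2]
          refine ⟨lt_max_of_lt_left h3, fun j' hj' => ?_, ?_, ?_, ?_⟩
          · have : (j' : ℕ) ≠ i := by
              have := Fin.lt_def.1 ((hnb_mem j j').1 hj').1
              omega
            rw [Function.update_of_ne this]
            exact h4 j' hj'
          all_goals simp only [g1 j hji']
          exacts [h5, h6, h7]
      refine WP.ite (fun hc => WP.skip ?_) fun hc => WP.set (s₂.v .sl + 1) rfl (by omega) ?_
      · have hc' : s₂.v .sl < s₁.v .Q := by simpa [f3] using hc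
        refine ⟨by simpa [f3] using h1, ?_⟩
        have : max (s₁.v .Q) (s₂.v .sl + 1) = s₁.v .Q := max_eq_left hc'
        simpa [f3, this] using hmain
      · have hc' : s₁.v .Q ≤ s₂.v .sl := by simpa [f3] using hc
        refine ⟨by simpa using hsl, ?_⟩
        have : max (s₁.v .Q) (s₂.v .sl + 1) = s₂.v .sl + 1 := max_eq_right (by omega)
        simpa [this] using hmain
  · rintro s' - - ⟨h1, h2⟩
    have h3 : ∀ i : Fin n, _ := fun i => h2 i (by omega)
    refine ⟨_, h1, rfl, fun i hi => (h3 ⟨i, hi⟩).1, fun i j hij h => (h3 i).2.1 j ((hnb_mem _ _).2 ⟨hij, h⟩),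
      fun i hi => ?_, fun i hi => (h3 ⟨i, hi⟩).2.2.1, ?_,
      fun i j hij h => (h3 i).2.2.2.2 j ((hnb_mem _ _).2 ⟨hij, h⟩)⟩
    · by_contra hcon
      have := (h3 ⟨i, hi⟩).2.2.2.1 (by simp only; omega)
      have := Fin.lt_def.1 ((hnb_mem _ _).1 this).1
      simp only at this
      omega
    · rintro i hi h i' rfl
      exact ((hnb_mem _ _).1 ((h3 i').2.2.2.1 h)).2

theorem wp_powers (hE : Room E n m k p) {s : St} {Q : ℕ} (hQ : s.v .Q = Q) (hQp : Q ≤ p + 1) :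
    WP E powers (2 * p + 5) (fun s' => (∀ t ≤ Q, s'.a .PW t = 4 ^ t) ∧ s'.v .TS = 4 ^ Q) s := by
  have hpow := hE.pow
  have hle : ∀ t ≤ Q, 4 ^ t < E.B := fun t ht =>
    (Nat.pow_le_pow_right (by omega) (show t ≤ p + 2 by omega)).trans_lt hpow
  have hQB := Nat.lt_pow_self (n := Q) (show 1 < 4 by omega)
  have hQB' := hle Q le_rfl
  refine WP.le (T := 1 + ((Q * (1 + 1) + 1) + 1)) ?_ (by omega)
  refine WP.seq' (WP.put 0 1 rfl rfl (by omega) ?_)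
  refine WP.seq (WP.loop Q (fun t s' => ∀ t' ≤ t, s'.a .PW t' = 4 ^ t') 1 hQ (by omega) ?_
    fun t ht s' hf hb h => ?_) ?_
  · intro t ht
    obtain rfl : t = 0 := by omega
    simp
  · refine WP.put (t + 1) (4 ^ (t + 1)) (by simp) ?_ (hle _ ht) fun t' ht' => ?_
    · simp [h t le_rfl, pow_succ']
    · simp only [setA_a, if_true, Function.update_apply, setV_a]
      split_ifs with h'
      · rw [h']
      · exact h t' (by omega)
  · intro s' hf h
    have : s'.v .Q = Q := (hf.v .Q rfl).trans hQ
    exact WP.set (4 ^ Q) (by simp [this, h]) (hle Q le_rfl) ⟨h, rfl⟩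

end Loop

/-! ### Arithmetic in the field -/

namespace ShiftRegister

variable {K : Type} [Field K] [Fintype K] {fs : ℕ} (F : Repr K fs)

theorem Repr.val_inj {a b : ℕ} (ha : a < fs) (hb : b < fs) : F.val a = F.val b ↔ a = b :=
  ⟨fun h => F.val_bij.injOn ha hb h, fun h => h ▸ rfl⟩

theorem Repr.one_lt (F : Repr K fs) : 1 < fs := F.card ▸ Fintype.one_lt_card

theorem Repr.g_ne_zero : F.g ≠ 0 := fun h => by
  have h1 := F.orderOf_g
  rw [h, orderOf_zero] at h1
  have := F.one_lt
  omega

theorem Repr.pow_mod (i : ℕ) : F.g ^ (i % (fs - 1)) = F.g ^ i := by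
  rw [← F.orderOf_g, pow_mod_orderOf]

theorem Repr.exists_pow {x : K} (hx : x ≠ 0) : ∃ j < fs - 1, F.g ^ j = x := by
  classical
  have h1 : ((Finset.range (fs - 1)).image (F.g ^ ·)) = Finset.univ.erase 0 := by
    refine Finset.eq_of_subset_of_card_le (fun y hy => ?_) ?_
    · obtain ⟨j, -, rfl⟩ := Finset.mem_image.1 hy
      exact Finset.mem_erase.2 ⟨pow_ne_zero _ F.g_ne_zero, Finset.mem_univ _⟩
    · rw [Finset.card_erase_of_mem (Finset.mem_univ _), Finset.card_univ, F.card,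
        Finset.card_image_of_injOn, Finset.card_range]
      intro i hi j hj h
      refine pow_injOn_Iio_orderOf ?_ ?_ h <;> rw [F.orderOf_g]
      exacts [Finset.mem_range.1 hi, Finset.mem_range.1 hj]
  have : x ∈ (Finset.range (fs - 1)).image (F.g ^ ·) :=
    h1 ▸ Finset.mem_erase.2 ⟨hx, Finset.mem_univ _⟩
  simpa using this

end ShiftRegister

namespace Loop

open ShiftRegister

variable {E : Env} {K : Type} [Field K] [Fintype K]

theorem wp_shift {q a f : ℕ} {e : Expr} {s : St} (hq : 2 * 2 ^ q < E.B) (hs : s.v .s = a)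
    (ha : a < 2 ^ q) (hfs : s.v .fs = 2 ^ q) (he : ∀ c, e.eval (s.setV .s c) = f)
    (hf : 2 ^ q ≤ f) (hf' : f < 2 ^ (q + 1)) :
    WP E (shift e) 3 (fun s' => s'.v .s = step (2 ^ q) f a) s := by
  have hlt := step_lt hf hf' ha
  refine WP.le (T := 1 + (1 + 1)) ?_ (by omega)
  refine WP.seq' (WP.set (2 * a) (by simp [hs]) (by omega) ?_)
  refine WP.ite (fun hc => WP.skip ?_) fun hc => WP.set (step (2 ^ q) f a) ?_ (by omega) (by simp)
  · have : 2 * a < 2 ^ q := by simpa [hfs] using hc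
    simp [step, this]
  · have : ¬ 2 * a < 2 ^ q := by simpa [hfs] using hc
    simp [step, this, he]

theorem wp_testPeriod {q c : ℕ} {s : St} (hq : 4 * 2 ^ q < E.B) (hq1 : 1 ≤ q) (hfs : s.v .fs = 2 ^ q)
    (hN : s.v .N = 2 ^ q - 1) (hc : s.v .cand = c) (hc' : c < 2 ^ q) :
    WP E testPeriod (6 * 2 ^ q + 3) (fun s' => s'.v .flag ≠ 0 ↔ FullPeriod (2 ^ q) (2 ^ q + c)) s := by
  have hpos : 0 < 2 ^ q := by positivity
  have hf' : 2 ^ q + c < 2 ^ (q + 1) := by rw [pow_succ]; omega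
  refine WP.le (T := 1 + (1 + ((2 ^ q - 1) * ((3 + (1 + 1)) + 1) + 1))) ?_ (by omega)
  refine WP.seq' (WP.set 1 rfl (by omega) ?_)
  refine WP.seq' (WP.set 1 rfl (by omega) ?_)
  refine WP.mono (WP.loop (2 ^ q - 1) (fun i s' => s'.v .s = state (2 ^ q) (2 ^ q + c) i ∧
    (s'.v .flag ≠ 0 ↔ ∀ j < i, (state (2 ^ q) (2 ^ q + c) (j + 1) = 1 ↔ j + 1 = 2 ^ q - 1)))
    (3 + (1 + 1)) hN (by omega) (by simp [state]) fun i hi s₁ hf hb ⟨h1, h2⟩ => ?_) le_rfl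
    fun s' _ _ h => h.2
  have e1 : s₁.v .fs = 2 ^ q := (hf.v .fs rfl).trans hfs
  have e2 : s₁.v .cand = c := (hf.v .cand rfl).trans hc
  have e3 : s₁.v .N = 2 ^ q - 1 := (hf.v .N rfl).trans hN
  refine WP.seq (wp_shift (s := s₁.setV .i i) (q := q) (f := 2 ^ q + c) (by omega) h1 (state_lt hq1 (by omega) hf' i) e1 (by simp [e1, e2])
    (by omega) hf') fun s₂ hf₂ h3 => ?_
  have e4 : s₂.v .i = i := hf₂.v .i rfl
  have e5 : s₂.v .N = 2 ^ q - 1 := (hf₂.v .N rfl).trans e3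
  have e6 : s₂.v .flag = s₁.v .flag := hf₂.v .flag rfl
  have h3 : s₂.v .s = state (2 ^ q) (2 ^ q + c) (i + 1) := h3
  have hcond (a b : Prop) [Decidable a] [Decidable b] : ((if (if a then 1 else 0) = (if b then 1 else 0) then 1 else 0) : ℕ) ≠ 0 ↔ (a ↔ b) := by
    by_cases ha : a <;> by_cases hb : b <;> simp [ha, hb]
  have hstep (Q : ℕ → Prop) : (∀ j < i + 1, Q j) ↔ (∀ j < i, Q j) ∧ Q i := Nat.forall_lt_succ_right
  have hev : Expr.eval s₂ (.eq (.eq (.var .s) 1) (.eq (.var .i + 1) (.var .N))) ≠ 0 ↔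
      (state (2 ^ q) (2 ^ q + c) (i + 1) = 1 ↔ i + 1 = 2 ^ q - 1) := by
    simp only [eval_eq, eval_var, eval_add, h3, e4, e5]
    exact hcond _ _
  refine WP.ite (fun hc => WP.skip ⟨h3, ?_⟩) fun hc => WP.set 0 rfl (by omega) ⟨h3, ?_⟩
  · rw [e6, h2, hstep, and_iff_left (hev.1 hc)]
  · rw [hstep, setV_v, if_pos rfl]
    simp only [ne_eq, not_true_eq_false, false_iff, not_and]
    exact fun _ h => hev.2 h hc

/-- Exhaustive search tries `2 ^ q` feedbacks for `2 ^ q - 1` steps each. This quadratic cost in a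
field of size `O(n ^ 3)` fits in the `n ^ 6` term. Any success may be kept, and `exists_fullPeriod`
guarantees one. -/
theorem wp_findPolynomial {q : ℕ} {s : St} (hq : 4 * 2 ^ q < E.B) (hq1 : 1 ≤ q)
    (hfs : s.v .fs = 2 ^ q) (hN : s.v .N = 2 ^ q - 1) :
    WP E findPolynomial (2 ^ q * (6 * 2 ^ q + 6) + 1) (fun s' => ∃ f, s'.v .pol = f ∧ 2 ^ q ≤ f ∧
      f < 2 ^ (q + 1) ∧ FullPeriod (2 ^ q) f) s := by
  refine WP.mono (WP.loop (2 ^ q) (fun i s' => (∃ c < i, FullPeriod (2 ^ q) (2 ^ q + c)) →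
    ∃ f, s'.v .pol = f ∧ 2 ^ q ≤ f ∧ f < 2 ^ (q + 1) ∧ FullPeriod (2 ^ q) f)
    ((6 * 2 ^ q + 3) + (1 + 1)) hfs (by omega) (by simp) fun i hi s₁ hf hb h => ?_) le_rfl
    fun s' _ _ h => h (exists_fullPeriod hq1)
  have e1 : s₁.v .fs = 2 ^ q := (hf.v .fs rfl).trans hfs
  have e3 : s₁.v .N = 2 ^ q - 1 := (hf.v .N rfl).trans hN
  refine WP.seq (wp_testPeriod (s := s₁.setV .cand i) hq hq1 e1 e3 rfl hi) fun s₂ hf₂ h2 => ?_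
  have e4 : s₂.v .cand = i := hf₂.v .cand rfl
  have e5 : s₂.v .fs = 2 ^ q := (hf₂.v .fs rfl).trans e1
  have e6 : s₂.v .pol = s₁.v .pol := hf₂.v .pol rfl
  refine WP.ite (fun hc => WP.set (2 ^ q + i) (by simp [e4, e5]) (by omega) fun _ => ?_) fun hc => WP.skip ?_
  · exact ⟨2 ^ q + i, rfl, by omega, by rw [pow_succ]; omega, h2.1 hc⟩
  · rintro ⟨c, hc', hc''⟩
    rw [e6]
    refine h ⟨c, ?_, hc''⟩
    rcases Nat.lt_succ_iff_lt_or_eq.1 hc' with h' | rfl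
    exacts [h', absurd (h2.2 hc'') (not_not.2 hc)]

/-- The tables of powers and discrete logarithms represent the field. -/
structure FieldTables {fs : ℕ} (F : Repr K fs) (s : St) : Prop where
  N : s.v .N = fs - 1
  exp : ∀ i < 2 * (fs - 1), s.a .EXP i = F.pow i
  exp_zero : ∀ i, 2 * (fs - 1) ≤ i → s.a .EXP i = 0
  log_zero : s.a .LOG 0 = 2 * (fs - 1)
  log : ∀ a < fs, a ≠ 0 → s.a .LOG a < fs - 1 ∧ F.g ^ (s.a .LOG a) = F.val a

theorem FieldTables.of_frame {fs : ℕ} {F : Repr K fs} {s s' : St} {P : Stmt}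
    (h : FieldTables F s) (hf : Frame P s s') (hN : P.writesV .N = false)
    (hE : P.writesA .EXP = false) (hL : P.writesA .LOG = false) : FieldTables F s' := by
  obtain ⟨h1, h2, h3, h4, h5⟩ := h
  rw [← hf.a _ hE] at h2 h3
  rw [← hf.a _ hL] at h4 h5
  exact ⟨(hf.v _ hN).trans h1, h2, h3, h4, h5⟩

/-- `c` represents the field element `y`. -/
def Rep {fs : ℕ} (F : Repr K fs) (c : ℕ) (y : K) : Prop := c < fs ∧ F.val c = y

/-- Zero needs no case distinction in the program: its logarithm is set to `2 * (fs - 1)`, so any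
sum involving it points beyond the table of powers, where memory is still zero. Two genuine
logarithms have a sum inside the table. -/
theorem FieldTables.rep_mul {fs : ℕ} {F : Repr K fs} {s : St} (h : FieldTables F s) {a b : ℕ}
    {x y : K} (ha : Rep F a x) (hb : Rep F b y) :
    Rep F (s.a .EXP (s.a .LOG a + s.a .LOG b)) (x * y) := by
  obtain ⟨ha, rfl⟩ := ha
  obtain ⟨hb, rfl⟩ := hb
  by_cases h0 : a = 0 ∨ b = 0
  · have h1 : 2 * (fs - 1) ≤ s.a .LOG a + s.a .LOG b := by
      rcases h0 with rfl | rfl <;> rw [h.log_zero] <;> omega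
    rw [h.exp_zero _ h1]
    refine ⟨by omega, ?_⟩
    rcases h0 with rfl | rfl <;> simp [F.val_zero]
  · obtain ⟨h1, h2⟩ := h.log a ha (by tauto)
    obtain ⟨h3, h4⟩ := h.log b hb (by tauto)
    rw [h.exp _ (by omega)]
    refine ⟨F.pow_lt _, ?_⟩
    rw [F.val_pow, pow_add, h2, h4]

theorem FieldTables.rep_pow {fs : ℕ} {F : Repr K fs} {s : St} (h : FieldTables F s) (i : ℕ) :
    Rep F (s.a .EXP (i % (fs - 1))) (F.g ^ i) := by
  have := F.one_lt
  have h1 := Nat.mod_lt i (show 0 < fs - 1 by omega)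
  rw [h.exp _ (by omega)]
  exact ⟨F.pow_lt _, by rw [F.val_pow, F.pow_mod]⟩

theorem rep_xor {q : ℕ} {F : Repr K (2 ^ q)} {a b : ℕ} {x y : K} (ha : Rep F a x)
    (hb : Rep F b y) : Rep F (a ^^^ b) (x + y) :=
  ⟨Nat.xor_lt_two_pow ha.1 hb.1, by rw [F.val_xor, ha.2, hb.2]⟩

theorem rep_zero {fs : ℕ} (F : Repr K fs) : Rep F 0 0 :=
  ⟨by have := F.one_lt; omega, F.val_zero⟩

theorem rep_one {fs : ℕ} (F : Repr K fs) : Rep F 1 1 := ⟨F.one_lt, F.val_one⟩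

/-- Two periods of powers are stored so that sums of two logarithms need no reduction. Each
logarithm is written twice, but reduced modulo the period, so both writes agree. The zeros beyond
the table come from the initial memory. -/
theorem wp_fieldTables {q f : ℕ} {s : St} (hq : 4 * 2 ^ q < E.B)
    (hfs : s.v .fs = 2 ^ q) (hN : s.v .N = 2 ^ q - 1) (hpol : s.v .pol = f) (hf : 2 ^ q ≤ f)
    (hf' : f < 2 ^ (q + 1)) (F : Repr K (2 ^ q)) (hF : F.pow = state (2 ^ q) f)
    (hexp : ∀ i, s.a .EXP i = 0) :
    WP E fieldTables (12 * 2 ^ q + 3) (FieldTables F) s := by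
  have hpos : 1 < 2 ^ q := F.one_lt
  have hpow_ne : ∀ i, F.pow i ≠ 0 := fun i h => by
    have := F.val_pow i
    rw [h, F.val_zero] at this
    exact pow_ne_zero _ F.g_ne_zero this.symm
  refine WP.le (T := 1 + (1 + (2 * (2 ^ q - 1) * ((1 + (1 + 3)) + 1) + 1))) ?_ (by omega)
  refine WP.seq' (WP.put 0 (2 * (2 ^ q - 1)) rfl (by simp [hN]) (by omega) ?_)
  refine WP.seq' (WP.set 1 rfl (by omega) ?_)
  refine WP.mono (WP.loop (2 * (2 ^ q - 1)) (fun i s' => s'.v .s = F.pow i ∧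
    (∀ j < i, s'.a .EXP j = F.pow j) ∧ (∀ j, i ≤ j → s'.a .EXP j = 0) ∧
    s'.a .LOG 0 = 2 * (2 ^ q - 1) ∧ ∀ j < i, s'.a .LOG (F.pow j) < 2 ^ q - 1 ∧
      F.g ^ (s'.a .LOG (F.pow j)) = F.g ^ j) (1 + (1 + 3)) (by simp [hN]) (by omega)
    ⟨by simp [hF, state], by simp, by simpa using hexp, by simp, by simp⟩
    fun i hi s₁ hfr hb ⟨h1, h2, h3, h4, h5⟩ => ?_) le_rfl fun s' hfr _ ⟨_, h2, h3, h4, h5⟩ => ?_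
  · have e1 : s₁.v .fs = 2 ^ q := (hfr.v .fs rfl).trans hfs
    have e2 : s₁.v .pol = f := (hfr.v .pol rfl).trans hpol
    have e3 : s₁.v .N = 2 ^ q - 1 := (hfr.v .N rfl).trans hN
    have hlt := F.pow_lt i
    have hm := Nat.mod_lt i (show 0 < 2 ^ q - 1 by omega)
    refine WP.seq' (WP.put i (F.pow i) rfl h1 (by omega) ?_)
    refine WP.seq' (WP.put (F.pow i) (i % (2 ^ q - 1)) h1 (by simp [e3]) (by omega) ?_)
    refine WP.mono (wp_shift (q := q) (f := f) (by omega) h1 hlt e1 (fun c => e2) hf hf') le_rfl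
      fun s₂ hf₂ _ h6 => ?_
    have hE : s₂.a .EXP = Function.update (s₁.a .EXP) i (F.pow i) := hf₂.a .EXP rfl
    have hL : s₂.a .LOG = Function.update (s₁.a .LOG) (F.pow i) (i % (2 ^ q - 1)) := hf₂.a .LOG rfl
    refine ⟨by rw [h6, hF]; rfl, fun j hj => ?_, fun j hj => ?_, ?_, fun j hj => ?_⟩
    · rw [hE, Function.update_apply]
      split_ifs with h
      · rw [h]
      · exact h2 j (by omega)
    · rw [hE, Function.update_of_ne (by omega)]
      exact h3 j (by omega)
    · rw [hL, Function.update_of_ne (hpow_ne i).symm, h4]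
    · rw [hL, Function.update_apply]
      split_ifs with h
      · refine ⟨hm, ?_⟩
        rw [F.pow_mod, ← F.val_pow, ← F.val_pow, h]
      · rcases Nat.lt_succ_iff_lt_or_eq.1 hj with hj | rfl
        exacts [h5 j hj, absurd rfl h]
  · refine ⟨(hfr.v .N rfl).trans hN, h2, h3, h4, fun a ha ha0 => ?_⟩
    obtain ⟨j, hj, hj'⟩ := F.exists_pow (x := F.val a) fun h => ha0 <| by
      rwa [← F.val_zero, F.val_inj ha (by omega)] at h
    have : a = F.pow j := by
      rw [← F.val_inj ha (F.pow_lt j), F.val_pow, hj']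
    rw [this, F.val_pow]
    exact h5 j (by omega)

end Loop

/-! ### The dynamic program -/

namespace Loop

open ShiftRegister CutCount Elimination Finset

variable {E : Env} {n m k p q Q : ℕ} {G : SimpleGraph (Fin n)} {D : TreeDecomposition G m}
    {S : Finset (Fin n)} {K : Type} [Field K] [Fintype K]

/-- No set has more than `n` vertices, so the budget is capped at `n`; this keeps the filter sum
linear in `n` however large `k` is. Any position of a vertex of `S` may serve as `si`. -/
theorem wp_sources (hE : Room E n m k p) (hI : Input E G D S k) (hS : S.Nonempty) {s : St}
    (hs : Header n m k s) {ord : Fin n ≃ Fin n} (hord : ∀ i : Fin n, s.a .ORD i = ord i) :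
    WP E sources (5 * n + 5) (fun s' => (∀ i : Fin n, (ord i ∈ S → s'.a .SB i = 1) ∧
      (ord i ∉ S → s'.a .SB i = 0)) ∧ (∃ i : Fin n, s'.v .si = i ∧ ord i ∈ S) ∧
      s'.v .kk = min k n + 1) s := by
  have hsum := hE.sum
  have hbase := hI.base
  rw [TreeDecomposition.bagOffset] at hbase
  refine WP.le (T := (n * ((1 + (1 + (1 + 1))) + 1) + 1) + (1 + ((1 + 1) + 1))) ?_ (by omega)
  refine WP.seq (WP.loop n (fun i s' => (∀ j : Fin n, (j : ℕ) < i → (ord j ∈ S → s'.a .SB j = 1) ∧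
      (ord j ∉ S → s'.a .SB j = 0)) ∧ ((∃ j : Fin n, (j : ℕ) < i ∧ ord j ∈ S) →
      ∃ j : Fin n, s'.v .si = j ∧ ord j ∈ S)) (1 + (1 + (1 + 1))) hs.n (by omega) (by simp)
      fun i hi s₁ hf hb ⟨h1, h2⟩ => ?_) fun s₁ hf ⟨h1, h2⟩ => ?_
  · have e1 : s₁.v .n = n := (hf.v .n rfl).trans hs.n
    have e2 : s₁.a .ORD = s.a .ORD := hf.a .ORD rfl
    have e3 : s.a .ORD i = ord ⟨i, hi⟩ := hord ⟨i, hi⟩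
    have hlt := (ord ⟨i, hi⟩).2
    refine WP.seq' (WP.inp (3 + n * n + ord ⟨i, hi⟩) (by simp [e1, e2, e3]) (by omega) ?_)
    set g := E.I (3 + n * n + ord ⟨i, hi⟩) with hg
    have hgB : g < E.B := E.I_lt _
    have hSB : ∀ j : Fin n, (j : ℕ) < i + 1 → (ord j ∈ S → Function.update (s₁.a .SB) i g j = 1) ∧
        (ord j ∉ S → Function.update (s₁.a .SB) i g j = 0) := fun j hj => by
      by_cases hji : (j : ℕ) = i
      · obtain rfl : j = ⟨i, hi⟩ := Fin.ext hji
        simpa using hI.mem_S (ord ⟨i, hi⟩)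
      · rw [Function.update_of_ne hji]
        exact h1 j (by omega)
    refine WP.seq' (WP.put i g rfl (by simp) hgB ?_)
    refine WP.ite (fun hc => WP.set i rfl (by omega) ⟨by simpa using hSB, fun _ => ⟨⟨i, hi⟩, rfl, ?_⟩⟩)
      fun hc => WP.skip ⟨by simpa using hSB, ?_⟩
    · by_contra hcon
      exact hc ((hI.mem_S _).2 hcon)
    · rintro ⟨j, hj, hjS⟩
      refine h2 ⟨j, ?_, hjS⟩
      rcases Nat.lt_succ_iff_lt_or_eq.1 hj with hj | hj
      · exact hj
      · obtain rfl : j = ⟨i, hi⟩ := Fin.ext hj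
        have h3 : g = 1 := (hI.mem_S _).1 hjS
        have h4 : g = 0 := hc
        omega
  · have e1 : s₁.v .n = n := (hf.v .n rfl).trans hs.n
    have e2 : s₁.v .k = k := (hf.v .k rfl).trans hs.k
    obtain ⟨v, hv⟩ := hS
    have h3 := h2 ⟨ord.symm v, (ord.symm v).2, by simpa using hv⟩
    refine WP.seq' (WP.set k e2 (by omega) ?_)
    refine WP.seq (R := fun s' => s'.v .kk = min k n ∧ s'.a .SB = s₁.a .SB ∧ s'.v .si = s₁.v .si)
      (WP.ite (fun hc => WP.set n e1 (by omega) ⟨?_, rfl, rfl⟩) fun hc => WP.skip ⟨?_, rfl, rfl⟩) ?_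
    · have : n < k := by simpa [e1, e2] using hc
      simp; omega
    · have : ¬ n < k := by simpa [e1, e2] using hc
      simp; omega
    · rintro s₂ - ⟨h4, h5, h6⟩
      refine WP.set (min k n + 1) (by simp [h4]) (by omega) ⟨fun i => ?_, ?_, rfl⟩
      · rw [setV_a, h5]; exact h1 i i.2
      · rw [setV_v, if_neg (by decide), h6]; exact h3

/-- The data on which the main loop operates. -/
structure Data (F : Repr K (2 ^ q)) (D : TreeDecomposition G m) (S : Finset (Fin n)) (k : ℕ)
    (ord : Fin n ≃ Fin n) (Q : ℕ) (i₀ : Fin n) (y : Fin n → K) (s : St) : Prop where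
  header : Header n m k s
  tables : FieldTables F s
  later : Later D ord s
  slots : Slots D ord Q s
  pw : ∀ t ≤ Q, s.a .PW t = 4 ^ t
  ts : s.v .TS = 4 ^ Q
  x : ∀ i : Fin n, Rep F (s.a .X i) (y i)
  sb : ∀ i : Fin n, (ord i ∈ S → s.a .SB i = 1) ∧ (ord i ∉ S → s.a .SB i = 0)
  si : s.v .si = i₀
  kk : s.v .kk = min k n + 1

/-- `P` does not change the data. -/
def Stmt.keepsData (P : Stmt) : Bool :=
  [Var.n, .m, .k, .N, .TS, .si, .kk].all (fun x => !P.writesV x) &&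
    [Arr.EXP, .LOG, .HO, .GO, .SLOT, .PAR, .PW, .X, .SB].all fun c => !P.writesA c

theorem Data.of_frame {F : Repr K (2 ^ q)} {ord : Fin n ≃ Fin n} {i₀ : Fin n} {y : Fin n → K}
    {s s' : St} {P : Stmt} (h : Data F D S k ord Q i₀ y s) (hf : Frame P s s')
    (hP : P.keepsData = true) : Data F D S k ord Q i₀ y s' := by
  simp only [Stmt.keepsData, List.all_cons, List.all_nil, Bool.and_true, Bool.and_eq_true,
    Bool.not_eq_true'] at hP
  obtain ⟨⟨v1, v2, v3, v4, v5, v6, v7⟩, a1, a2, a3, a4, a5, a6, a7, a8, a9⟩ := hP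
  obtain ⟨h1, h2, ⟨h3, h3'⟩, ⟨h4, h5, h6, h7, h8, h9⟩, h10, h11, h12, h13, h14, h15⟩ := h
  rw [← hf.a _ a3] at h3
  rw [← hf.a _ a4] at h3'
  simp only [← hf.a _ a5] at h4 h5
  simp only [← hf.a _ a6] at h6 h7 h8 h9
  rw [← hf.a _ a7] at h10
  rw [← hf.a _ a8] at h12
  rw [← hf.a _ a9] at h13
  exact ⟨h1.of_frame hf v1 v2 v3, h2.of_frame hf v4 a1 a2, ⟨h3, h3'⟩, ⟨h4, h5, h6, h7, h8, h9⟩,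
    h10, (hf.v _ v5).trans h11, h12, h13, (hf.v _ v6).trans h14, (hf.v _ v7).trans h15⟩

variable {F : Repr K (2 ^ q)} {ord : Fin n ≃ Fin n} {i₀ : Fin n} {y : Fin n → K} {s : St}

theorem Data.setV (h : Data F D S k ord Q i₀ y s) (x : Var) (c : ℕ)
    (hx : (Stmt.set x 0).keepsData = true) : Data F D S k ord Q i₀ y (s.setV x c) := by
  refine h.of_frame (P := .set x 0) ⟨fun z hz => ?_, fun _ _ => rfl⟩ hx
  simp only [Stmt.writesV, decide_eq_false_iff_not] at hz
  rw [setV_v, if_neg (Ne.symm hz)]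

theorem wp_filterWeight (hE : Room E n m k p) (hq : 2 ^ q < E.B) (h : Data F D S k ord Q i₀ y s)
    {e : ℕ} (he : s.v .e = e) :
    WP E filterWeight (2 * n + 4) (fun s' =>
      Rep F (s'.v .hs) (∑ j ∈ range (min k n + 1), F.g ^ (e * (2 ^ q - 1 - j)))) s := by
  have hsum := hE.sum
  refine WP.le (T := 1 + ((min k n + 1) * (1 + 1) + 1)) ?_ (by omega)
  refine WP.seq' (WP.set 0 rfl (by omega) ?_)
  refine WP.loop (min k n + 1) (fun j s' =>
      Rep F (s'.v .hs) (∑ j ∈ range j, F.g ^ (e * (2 ^ q - 1 - j)))) 1 h.kk (by omega)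
      (rep_zero F) fun j hj s₁ hf hb h1 => ?_
  have h2 := ((h.setV .hs 0 rfl).of_frame hf rfl).tables
  have e1 : s₁.v .e = e := (hf.v .e rfl).trans he
  have h3 := rep_xor h1 (h2.rep_pow (e * (2 ^ q - 1 - j)))
  rw [← sum_range_succ] at h3
  refine WP.set _ ?_ (h3.1.trans hq) ?_
  · simp [e1, h2.N]
  · simpa using h3

theorem wp_edgeFactors (hE : Room E n m k p) (hq : 2 ^ q < E.B) (h : Data F D S k ord Q i₀ y s)
    {e : ℕ} (he : s.v .e = e) :
    WP E edgeFactors 16 (fun s' => ∀ c < 4, ∀ c' < 4, Rep F (s'.a .EDG (4 * c + c'))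
      (edgeFactor (F.g ^ (e * (n + 1))) c c')) s := by
  have hsum := hE.sum
  -- An edge between two outside vertices in state `2` contributes `τ` once for each endpoint, hence
  -- `τ ^ 2`.
  have hsq := h.tables.rep_pow (e * (2 * (n + 1)))
  have hev (s' : St) (h1 : s'.v = s.v) (h2 : s'.a .EXP = s.a .EXP) :
      Expr.eval s' (.get .EXP (.var .e * (2 * (.var .n + 1)) % .var .N)) =
        s.a .EXP (e * (2 * (n + 1)) % (2 ^ q - 1)) := by
    simp [h1, h2, he, h.tables.N, h.header.n]
  rw [show e * (2 * (n + 1)) = e * (n + 1) + e * (n + 1) by ring, pow_add] at hsq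
  refine WP.le (T := 1 + (1 + (1 + (1 + (1 + (1 + (1 + (1 + (1 + (1 + (1 + (1 + (1 + (1 + (1 + 1)))))))))))))))
    ?_ le_rfl
  refine WP.seq' (WP.put 0 1 rfl rfl (by omega) ?_)
  refine WP.seq' (WP.put 1 0 rfl rfl (by omega) ?_)
  refine WP.seq' (WP.put 2 1 rfl rfl (by omega) ?_)
  refine WP.seq' (WP.put 3 1 rfl rfl (by omega) ?_)
  refine WP.seq' (WP.put 4 0 rfl rfl (by omega) ?_)
  refine WP.seq' (WP.put 5 1 rfl rfl (by omega) ?_)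
  refine WP.seq' (WP.put 6 1 rfl rfl (by omega) ?_)
  refine WP.seq' (WP.put 7 1 rfl rfl (by omega) ?_)
  refine WP.seq' (WP.put 8 1 rfl rfl (by omega) ?_)
  refine WP.seq' (WP.put 9 1 rfl rfl (by omega) ?_)
  refine WP.seq' (WP.put 10 _ rfl (hev _ rfl rfl) ?_ ?_)
  · rw [show e * (2 * (n + 1)) = e * (n + 1) + e * (n + 1) by ring]
    exact hsq.1.trans hq
  refine WP.seq' (WP.put 11 0 rfl rfl (by omega) ?_)
  refine WP.seq' (WP.put 12 1 rfl rfl (by omega) ?_)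
  refine WP.seq' (WP.put 13 1 rfl rfl (by omega) ?_)
  refine WP.seq' (WP.put 14 0 rfl rfl (by omega) ?_)
  refine WP.put 15 0 rfl rfl (by omega) ?_
  rw [show e * (2 * (n + 1)) = e * (n + 1) + e * (n + 1) by ring]
  intro c hc c' hc'
  generalize F.g ^ (e * (n + 1)) = τ at hsq ⊢
  interval_cases c <;> interval_cases c' <;>
    simp only [edgeFactor, halfEdge, stateOf, setA_a, if_true, Function.update_apply] <;> norm_num
  all_goals first | exact rep_one F | exact rep_zero F | exact hsq

theorem wp_vertexWeights (hE : Room E n m k p) (hq : 2 ^ q < E.B) (h : Data F D S k ord Q i₀ y s)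
    {e : ℕ} (he : s.v .e = e) (heN : e < 2 ^ q - 1) (hn : n + 1 < 2 ^ q - 1) :
    WP E vertexWeights (8 * n + 2) (fun s' => ∀ i : Fin n, ∀ c < 4, Rep F (s'.a .WT (4 * i + c))
      (vertexWeight S (ord i₀) (F.g ^ (e * (n + 1))) (fun v => y (ord.symm v) * F.g ^ e) (ord i)
        (stateOf c))) s := by
  have hsum := hE.sum
  set τ := F.g ^ (e * (n + 1)) with hτ
  -- The inverse is written with a nonnegative exponent, using that `g` has order `2 ^ q - 1`.
  have hti : F.g ^ (e * (2 ^ q - 1 - (n + 1))) = τ⁻¹ := by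
    refine eq_inv_of_mul_eq_one_left ?_
    rw [hτ, ← pow_add, ← mul_add, Nat.sub_add_cancel hn.le, mul_comm, pow_mul, ← F.orderOf_g,
      pow_orderOf_eq_one, one_pow]
  have hrti := h.tables.rep_pow (e * (2 ^ q - 1 - (n + 1)))
  rw [hti] at hrti
  refine WP.le (T := 1 + (n * ((1 + (1 + ((1 + 1) + ((1 + 1) + 1)))) + 1) + 1)) ?_ (by omega)
  refine WP.seq' (WP.set _ ?_ (hrti.1.trans hq) ?_)
  · simp [h.tables.N, h.header.n, he]
  set ti := s.a .EXP (e * (2 ^ q - 1 - (n + 1)) % (2 ^ q - 1)) with hti'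
  refine WP.mono (WP.loop n (fun i s' => ∀ j : Fin n, (j : ℕ) < i → ∀ c < 4,
      Rep F (s'.a .WT (4 * j + c))
      (vertexWeight S (ord i₀) τ (fun v => y (ord.symm v) * F.g ^ e) (ord j)
        (stateOf c))) (1 + (1 + ((1 + 1) + ((1 + 1) + 1)))) h.header.n (by omega) (by simp)
        fun i hi s₁ hf hb h1 => ?_) le_rfl fun s' _ _ h j => h j j.2
  have hd := (h.setV .ti ti rfl).of_frame hf rfl
  have e1 : s₁.v .e = e := (hf.v .e rfl).trans he
  have e2 : s₁.v .ti = ti := hf.v .ti rfl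
  have hx := hd.x ⟨i, hi⟩
  have hge := hd.tables.rep_pow e
  rw [Nat.mod_eq_of_lt heN] at hge
  have hwx := hd.tables.rep_mul hx hge
  refine WP.seq' (WP.set _ (by simp [e1]) (hwx.1.trans hq) ?_)
  set wx := s₁.a .EXP (s₁.a .LOG (s₁.a .X i) + s₁.a .LOG (s₁.a .EXP e)) with hwx'
  set u1 : ℕ := if i = i₀ then 0 else wx with hu1
  set u2 : ℕ := if ord ⟨i, hi⟩ ∈ S then 0 else ti with hu2
  set u3 : ℕ := if ord ⟨i, hi⟩ ∈ S then 0 else 1 ^^^ ti with hu3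
  have hone := rep_xor (rep_one F) hrti
  have hSB : s₁.a .SB i ≠ 0 ↔ ord ⟨i, hi⟩ ∈ S := by
    by_cases hiS : ord ⟨i, hi⟩ ∈ S
    · simp [hiS, (hd.sb ⟨i, hi⟩).1 hiS]
    · simp [hiS, (hd.sb ⟨i, hi⟩).2 hiS]
  refine WP.seq' (WP.put (4 * i) wx (by simp) (by simp) (hwx.1.trans hq) ?_)
  refine WP.seq (R := fun s' => s'.a = ((s₁.setA .WT (4 * i) wx).setA .WT (4 * i + 1) u1).a ∧
    s'.v .i = i ∧ s'.v .ti = ti) (WP.ite (fun hc => ?_) fun hc => ?_) fun s₂ _ h2 => ?_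
  · have hc' : i = i₀ := by simpa [hd.si] using hc
    refine WP.put (4 * i + 1) 0 (by simp) rfl (by omega) ⟨?_, rfl, e2⟩
    rw [hu1, if_pos hc']; rfl
  · have hc' : i ≠ i₀ := by simpa [hd.si] using hc
    refine WP.put (4 * i + 1) wx (by simp) rfl (hwx.1.trans hq) ⟨?_, rfl, e2⟩
    rw [hu1, if_neg hc']; rfl
  refine WP.mono (R := fun s' => s'.a .WT = Function.update (Function.update (Function.update
    (Function.update (s₁.a .WT) (4 * i) wx) (4 * i + 1) u1) (4 * i + 2) u2) (4 * i + 3) u3)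
    (WP.ite (T := 1 + 1) (fun hc => ?_) fun hc => ?_) le_rfl fun s₃ _ _ h3 j hj c hc => ?_
  · have hc' : ord ⟨i, hi⟩ ∈ S := hSB.1 (by simpa [h2.1, h2.2.1] using hc)
    refine WP.seq' (WP.put (4 * i + 2) 0 (by simp [h2.2.1]) rfl (by omega) ?_)
    refine WP.put (4 * i + 3) 0 (by simp [h2.2.1]) rfl (by omega) ?_
    simp [h2.1, hu2, hu3, hc']
  · have hc' : ord ⟨i, hi⟩ ∉ S := fun hcon => hSB.2 hcon (by simpa [h2.1, h2.2.1] using hc)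
    refine WP.seq' (WP.put (4 * i + 2) ti (by simp [h2.2.1]) (by simp [h2.2.2]) (hrti.1.trans hq) ?_)
    refine WP.put (4 * i + 3) (1 ^^^ ti) (by simp [h2.2.1]) (by simp [h2.2.2]) (hone.1.trans hq) ?_
    simp [h2.1, hu2, hu3, hc']
  · rw [h3]
    by_cases hji : (j : ℕ) = i
    · obtain rfl : j = ⟨i, hi⟩ := Fin.ext hji
      have hii : ((i = (i₀ : ℕ)) ↔ (⟨i, hi⟩ : Fin n) = i₀) := by rw [Fin.ext_iff]
      interval_cases c
      · simpa [vertexWeight, stateOf] using hwx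
      · by_cases h4 : (⟨i, hi⟩ : Fin n) = i₀
        · simpa [vertexWeight, stateOf, h4, hu1, hii] using rep_zero F
        · simpa [vertexWeight, stateOf, h4, hu1, hii] using hwx
      · by_cases h4 : ord ⟨i, hi⟩ ∈ S
        · simpa [vertexWeight, stateOf, h4, hu2] using rep_zero F
        · simpa [vertexWeight, stateOf, h4, hu2] using hrti
      · by_cases h4 : ord ⟨i, hi⟩ ∈ S
        · simpa [vertexWeight, stateOf, h4, hu3] using rep_zero F
        · simpa [vertexWeight, stateOf, h4, hu3] using hone
    · rw [Function.update_of_ne (by omega), Function.update_of_ne (by omega),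
        Function.update_of_ne (by omega), Function.update_of_ne (by omega)]
      exact h1 j (by omega) c hc

end Loop

/-! ### Tables of the messages -/

namespace Loop

open ShiftRegister CutCount Elimination Finset

variable {E : Env} {n m k p q Q : ℕ} {G : SimpleGraph (Fin n)} {D : TreeDecomposition G m}
    {S : Finset (Fin n)} {K : Type} [Field K]

open Classical in
/-- The factors of the weight that belong to a position of the elimination order. -/
noncomputable def localWeight (G : SimpleGraph (Fin n)) (S : Finset (Fin n)) (s₀ : Fin n) (τ : K)
    (x : Fin n → K) (ord : Fin n ≃ Fin n) (i : ℕ) (σ : ℕ → ℕ) : K :=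
  if h : i < n then vertexWeight S s₀ τ x (ord ⟨i, h⟩) (stateOf (σ i)) *
    ∏ j : Fin n, if (⟨i, h⟩ : Fin n) < j ∧ G.Adj (ord ⟨i, h⟩) (ord j) then edgeFactor τ (σ i) (σ j)
      else 1
  else 1

/-- The later neighbours in the completion. -/
def LaterShare (D : TreeDecomposition G m) (ord : Fin n ≃ Fin n) (i j : ℕ) : Prop :=
  ∃ (hi : i < n) (hj : j < n), i < j ∧ D.Share (ord ⟨i, hi⟩) (ord ⟨j, hj⟩)

/-- Every edge of `G` lies in a bag, so a local factor sees only later neighbours in the sharing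
graph, for which the order is a perfect elimination order. -/
theorem scheme_localWeight {ord : Fin n ≃ Fin n} {s : St} (hs : Slots D ord Q s)
    (hord : ∀ i j j', i < j → i < j' → D.Share (ord i) (ord j) →
        D.Share (ord i) (ord j') → D.Share (ord j) (ord j'))
    (s₀ : Fin n) (τ : K) (x : Fin n → K) :
    Scheme (localWeight G S s₀ τ x ord) (s.a .PAR) n (LaterShare D ord) where
  lt := fun i j ⟨hi, hj, hij, _⟩ => ⟨hij, hj⟩
  clique := fun i j j' ⟨hi, hj, hij, h⟩ ⟨_, hj', hij', h'⟩ hjj' =>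
    ⟨hj, hj', hjj', hord ⟨i, hi⟩ ⟨j, hj⟩ ⟨j', hj'⟩ hij hij' h h'⟩
  par_le := fun i j ⟨hi, hj, hij, h⟩ => hs.par_le ⟨i, hi⟩ ⟨j, hj⟩ hij h
  lt_par := hs.lt_par
  par_le_n := hs.par_le_n
  par_rel := fun i hi h => ⟨hi, h, hs.lt_par i hi, hs.par_rel i hi h ⟨i, hi⟩ rfl⟩
  loc_congr := fun i hi σ σ' h h' => by
    rw [localWeight, localWeight, dif_pos hi, dif_pos hi, h]
    congr 1
    refine prod_congr rfl fun j _ => ?_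
    split_ifs with hj
    · rw [h' j ⟨hi, j.2, hj.1, D.adj_bag _ _ hj.2⟩]
    · rfl

variable [Fintype K]

variable {F : Repr K (2 ^ q)} {ord : Fin n ≃ Fin n} {i₀ : Fin n} {y : Fin n → K}

/-- The factors for the current element of the field. -/
structure Factors (F : Repr K (2 ^ q)) (S : Finset (Fin n)) (ord : Fin n ≃ Fin n) (i₀ : Fin n)
    (τ : K) (x : Fin n → K) (s : St) : Prop where
  edg : ∀ c < 4, ∀ c' < 4, Rep F (s.a .EDG (4 * c + c')) (edgeFactor τ c c')
  wt : ∀ i : Fin n, ∀ c < 4, Rep F (s.a .WT (4 * i + c))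
    (vertexWeight S (ord i₀) τ x (ord i) (stateOf c))

theorem Factors.of_frame {τ : K} {x : Fin n → K} {s s' : St} {P : Stmt}
    (h : Factors F S ord i₀ τ x s) (hf : Frame P s s') (hE : P.writesA .EDG = false)
    (hW : P.writesA .WT = false) : Factors F S ord i₀ τ x s' := by
  obtain ⟨h1, h2⟩ := h
  rw [← hf.a _ hE] at h1
  rw [← hf.a _ hW] at h2
  exact ⟨h1, h2⟩

/-- The message of the vertex `i` for the states with the code `ix`. -/
noncomputable def tableEntry (G : SimpleGraph (Fin n)) (S : Finset (Fin n)) (s₀ : Fin n) (τ : K)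
    (x : Fin n → K) (ord : Fin n ≃ Fin n) (par slot : ℕ → ℕ) (i ix : ℕ) : K :=
  msg (localWeight G S s₀ τ x ord) par i fun j => digit ix (slot j)

/-- The tables of the vertices before `i` have been computed. -/
def TablesTo (F : Repr K (2 ^ q)) (Q i : ℕ) (t : ℕ → ℕ → K) (tbl : ℕ → ℕ) : Prop :=
  ∀ j < i, ∀ ix < 4 ^ Q, Rep F (tbl (j * 4 ^ Q + ix)) (t j ix)

theorem wp_stateProduct (hE : Room E n m k p) (hq : 2 ^ q < E.B) (hQ : Q ≤ p + 1) {s : St}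
    (h : Data F D S k ord Q i₀ y s) {τ : K} {x : Fin n → K} (hF : Factors F S ord i₀ τ x s)
    {i ix c : ℕ} (hi : s.v .i = i) (hin : i < n) (hix : s.v .ix = ix) (hixQ : ix < 4 ^ Q)
    (hc : s.v .c = c) (hc4 : c < 4)
    (hT : TablesTo F Q i (tableEntry G S (ord i₀) τ x ord (s.a .PAR) (s.a .SLOT)) (s.a .TBL)) :
    WP E stateProduct (6 * n + 4) (fun s' => Rep F (s'.v .pr)
      (localWeight G S (ord i₀) τ x ord i
        (fun j => digit (setDigit ix (s.a .SLOT i) c) (s.a .SLOT j)) *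
      ∏ j ∈ range i, if s.a .PAR j = i then tableEntry G S (ord i₀) τ x ord (s.a .PAR) (s.a .SLOT) j
        (setDigit ix (s.a .SLOT i) c) else 1)) s := by
  classical
  have hsum := hE.sum
  have hpow := hE.pow
  have hsl := h.slots.slot_lt i hin
  have hid : setDigit ix (s.a .SLOT i) c < 4 ^ Q := setDigit_lt hc4 hsl hixQ
  have hQB : 4 ^ Q < E.B := (Nat.pow_le_pow_right (by omega) (show Q ≤ p + 2 by omega)).trans_lt hpow
  have hpw := h.pw _ hsl.le
  set a := setDigit ix (s.a .SLOT i) c with ha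
  set w := vertexWeight S (ord i₀) τ x (ord ⟨i, hin⟩) (stateOf c)
  have hw := hF.wt ⟨i, hin⟩ c hc4
  set φ : ℕ → K := fun j => if s.a .GO (i * n + j) ≠ 0 then edgeFactor τ c (digit a (s.a .SLOT j)) else 1
    with hφ
  set ψ : ℕ → K := fun j => if s.a .PAR j = i then tableEntry G S (ord i₀) τ x ord (s.a .PAR) (s.a .SLOT) j a
    else 1 with hψ
  have hloc : localWeight G S (ord i₀) τ x ord i (fun j => digit a (s.a .SLOT j)) =
      w * ∏ j ∈ range n, φ j := by
    rw [localWeight, dif_pos hin, ha, digit_setDigit _ _ hc4, ← ha, ← Fin.prod_univ_eq_prod_range]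
    congr 1
    refine prod_congr rfl fun j _ => if_congr ?_ rfl rfl
    have := h.later.go ⟨i, hin⟩ j
    simp only at this
    by_cases h1 : (⟨i, hin⟩ : Fin n) < j ∧ G.Adj (ord ⟨i, hin⟩) (ord j)
    · simp [h1, this.1 h1]
    · simp [h1, this.2 h1]
  rw [hloc]
  refine WP.le (T := 1 + (1 + ((n * ((1 + 1) + 1) + 1) + (i * ((1 + 1) + 1) + 1)))) ?_ (by omega)
  refine WP.seq' (WP.set _ (by simp [hi, hc]) (hw.1.trans hq) ?_)
  refine WP.seq' (WP.set a ?_ (by omega) ?_)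
  · simp [ha, setDigit, digit, hi, hix, hc, hpw]
  set s₁ := (s.setV .pr (s.a .WT (4 * i + c))).setV .id2 a with hs₁
  have h₁ : Data F D S k ord Q i₀ y s₁ := (h.setV _ _ rfl).setV _ _ rfl
  refine WP.seq (WP.loop n (fun j s' => Rep F (s'.v .pr) (w * ∏ j' ∈ range j, φ j')) (1 + 1)
    h₁.header.n (by omega) (by simpa [hs₁] using hw) fun j hj s₂ hf hb h2 => ?_) fun s₂ hf h2 => ?_
  · have hd := h₁.of_frame hf rfl
    have hFd : Factors F S ord i₀ τ x s₂ := Factors.of_frame (s := s₁) ⟨hF.edg, hF.wt⟩ hf rfl rfl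
    have e1 : s₂.v .i = i := (hf.v .i rfl).trans hi
    have e2 : s₂.v .c = c := (hf.v .c rfl).trans hc
    have e3 : s₂.v .id2 = a := hf.v .id2 rfl
    have e4 : s₂.a .SLOT = s.a .SLOT := hf.a .SLOT rfl
    have e5 : s₂.a .GO = s.a .GO := hf.a .GO rfl
    have e6 := hd.header.n
    have e7 := hd.pw (s.a .SLOT j) (h.slots.slot_lt j hj).le
    rw [prod_range_succ, ← mul_assoc]
    refine WP.ite (fun hcond => ?_) fun hcond => WP.skip ?_
    · have hcond : s.a .GO (i * n + j) ≠ 0 := by simpa [e1, e5, e6] using hcond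
      have h3 := hd.tables.rep_mul h2 (hFd.edg c hc4 (digit a (s.a .SLOT j)) (digit_lt _ _))
      refine WP.set _ ?_ (h3.1.trans hq) ?_
      · simp [e2, e3, e4, e7, digit]
      · simpa [hφ, hcond] using h3
    · have hcond : s.a .GO (i * n + j) = 0 := by simpa [e1, e5, e6] using hcond
      simpa [hφ, hcond] using h2
  · have hd := h₁.of_frame hf rfl
    have e1 : s₂.v .i = i := (hf.v .i rfl).trans hi
    have e3 : s₂.v .id2 = a := hf.v .id2 rfl
    have e4 : s₂.a .PAR = s.a .PAR := hf.a .PAR rfl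
    have e5 : s₂.a .TBL = s.a .TBL := hf.a .TBL rfl
    refine WP.loop i (fun j s' => Rep F (s'.v .pr) (w * (∏ j' ∈ range n, φ j') * ∏ j' ∈ range j, ψ j'))
      (1 + 1) e1 (by omega) (by simpa using h2) fun j hj s₃ hf' hb h3 => ?_
    have hd' := hd.of_frame hf' rfl
    have f1 : s₃.v .i = i := (hf'.v .i rfl).trans e1
    have f3 : s₃.v .id2 = a := (hf'.v .id2 rfl).trans e3
    have f4 : s₃.a .PAR = s.a .PAR := (hf'.a .PAR rfl).trans e4
    have f5 : s₃.a .TBL = s.a .TBL := (hf'.a .TBL rfl).trans e5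
    rw [prod_range_succ, ← mul_assoc]
    refine WP.ite (fun hcond => ?_) fun hcond => WP.skip ?_
    · have hcond : s.a .PAR j = i := by simpa [f1, f4] using hcond
      have h4 := hd'.tables.rep_mul h3 (hT j hj a hid)
      refine WP.set _ ?_ (h4.1.trans hq) ?_
      · simp [f3, f5, hd'.ts]
      · simpa [hψ, hcond] using h4
    · have hcond : s.a .PAR j ≠ i := by simpa [f1, f4] using hcond
      simpa [hψ, hcond] using h3

/-- Children precede their parent in the order, so their tables are complete when needed. Over all
entries, the four states and the linear scans give `O(4 ^ Q * n)` per vertex. -/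
theorem wp_vertexTables (hE : Room E n m k p) (hq : 2 ^ q < E.B) (hQ : Q ≤ p + 1) {s : St}
    (h : Data F D S k ord Q i₀ y s) (hord : ∀ i j j', i < j → i < j' → D.Share (ord i) (ord j) →
        D.Share (ord i) (ord j') → D.Share (ord j) (ord j')) {τ : K} {x : Fin n → K}
    (hF : Factors F S ord i₀ τ x s) :
    WP E vertexTables (n * (4 ^ Q * (24 * n + 28) + 2) + 1) (fun s' =>
      TablesTo F Q n (tableEntry G S (ord i₀) τ x ord (s.a .PAR) (s.a .SLOT)) (s'.a .TBL)) s := by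
  have hsum := hE.sum
  have hpow := hE.pow
  have hcube := hE.cube
  have hB : 4 ≤ E.B := by
    have : 0 < (n + 2) ^ 3 := by positivity
    omega
  have hQB : 4 ^ Q < E.B := (Nat.pow_le_pow_right (by omega) (show Q ≤ p + 2 by omega)).trans_lt hpow
  have hsch := scheme_localWeight (S := S) h.slots hord (ord i₀) τ x
  set t := tableEntry G S (ord i₀) τ x ord (s.a .PAR) (s.a .SLOT) with ht
  refine WP.le (T := n * ((4 ^ Q * ((1 + ((4 * (((6 * n + 4) + 1) + 1) + 1) + 1)) + 1) + 1) + 1) + 1) ?_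
    (by ring_nf; omega)
  refine WP.loop n (fun i s' => TablesTo F Q i t (s'.a .TBL)) (4 ^ Q * ((1 + ((4 * (((6 * n + 4) + 1) + 1) + 1) + 1)) + 1) + 1)
    h.header.n (by omega) (by simp [TablesTo]) fun i hi s₁ hf hb h1 => ?_
  have hd := h.of_frame hf rfl
  have hFd := hF.of_frame hf rfl rfl
  have eP : s₁.a .PAR = s.a .PAR := hf.a .PAR rfl
  have eS : s₁.a .SLOT = s.a .SLOT := hf.a .SLOT rfl
  refine WP.mono (WP.loop (4 ^ Q) (fun ix s' => TablesTo F Q i t (s'.a .TBL) ∧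
    ∀ a < ix, Rep F (s'.a .TBL (i * 4 ^ Q + a)) (t i a)) ((1 + ((4 * (((6 * n + 4) + 1) + 1) + 1) + 1)))
    hd.ts hQB.le ⟨h1, by simp⟩ fun ix hix s₂ hf' hb' ⟨h2, h3⟩ => ?_) le_rfl fun s₂ _ _ ⟨h2, h3⟩ j hj a ha => ?_
  swap
  · rcases Nat.lt_succ_iff_lt_or_eq.1 hj with hj | rfl
    exacts [h2 j hj a ha, h3 a ha]
  have hd' := (hd.setV .i i rfl).of_frame hf' rfl
  have hFd' : Factors F S ord i₀ τ x s₂ := Factors.of_frame (s := s₁.setV .i i) ⟨hFd.edg, hFd.wt⟩ hf' rfl rfl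
  have eP' : s₂.a .PAR = s.a .PAR := (hf'.a .PAR rfl).trans eP
  have eS' : s₂.a .SLOT = s.a .SLOT := (hf'.a .SLOT rfl).trans eS
  have ei : s₂.v .i = i := hf'.v .i rfl
  set χ : ℕ → K := fun c => localWeight G S (ord i₀) τ x ord i
      (fun j => digit (setDigit ix (s.a .SLOT i) c) (s.a .SLOT j)) *
      ∏ j ∈ range i, if s.a .PAR j = i then t j (setDigit ix (s.a .SLOT i) c) else 1 with hχ
  -- Overwriting the digit in the slot of `i` may also change the decoded states of unrelated
  -- vertices with the same slot. This is harmless: the later neighbours of `i` have other slots,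
  -- and nothing else matters by `msg_eq_of_agree`.
  have hmsg : t i ix = ∑ c ∈ range 4, χ c := by
    rw [ht, tableEntry]
    refine hsch.msg_eq_of_agree hi (fun c j => digit (setDigit ix (s.a .SLOT i) c) (s.a .SLOT j))
      (fun c hc => digit_setDigit _ _ hc) fun c hc j ⟨_, hj, hij, hsh⟩ => ?_
    exact digit_setDigit_of_ne _ hc (h.slots.slot_ne ⟨i, hi⟩ ⟨j, hj⟩ hij hsh).symm
  refine WP.seq' (WP.set 0 rfl (by omega) ?_)
  set s₃ := (s₂.setV .ix ix).setV .tot 0 with hs₃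
  have hd₃ : Data F D S k ord Q i₀ y s₃ := (hd'.setV _ _ rfl).setV _ _ rfl
  refine WP.seq (WP.loop 4 (fun c s' => Rep F (s'.v .tot) (∑ c' ∈ range c, χ c')) ((6 * n + 4) + 1)
    rfl hB (rep_zero F) fun c hc s₄ hf₄ hb₄ h4 => ?_) fun s₄ hf₄ h4 => ?_
  · have hd₄ : Data F D S k ord Q i₀ y (s₄.setV .c c) := (hd₃.of_frame hf₄ rfl).setV _ _ rfl
    have hF₃ : Factors F S ord i₀ τ x s₃ := ⟨hFd'.edg, hFd'.wt⟩
    have hF₄ := hF₃.of_frame hf₄ rfl rfl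
    have gP : (s₄.setV .c c).a .PAR = s.a .PAR := (hf₄.a .PAR rfl).trans eP'
    have gS : (s₄.setV .c c).a .SLOT = s.a .SLOT := (hf₄.a .SLOT rfl).trans eS'
    have gT : (s₄.setV .c c).a .TBL = s₂.a .TBL := hf₄.a .TBL rfl
    refine WP.seq (wp_stateProduct (s := s₄.setV .c c) hE hq hQ hd₄ (τ := τ) (x := x) ⟨hF₄.edg, hF₄.wt⟩
      (i := i) (ix := ix) (c := c) ((hf₄.v .i rfl).trans ei) hi (hf₄.v .ix rfl) hix rfl hc ?_) fun s₅ hf₅ h5 => ?_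
    · rw [gP, gS, gT]; exact h2
    · rw [gP, gS] at h5
      have e5 : s₅.v .tot = s₄.v .tot := hf₅.v .tot rfl
      rw [← e5] at h4
      have h6 := rep_xor h4 h5
      rw [sum_range_succ]
      exact WP.set _ rfl (h6.1.trans hq) (by simpa using h6)
  · have gT : s₄.a .TBL = s₂.a .TBL := hf₄.a .TBL rfl
    have g1 : s₄.v .i = i := (hf₄.v .i rfl).trans ei
    have g2 : s₄.v .ix = ix := hf₄.v .ix rfl
    have g3 := (hd₃.of_frame hf₄ rfl).ts
    refine WP.put (i * 4 ^ Q + ix) (s₄.v .tot) (by simp [g1, g2, g3]) rfl (h4.1.trans hq) ?_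
    simp only [setA_a, if_true, gT]
    refine ⟨fun j hj a ha => ?_, fun a ha => ?_⟩
    · rw [Function.update_of_ne fun heq => hj.ne ((Nat.mul_add_inj ha hix).1 heq).1]
      exact h2 j hj a ha
    · rcases Nat.lt_succ_iff_lt_or_eq.1 ha with ha | rfl
      · rw [Function.update_of_ne (by omega)]
        exact h3 a ha
      · rw [Function.update_self, hmsg]
        exact h4

theorem wp_rootProduct (hE : Room E n m k p) (hq : 2 ^ q < E.B) {s : St}
    (h : Data F D S k ord Q i₀ y s) {t : ℕ → ℕ → K} (hT : TablesTo F Q n t (s.a .TBL)) :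
    WP E rootProduct (3 * n + 2) (fun s' => Rep F (s'.v .res)
      (∏ j ∈ range n, if s.a .PAR j = n then t j 0 else 1)) s := by
  have hsum := hE.sum
  refine WP.le (T := 1 + (n * ((1 + 1) + 1) + 1)) ?_ (by omega)
  refine WP.seq' (WP.set 1 rfl (by omega) ?_)
  refine WP.loop n (fun i s' => Rep F (s'.v .res)
    (∏ j ∈ range i, if s.a .PAR j = n then t j 0 else 1)) (1 + 1) h.header.n (by omega)
    (by simpa using rep_one F) fun j hj s₁ hf hb h1 => ?_
  have hd := (h.setV .res 1 rfl).of_frame hf rfl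
  have e1 : s₁.a .PAR = s.a .PAR := hf.a .PAR rfl
  have e2 : s₁.a .TBL = s.a .TBL := hf.a .TBL rfl
  have e3 := hd.header.n
  rw [prod_range_succ]
  refine WP.ite (fun hc => ?_) fun hc => WP.skip ?_
  · have hc : s.a .PAR j = n := by simpa [e1, e3] using hc
    have h2 := hd.tables.rep_mul h1 (hT j hj 0 (by positivity))
    refine WP.set _ ?_ (h2.1.trans hq) ?_
    · simp [e2, hd.ts]
    · simpa [hc] using h2
  · have hc : s.a .PAR j ≠ n := by simpa [e1, e3] using hc
    simpa [hc] using h1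

end Loop

/-! ### Correctness of the algorithm -/

namespace Loop

open ShiftRegister CutCount Elimination Finset

variable {E : Env} {n m k p q Q : ℕ} {G : SimpleGraph (Fin n)} {D : TreeDecomposition G m}
    {S : Finset (Fin n)} {K : Type} [Field K] [Fintype K]
    {F : Repr K (2 ^ q)} {ord : Fin n ≃ Fin n} {i₀ : Fin n} {y : Fin n → K}

theorem wp_mainLoop [CharP K 2] (hE : Room E n m k p) (hq : 2 ^ q < E.B) (hq1 : 1 ≤ q)
    (hlarge : (n + 2) ^ 3 < 2 ^ q) (hQ : Q ≤ p + 1) {s : St}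
    (h : Data F D S k ord Q i₀ y s) (hord : ∀ i j j', i < j → i < j' → D.Share (ord i) (ord j) →
        D.Share (ord i) (ord j') → D.Share (ord j) (ord j')) (hi₀ : ord i₀ ∈ S)
    (hacc : s.v .acc = 0) :
    WP E mainLoop (2 ^ q * (n * (4 ^ (p + 1) * (24 * n + 28) + 2) + 13 * n + 27) + 1) (fun s' =>
      Rep F (s'.v .acc) (MvPolynomial.eval y (solutionPoly K G S k ord))) s := by
  classical
  have hN : n + 1 < 2 ^ q - 1 := by
    have : n + 3 ≤ (n + 2) ^ 3 := by nlinarith [Nat.zero_le (n ^ 3)]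
    omega
  have hodd : Odd (2 ^ q - 1) := Nat.Even.sub_odd Nat.one_le_two_pow
    ((Nat.even_pow' (by omega)).2 even_two) odd_one
  set A : ℕ → K := fun e => ∑ σ : Fin n → State, weight G S (ord i₀) (F.g ^ (e * (n + 1)))
    (fun v => y (ord.symm v) * F.g ^ e) σ with hA
  set B : ℕ → K := fun e => ∑ j ∈ range (min k n + 1), F.g ^ (e * (2 ^ q - 1 - j)) with hB
  have hsum : MvPolynomial.eval y (solutionPoly K G S k ord) = ∑ e ∈ range (2 ^ q - 1), A e * B e := by
    rw [eval_solutionPoly, ← sum_filter_weight G S (ord i₀) F.orderOf_g hodd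
      (fun v => y (ord.symm v)) hi₀ k (Fintype.card_fin n) ?_]
    have : (n + 1) * n * n + n + 1 ≤ (n + 2) ^ 3 := by nlinarith [Nat.zero_le (n ^ 3)]
    omega
  rw [hsum]
  set T := (2 * n + 4) + (16 + ((8 * n + 2) + ((n * (4 ^ Q * (24 * n + 28) + 2) + 1) +
    ((3 * n + 2) + 1)))) with hT
  have hT' : (2 ^ q - 1) * (T + 1) + 1 ≤
      2 ^ q * (n * (4 ^ (p + 1) * (24 * n + 28) + 2) + 13 * n + 27) + 1 := by
    refine Nat.add_le_add_right (Nat.mul_le_mul (Nat.sub_le _ _) ?_) 1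
    have : n * (4 ^ Q * (24 * n + 28) + 2) ≤ n * (4 ^ (p + 1) * (24 * n + 28) + 2) := by
      gcongr
      omega
    omega
  refine WP.le (WP.loop (2 ^ q - 1) (fun e s' => Rep F (s'.v .acc) (∑ e' ∈ range e, A e' * B e')) T
    h.tables.N (by omega) (by simpa [hacc] using rep_zero F) fun e he s₁ hf hb h1 => ?_) hT'
  have hd : Data F D S k ord Q i₀ y (s₁.setV .e e) := (h.of_frame hf rfl).setV _ _ rfl
  refine WP.seq (wp_filterWeight hE hq hd rfl) fun s₂ f₂ h2 => ?_
  have d₂ := hd.of_frame f₂ rfl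
  refine WP.seq (wp_edgeFactors hE hq d₂ (f₂.v .e rfl)) fun s₃ f₃ h3 => ?_
  have d₃ := d₂.of_frame f₃ rfl
  refine WP.seq (wp_vertexWeights hE hq d₃ ((f₃.v .e rfl).trans (f₂.v .e rfl)) he hN)
    fun s₄ f₄ h4 => ?_
  have d₄ := d₃.of_frame f₄ rfl
  have hF : Factors F S ord i₀ (F.g ^ (e * (n + 1))) (fun v => y (ord.symm v) * F.g ^ e) s₄ :=
    ⟨by rw [f₄.a .EDG rfl]; exact h3, h4⟩
  refine WP.seq (wp_vertexTables hE hq hQ d₄ hord hF) fun s₅ f₅ h5 => ?_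
  have d₅ := d₄.of_frame f₅ rfl
  refine WP.seq (wp_rootProduct hE hq d₅ h5) fun s₆ f₆ h6 => ?_
  have d₆ := d₅.of_frame f₆ rfl
  -- A root has no later neighbours, so its message is constant; the entry with code `0` corresponds
  -- to the all-zero assignment in `sum_eq`.
  have hAe : (∏ j ∈ range n, if s₅.a .PAR j = n then tableEntry G S (ord i₀) (F.g ^ (e * (n + 1)))
      (fun v => y (ord.symm v) * F.g ^ e) ord (s₄.a .PAR) (s₄.a .SLOT) j 0 else 1) = A e := by
    have hzero : (fun j => digit 0 (s₄.a .SLOT j)) = fun _ => 0 := by funext j; simp [digit]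
    rw [hA]
    simp only
    rw [sum_weight_eq_sum_prod G S (ord i₀) _ _ ord
      (localWeight G S (ord i₀) (F.g ^ (e * (n + 1))) (fun v => y (ord.symm v) * F.g ^ e) ord) ?_,
      (scheme_localWeight d₄.slots hord _ _ _).sum_eq, f₅.a .PAR rfl]
    · simp only [tableEntry, hzero]
    · intro i σ _
      rw [localWeight, dif_pos i.2]
  rw [hAe] at h6
  have eacc : s₆.v .acc = s₁.v .acc :=
    (f₆.v .acc rfl).trans <| (f₅.v .acc rfl).trans <| (f₄.v .acc rfl).trans <|
      (f₃.v .acc rfl).trans (f₂.v .acc rfl)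
  have ehs : s₆.v .hs = s₂.v .hs := (f₆.v .hs rfl).trans <| (f₅.v .hs rfl).trans <|
    (f₄.v .hs rfl).trans (f₃.v .hs rfl)
  rw [← ehs] at h2
  rw [← eacc] at h1
  have h7 := rep_xor h1 (d₆.tables.rep_mul h6 h2)
  rw [sum_range_succ]
  exact WP.set _ rfl (h7.1.trans hq) (by simpa using h7)

/-- The initial state. -/
def start (c : ℕ → Bool) : St := ⟨fun _ => 0, fun _ _ => 0, c⟩

/-- The state after the preparation. -/
def Prepared (D : TreeDecomposition G m) (S : Finset (Fin n)) (k p q : ℕ) (s : St) : Prop :=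
  ∃ (K : Type) (_ : Field K) (_ : Fintype K) (_ : CharP K 2) (F : Repr K (2 ^ q))
    (ord : Fin n ≃ Fin n) (Q : ℕ) (i₀ : Fin n), Q ≤ p + 1 ∧ ord i₀ ∈ S ∧
    (∀ i j j', i < j → i < j' → D.Share (ord i) (ord j) → D.Share (ord i) (ord j') →
      D.Share (ord j) (ord j')) ∧ Data F D S k ord Q i₀ (fun _ => 0) s

theorem wp_preparation (hE : Room E n m k p) (hI : Input E G D S k) (hS : S.Nonempty)
    (hp : D.width ≤ p) (c : ℕ → Bool) :
    WP E preparation (500 * ((n + 2) ^ 3) ^ 2 + 4 * m + 2 * p +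
      20 * (m * (p + 1) + n * (p + 1) ^ 2)) (fun s =>
      ∃ q, 1 ≤ q ∧ s.v .q = q ∧ (n + 2) ^ 3 < 2 ^ q ∧ 2 ^ q ≤ 2 * (n + 2) ^ 3 ∧
        Prepared D S k p q s) (start c) := by
  have hcube := hE.cube
  set C := (n + 2) ^ 3 with hC
  have hT : 4 + ((4 * C + 5) + ((4 * m + 2) +
      ((20 * (m * (p + 1) + n * (p + 1) ^ 2) + 1) + (16 * (n + 1) ^ 4 + (6 * (n + 1) ^ 2 +
      (20 * (n + 1) ^ 3 + ((2 * p + 5) + ((2 * C * (6 * (2 * C) + 6) + 1) + ((12 * (2 * C) + 3) +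
      (5 * n + 5)))))))))) ≤ 500 * C ^ 2 + 4 * m + 2 * p +
      20 * (m * (p + 1) + n * (p + 1) ^ 2) := by
    have h0 : 8 ≤ C := Nat.pow_le_pow_left (show 2 ≤ n + 2 by omega) 3
    have h1 : (n + 1) ^ 4 ≤ C ^ 2 := by
      rw [hC, ← pow_mul]
      exact (Nat.pow_le_pow_left (by omega) 4).trans (Nat.pow_le_pow_right (by omega) (by omega))
    have h2 : (n + 1) ^ 2 ≤ C :=
      (Nat.pow_le_pow_left (by omega) 2).trans (Nat.pow_le_pow_right (by omega) (by omega))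
    have h3 : (n + 1) ^ 3 ≤ C := Nat.pow_le_pow_left (by omega) 3
    have h4 : n ≤ C := by nlinarith [Nat.zero_le (n ^ 3)]
    clear_value C
    nlinarith
  refine WP.le ?_ hT
  refine WP.seq (wp_header hI _) fun s₁ f₁ ⟨h₁, hroot⟩ => ?_
  refine WP.seq (wp_fieldSize hE h₁) fun s₂ f₂ ⟨q, hq1, hq, hfs, hN, hlt, hle⟩ => ?_
  have h₂ := h₁.of_frame f₂ rfl rfl rfl
  have f₂' := f₁.trans f₂
  have hqB : 4 * 2 ^ q < E.B := by omega
  refine WP.seq (wp_bagPointers hE hI h₂) fun s₃ f₃ hptr => ?_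
  have h₃ := h₂.of_frame f₃ rfl rfl rfl
  have f₃' := f₂'.trans f₃
  refine WP.seq (wp_completion hE hI hp h₃ ((f₂.trans f₃).v .root rfl ▸ hroot) hptr
    (fun a => congrFun (f₃'.a .MARK rfl) a) (fun a => congrFun (f₃'.a .H rfl) a)) fun s₄ f₄ hH => ?_
  have h₄ := h₃.of_frame f₄ rfl rfl rfl
  have f₄' := f₃'.trans f₄
  have hH : Completed D (s₄.a .H) := fun u v =>
    ⟨fun h => by rw [hH, if_pos h], fun h => by rw [hH, if_neg h]⟩
  refine WP.seq (wp_elimination hE h₄ hH fun a => congrFun (f₄'.a .DEAD rfl) a)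
    fun s₅ f₅ ⟨ord, hord, hperfect⟩ => ?_
  have h₅ := h₄.of_frame f₅ rfl rfl rfl
  have f₅' := f₄'.trans f₅
  have hH₅ : Completed D (s₅.a .H) := by rwa [f₅.a .H rfl]
  refine WP.seq (wp_laterMatrices hE hI h₅ hH₅ hord) fun s₆ f₆ hl => ?_
  have h₆ := h₅.of_frame f₆ rfl rfl rfl
  have f₆' := f₅'.trans f₆
  refine WP.seq (wp_slots hE hp h₆ (f₆'.v .Q rfl) hl hperfect) fun s₇ f₇ ⟨Q, hQp, hQ, hslots⟩ => ?_
  have h₇ := h₆.of_frame f₇ rfl rfl rfl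
  refine WP.seq (wp_powers hE hQ hQp) fun s₈ f₈ ⟨hpw, hts⟩ => ?_
  have h₈ := h₇.of_frame f₈ rfl rfl rfl
  have g₈ := f₃.trans <| f₄.trans <| f₅.trans <| f₆.trans <| f₇.trans f₈
  have f₈' := (f₆'.trans f₇).trans f₈
  have hfs₈ : s₈.v .fs = 2 ^ q := (g₈.v .fs rfl).trans hfs
  have hN₈ : s₈.v .N = 2 ^ q - 1 := (g₈.v .N rfl).trans hN
  refine WP.seq (WP.le (wp_findPolynomial hqB hq1 hfs₈ hN₈) (by gcongr)) fun s₉ f₉ ⟨f, hpol, hf, hf', hfull⟩ => ?_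
  have f₉' := f₈'.trans f₉
  obtain ⟨K, i1, i2, i3, F, hF⟩ := exists_field hq1 hf hf' hfull
  refine WP.seq (WP.le (wp_fieldTables hqB ((f₉.v .fs rfl).trans hfs₈) ((f₉.v .N rfl).trans hN₈)
    hpol hf hf' F hF fun a => congrFun (f₉'.a .EXP rfl) a) (by gcongr)) fun s₁₀ f₁₀ htab => ?_
  have h₁₀ := (h₈.of_frame f₉ rfl rfl rfl).of_frame f₁₀ rfl rfl rfl
  have g₁₀ := f₆.trans <| f₇.trans <| f₈.trans <| f₉.trans f₁₀
  refine WP.mono (wp_sources hE hI hS h₁₀ fun i => (congrFun (g₁₀.a .ORD rfl) i).trans (hord i))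
    le_rfl fun s₁₁ f₁₁ _ ⟨hSB, ⟨i₀, hi₀, hi₀S⟩, hkk⟩ => ?_
  have r₈ := f₉.trans <| f₁₀.trans f₁₁
  have r₇ := f₈.trans r₈
  have r₆ := f₇.trans r₇
  obtain ⟨l1, l2⟩ := hl
  obtain ⟨t1, t2, t3, t4, t5, t6⟩ := hslots
  rw [← r₆.a .HO rfl] at l1
  rw [← r₆.a .GO rfl] at l2
  simp only [← r₇.a .SLOT rfl, ← r₇.a .PAR rfl] at t1 t2 t3 t4 t5 t6
  rw [← r₈.a .PW rfl] at hpw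
  refine ⟨q, hq1, ((g₈.trans r₈).v .q rfl).trans hq, hlt, hle, K, i1, i2, i3, F, ord, Q, i₀, hQp,
    hi₀S, hperfect, h₁₀.of_frame f₁₁ rfl rfl rfl, htab.of_frame f₁₁ rfl rfl rfl, ⟨l1, l2⟩,
    ⟨t1, t2, t3, t4, t5, t6⟩, hpw, (r₈.v .TS rfl).trans hts, fun i => ?_, hSB, hi₀, hkk⟩
  -- No random elements have been drawn yet; the untouched array represents the zero point, which is
  -- why `Prepared` speaks of it.
  have : s₁₁.a .X i = 0 := congrFun (((f₉'.trans f₁₀).trans f₁₁).a .X rfl) i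
  rw [this]
  exact ⟨by positivity, F.val_zero⟩

/-- The algorithm answers YES if and only if the polynomial of the solutions does not vanish at
the random point. -/
theorem wp_algorithm (hE : Room E n m k p) (hI : Input E G D S k) (hS : S.Nonempty)
    (hp : D.width ≤ p) : ∃ (q : ℕ) (K : Type) (_ : Field K) (_ : Fintype K) (F : Repr K (2 ^ q))
    (ord : Fin n ≃ Fin n), 2 * n ≤ 2 ^ q ∧ ∀ c, WP E algorithm
      (500 * ((n + 2) ^ 3) ^ 2 + 4 * m + 2 * p + 20 * (m * (p + 1) + n * (p + 1) ^ 2) +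
        (n * (3 * (2 * (n + 2) ^ 3) + 4) + 1 + (2 * (n + 2) ^ 3 *
        (n * (4 ^ (p + 1) * (24 * n + 28) + 2) + 13 * n + 27) + 1 + 1))) (fun s =>
      s.v .ans = 1 ↔ MvPolynomial.eval (RandomBits.elements F.val n q c)
        (solutionPoly K G S k ord) ≠ 0) (start c) := by
  have hcube := hE.cube
  have hb : ∀ c, Bdd E (start c) := fun c => ⟨fun _ => by positivity, fun _ _ => by positivity⟩
  obtain ⟨-, -, q, hq1, hq, hlt, hle, K, i1, i2, i3, F, ord, Q, i₀, hQ, hi₀, hord, hd⟩ :=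
    wp_preparation hE hI hS hp (fun _ => false) (hb _)
  have hqB : 2 ^ q < E.B := by omega
  have hn : 2 * n ≤ (n + 2) ^ 3 := by nlinarith [Nat.zero_le (n ^ 3)]
  refine ⟨q, K, i1, i2, F, ord, by omega, fun c => ?_⟩
  -- The field, its representation and the order are extracted from one run with arbitrary bits.
  -- They must not depend on `c`, since the probability is estimated for one fixed polynomial and
  -- one fixed field.
  have hrun : run E preparation (start c) =
      { run E preparation (start fun _ => false) with coins := c } :=
    run_coins (s := start fun _ => false) (c := c) (by decide)
  generalize run E preparation (start fun _ => false) = s at hq hd hrun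
  refine WP.seq (R := fun s' => s' = { s with coins := c }) (fun hb => ?_) fun s₁ f₁ h₁ => ?_
  · obtain ⟨h1, h2, -⟩ := wp_preparation hE hI hS hp c hb
    exact ⟨h1, h2, hrun⟩
  have hd₁ : Data F D S k ord Q i₀ (fun _ => 0) s₁ := by
    subst h₁
    exact hd.of_frame (P := .skip) ⟨fun _ _ => rfl, fun _ _ => rfl⟩ rfl
  have hq₁ : s₁.v .q = q := by rw [h₁]; exact hq
  have hc₁ : s₁.coins = c := by rw [h₁]
  have hqC : q ≤ 2 * (n + 2) ^ 3 := q.lt_two_pow_self.le.trans hle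
  refine WP.seq (WP.le (wp_randomElements hE hd₁.header hq₁ hqB) (by gcongr)) fun s₂ f₂ h₂ => ?_
  rw [hc₁] at h₂
  have hd₂ : Data F D S k ord Q i₀ (RandomBits.elements F.val n q c) s₂ := by
    obtain ⟨d1, d2, ⟨d3, d3'⟩, ⟨d4, d5, d6, d7, d8, d9⟩, d10, d11, -, d13, d14, d15⟩ := hd₁
    rw [← f₂.a .HO rfl] at d3
    rw [← f₂.a .GO rfl] at d3'
    simp only [← f₂.a .SLOT rfl, ← f₂.a .PAR rfl] at d4 d5 d6 d7 d8 d9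
    rw [← f₂.a .PW rfl] at d10
    rw [← f₂.a .SB rfl] at d13
    refine ⟨d1.of_frame f₂ rfl rfl rfl, d2.of_frame f₂ rfl rfl rfl, ⟨d3, d3'⟩,
      ⟨d4, d5, d6, d7, d8, d9⟩, d10, (f₂.v _ rfl).trans d11, fun i => ?_, d13,
      (f₂.v _ rfl).trans d14, (f₂.v _ rfl).trans d15⟩
    rw [h₂ i i.2]
    exact ⟨RandomBits.bitsVal_lt _ _, rfl⟩
  refine WP.seq (WP.le (wp_mainLoop hE hqB hq1 hlt hQ hd₂ hord hi₀ ((f₁.trans f₂).v .acc rfl))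
    (by gcongr)) fun s₃ f₃ h₃ => ?_
  have hsum := hE.sum
  have hans : Expr.eval s₃ (.lt 0 (.var .acc)) = if 0 < s₃.v .acc then 1 else 0 := rfl
  refine WP.set _ hans (by split_ifs <;> omega) ?_
  have hacc : s₃.v .acc = 0 ↔ MvPolynomial.eval (RandomBits.elements F.val n q c)
      (solutionPoly K G S k ord) = 0 := by
    rw [← h₃.2, ← F.val_zero, F.val_inj h₃.1 (by positivity)]
  rw [setV_v, if_pos rfl, Ne, ← hacc]
  split_ifs with h0 <;> simp <;> omega

end Loop

/-! ### The theorem -/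

namespace Loop

open WordRAM ShiftRegister CutCount

/-- The program that puts the address of the first cell after the input, or a larger one, into
register `1`. -/
def basePrefix : Program :=
  .seq (.const 3 0) <| .seq (.load 5 3) <| .seq (.const 3 1) <| .seq (.load 7 3) <|
  .seq (.op .mul 1 5 5) <| .seq (.op .add 1 1 5) <| .seq (.op .add 1 1 7) <|
  .seq (.op .add 5 5 3) <| .seq (.op .mul 5 5 7) <| .seq (.op .add 1 1 5) <|
  .seq (.const 3 4) <| .op .add 1 1 3

/-- Only odd registers are written, so all variables keep their initial value; the temporaries may
be left dirty. -/
theorem exec_basePrefix {w n m : ℕ} {σ : Config} (h0 : σ.mem 0 = n) (h1 : σ.mem 1 = m)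
    (hw : 4 + n * n + n + m + m * (n + 1) < 2 ^ w) :
    ∃ r : ℕ → ℕ, Exec w basePrefix σ 12 { σ with reg := r } ∧
      r 1 = 4 + n * n + n + m + m * (n + 1) ∧ ∀ x, r (2 * x) = σ.reg (2 * x) := by
  have hmn : (n + 1) * m = m * (n + 1) := mul_comm _ _
  have h2 : n + 1 ≤ 4 + n * n + n + m + m * (n + 1) := by omega
  refine ⟨_, .seq (exec_const σ (by omega)) <| .seq (.load _ _ _) <|
    .seq (exec_const σ (by omega)) <| .seq (.load _ _ _) <|
    .seq (exec_op σ (a := n) (b := n) ?_ ?_ ?_) <|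
    .seq (exec_op σ (a := n * n) (b := n) ?_ ?_ ?_) <|
    .seq (exec_op σ (a := n * n + n) (b := m) ?_ ?_ ?_) <|
    .seq (exec_op σ (a := n) (b := 1) ?_ ?_ ?_) <|
    .seq (exec_op σ (a := n + 1) (b := m) ?_ ?_ ?_) <|
    .seq (exec_op σ (a := n * n + n + m) (b := (n + 1) * m) ?_ ?_ ?_) <|
    .seq (exec_const σ (by omega)) <|
    exec_op σ (a := n * n + n + m + (n + 1) * m) (b := 4) ?_ ?_ ?_, ?_, fun x => ?_⟩
  all_goals simp only [BinOp.eval]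
  all_goals first
    | omega
    | simp [Function.update_apply, h0, h1]
  all_goals first
    | omega
    | (split_ifs <;> first | rfl | omega)

/-- The program of a statement. -/
def program (A : Stmt) : Program := .seq basePrefix (A.compile 0)

/-- The constant of the time bound and of the word length. -/
def constant (A : Stmt) : ℕ := 16 * A.deg + 1000000 * A.slowdown + 12

/-- The number of bits of the values of the algorithm. -/
def bits (p l : ℕ) : ℕ := 2 * p + 4 + (4 * l + 8)

/-- With `X = 2 ^ l > n + m + k`, all required bounds are below `4 ^ (p + 2) * 256 * X ^ 4`, whose
binary logarithm is `bits p l`. Since `l ≥ 1`, the additive constants are absorbed by the factor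
`16`. -/
theorem bits_spec {n m k p : ℕ} (hn : 1 ≤ n) :
    8 * (n + 2) ^ 3 < 2 ^ bits p (Nat.size (n + m + k)) ∧
    4 + n * n + n + m + m * (n + 1) + n + m + k + 3 < 2 ^ bits p (Nat.size (n + m + k)) ∧
    4 ^ (p + 2) < 2 ^ bits p (Nat.size (n + m + k)) ∧
    bits p (Nat.size (n + m + k)) ≤ 16 * (p + Nat.size (n + m + k)) := by
  have hX := Nat.lt_size_self (n + m + k)
  have hl : 1 ≤ Nat.size (n + m + k) := Nat.size_pos.2 (by omega)
  generalize Nat.size (n + m + k) = l at *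
  have e : 2 ^ bits p l = 2 ^ (2 * p + 4) * ((2 ^ l) ^ 4 * 256) := by
    rw [bits, pow_add _ (2 * p + 4), pow_add _ (4 * l), ← pow_mul, mul_comm l]
    norm_num
  have e4 : 4 ^ (p + 2) = 2 ^ (2 * p + 4) := by
    rw [show 2 * p + 4 = 2 * (p + 2) by ring, pow_mul]
    norm_num
  rw [e, e4]
  have hp : 1 ≤ 2 ^ (2 * p + 4) := Nat.one_le_two_pow
  generalize 2 ^ (2 * p + 4) = P at *
  generalize 2 ^ l = X at *
  have hX4 : X ^ 4 * 256 ≤ P * (X ^ 4 * 256) := Nat.le_mul_of_pos_left _ hp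
  have h34 : X ^ 3 ≤ X ^ 4 := Nat.pow_le_pow_right (by omega) (by omega)
  have h24 : X ^ 2 ≤ X ^ 4 := Nat.pow_le_pow_right (by omega) (by omega)
  have h14 : X ≤ X ^ 4 := Nat.le_self_pow (by omega) _
  have h1 : 1 ≤ X ^ 4 := Nat.one_le_pow _ _ (by omega)
  refine ⟨lt_of_lt_of_le ?_ hX4, lt_of_lt_of_le ?_ hX4, ?_, by rw [bits]; omega⟩
  · have : (n + 2) ^ 3 ≤ (2 * X) ^ 3 := Nat.pow_le_pow_left (by omega) 3
    rw [mul_pow] at this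
    omega
  · have e1 : n * n ≤ X ^ 2 := by rw [sq]; exact Nat.mul_le_mul (by omega) (by omega)
    have e2 : m * (n + 1) ≤ X ^ 2 := by rw [sq]; exact Nat.mul_le_mul (by omega) (by omega)
    omega
  · exact lt_mul_of_one_lt_right hp (by omega)

/-- Because `n ≥ 1`, every polynomial in `n` is bounded by a multiple of its leading power. The main
loop is of order `4 ^ p * n ^ 5`, the search for the field of order `n ^ 6`, and `p + 1 ≤ 4 ^ p`
absorbs the square in the cost of the cliques. -/
theorem time_le {n m p : ℕ} (hn : 1 ≤ n) :
    500 * ((n + 2) ^ 3) ^ 2 + 4 * m + 2 * p + 20 * (m * (p + 1) + n * (p + 1) ^ 2) +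
        (n * (3 * (2 * (n + 2) ^ 3) + 4) + 1 + (2 * (n + 2) ^ 3 *
        (n * (4 ^ (p + 1) * (24 * n + 28) + 2) + 13 * n + 27) + 1 + 1)) ≤
      1000000 * (4 ^ p * (p + 1) * n ^ 6 + (p + 1) * m) := by
  have hc : (n + 2) ^ 3 ≤ 27 * n ^ 3 := by
    calc (n + 2) ^ 3 ≤ (3 * n) ^ 3 := Nat.pow_le_pow_left (by omega) 3
      _ = 27 * n ^ 3 := by ring
  have hp : p + 1 ≤ 4 ^ p := Nat.succ_le_of_lt (Nat.lt_pow_self (by omega))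
  have hpow : ∀ i ≤ 6, n ^ i ≤ n ^ 6 := fun i hi => Nat.pow_le_pow_right hn hi
  have hn1 : n ≤ n ^ 6 := Nat.le_self_pow (by omega) _
  have hA : n ^ 6 * 4 ^ p ≤ 4 ^ p * (p + 1) * n ^ 6 := by
    rw [mul_comm]; gcongr; exact Nat.le_mul_of_pos_right _ (by omega)
  have hA' : n ^ 6 ≤ n ^ 6 * 4 ^ p := Nat.le_mul_of_pos_right _ (by positivity)
  have h1 : ((n + 2) ^ 3) ^ 2 ≤ 729 * n ^ 6 := by
    calc ((n + 2) ^ 3) ^ 2 ≤ (27 * n ^ 3) ^ 2 := Nat.pow_le_pow_left hc 2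
      _ = 729 * n ^ 6 := by ring
  have h2 : n * (p + 1) ^ 2 ≤ 4 ^ p * (p + 1) * n ^ 6 := by
    calc n * (p + 1) ^ 2 = (p + 1) * (p + 1) * n := by ring
      _ ≤ _ := by gcongr
  have h3 : p ≤ 4 ^ p * (p + 1) * n ^ 6 := by
    have : 4 ^ p * (p + 1) * 1 ≤ 4 ^ p * (p + 1) * n ^ 6 := by gcongr; omega
    nlinarith
  have h4 : n * (3 * (2 * (n + 2) ^ 3) + 4) ≤ 166 * n ^ 6 := by
    calc n * (3 * (2 * (n + 2) ^ 3) + 4) ≤ n * (3 * (2 * (27 * n ^ 3)) + 4) := by gcongr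
      _ = 162 * n ^ 4 + 4 * n ^ 1 := by ring
      _ ≤ 162 * n ^ 6 + 4 * n ^ 6 := by gcongr <;> omega
      _ = 166 * n ^ 6 := by ring
  have h5 : 2 * (n + 2) ^ 3 * (n * (4 ^ (p + 1) * (24 * n + 28) + 2) + 13 * n + 27) ≤
      54 * 250 * (n ^ 6 * 4 ^ p) := by
    have : n * (4 ^ (p + 1) * (24 * n + 28) + 2) + 13 * n + 27 ≤ 250 * n ^ 2 * 4 ^ p := by
      have a1 : 1 ≤ 4 ^ p := Nat.one_le_pow _ _ (by omega)
      have a2 : n ≤ n ^ 2 := Nat.le_self_pow (by omega) _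
      have a3 : n ^ 2 ≤ n ^ 2 * 4 ^ p := Nat.le_mul_of_pos_right _ a1
      calc n * (4 ^ (p + 1) * (24 * n + 28) + 2) + 13 * n + 27
          ≤ n * (4 ^ (p + 1) * (24 * n + 28 * n) + 2) + 13 * n + 27 * n := by gcongr <;> omega
        _ = 208 * (n ^ 2 * 4 ^ p) + 42 * n := by ring
        _ ≤ 208 * (n ^ 2 * 4 ^ p) + 42 * (n ^ 2 * 4 ^ p) := by gcongr; omega
        _ = 250 * n ^ 2 * 4 ^ p := by ring
    calc _ ≤ 2 * (27 * n ^ 3) * (250 * n ^ 2 * 4 ^ p) := by gcongr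
      _ = 54 * 250 * (n ^ 5 * 4 ^ p) := by ring
      _ ≤ _ := by gcongr; omega
  have h6 : m * (p + 1) = (p + 1) * m := mul_comm _ _
  have h7 : m ≤ (p + 1) * m := Nat.le_mul_of_pos_left _ (by omega)
  have h8 : 1 ≤ n ^ 6 := Nat.one_le_pow _ _ hn
  omega

theorem Stmt.one_le_deg (P : Stmt) : 1 ≤ P.deg := by
  induction P <;> simp only [Stmt.deg] <;> omega

/-- Passing from the simple language to the machine. -/
theorem Stmt.exists_answers (A : Stmt) {n m k p : ℕ} {G : SimpleGraph (Fin n)}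
    (D : TreeDecomposition G m) {S : Finset (Fin n)} (hS : S.Nonempty)
    {good : ((ℕ → Bool) → Prop) → Prop} {T : ℕ}
    (hT : T ≤ 1000000 * (4 ^ p * (p + 1) * n ^ 6 + (p + 1) * m))
    (hA : ∀ E, Room E n m k p → Input E G D S k → ∃ yes, good yes ∧ ∀ c,
      WP E A T (fun s => s.v .ans = 1 ↔ yes c) (start c)) {w : ℕ}
    (hw : w = constant A * (p + Nat.size (n + m + k))) :
    ∃ yes, good yes ∧ ∀ c, ∃ t ≤ constant A * (4 ^ p * (p + 1) * n ^ 6 + (p + 1) * m),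
      ∃ b : Bool, Answers w (program A) (encodeInstance G D S k) c t b ∧ (b = true ↔ yes c) := by
  have hn : 1 ≤ n := by
    obtain ⟨v, -⟩ := hS
    exact v.pos
  obtain ⟨hcube, hsum, hpow, hb⟩ := bits_spec (n := n) (m := m) (k := k) (p := p) hn
  set l := Nat.size (n + m + k) with hl
  have hB : (2 ^ bits p l) ^ A.deg ≤ 2 ^ w := by
    rw [← pow_mul, hw]
    refine Nat.pow_le_pow_right (by omega) ?_
    calc bits p l * A.deg ≤ 16 * (p + l) * A.deg := Nat.mul_le_mul_right _ hb
      _ = 16 * A.deg * (p + l) := by ring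
      _ ≤ constant A * (p + l) := by gcongr; rw [constant]; omega
  have hdeg : 1 ≤ A.deg := A.one_le_deg
  have hB1 : 2 ^ bits p l ≤ 2 ^ w := (Nat.le_self_pow (by omega) _).trans hB
  obtain ⟨E, hEb, hbase, hEI⟩ : ∃ E : Env, E.b = bits p l ∧
      E.base = 4 + n * n + n + m + m * (n + 1) ∧
      ∀ i, E.I i = (encodeInstance G D S k).getD i 0 := ⟨{
      b := bits p l
      base := 4 + n * n + n + m + m * (n + 1)
      I := fun i => (encodeInstance G D S k).getD i 0
      I_lt := fun i => by
        rw [List.getD_eq_getElem?_getD]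
        by_cases hi : i < (encodeInstance G D S k).length
        · rw [List.getElem?_eq_getElem hi, Option.getD_some]
          have := mem_encodeInstance_le D S k (List.getElem_mem hi)
          omega
        · rw [List.getElem?_eq_none (by omega), Option.getD_none]
          positivity
      b_pos := by rw [bits]; omega
      base_lt := by omega }, rfl, rfl, fun _ => rfl⟩
  rw [← hEb] at hcube hsum hpow hB hB1
  rw [← hbase] at hsum
  have hle : D.bagOffset m ≤ E.base := D.bagOffset_le.trans hbase.ge
  have hE : Room E n m k p := ⟨hcube, hsum, hpow⟩
  have hI : Input E G D S k := input_encodeInstance D S k hEI hle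
  obtain ⟨yes, hyes, hrun⟩ := hA E hE hI
  refine ⟨yes, hyes, fun c => ?_⟩
  obtain ⟨hok, hcost, hans⟩ := hrun c ⟨fun _ => by positivity, fun _ _ => by positivity⟩
  obtain ⟨r, hr, hr1, hr2⟩ := exec_basePrefix (w := w) (n := n) (m := m)
    (σ := initial (encodeInstance G D S k) c) (by simp [initial, encodeInstance])
    (by simp [initial, encodeInstance]) (by omega)
  have hsim : Sim E (start c) { initial (encodeInstance G D S k) c with reg := r } := by
    refine ⟨fun x => hr2 _, fun a i => ?_, fun i _ => (hEI i).symm, hr1.trans hbase.symm,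
      rfl⟩
    -- The arrays begin at or beyond the end of the input, where memory is zero, as the initial
    -- state demands.
    exact List.getD_eq_default _ _ ((length_encodeInstance D S k).trans_le (by omega))
  obtain ⟨t, σ, hσ, ht, hsim', -⟩ := A.simulates_compile hB 0
    ⟨fun _ => by positivity, fun _ _ => by positivity⟩ hok hsim
  refine ⟨12 + t, ?_, _, ⟨σ, hr.seq hσ, rfl⟩, ?_⟩
  · have h1 := ht.trans (Nat.mul_le_mul_left _ (hcost.trans hT))
    have h2 : 1 ≤ 4 ^ p * (p + 1) * n ^ 6 + (p + 1) * m :=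
      Nat.one_le_iff_ne_zero.2 (by positivity)
    rw [constant]
    generalize 4 ^ p * (p + 1) * n ^ 6 + (p + 1) * m = Y at *
    nlinarith [Nat.zero_le (A.deg * Y)]
  -- The variable `ans` comes first in `Var`, so it is stored in register `0`, from which the answer
  -- is read.
  · rw [decide_eq_true_iff, show σ.reg 0 = _ from hsim'.reg .ans]
    exact hans

/-- The correctness of the algorithm. -/
theorem algorithm_correct {n m k p : ℕ} {G : SimpleGraph (Fin n)} {D : TreeDecomposition G m}
    {S : Finset (Fin n)} (hS : S.Nonempty) (hp : p = D.width) {E : Env} (hE : Room E n m k p)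
    (hI : Input E G D S k) : ∃ yes : (ℕ → Bool) → Prop,
      (((¬ ∃ F, IsConstrainedCVCP3Solution G S k F) → ∀ c, ¬ yes c) ∧
        ((∃ F, IsConstrainedCVCP3Solution G S k F) → fairCoins {c | ¬ yes c} ≤ 1 / 2)) ∧
      ∀ c, WP E algorithm
        (500 * ((n + 2) ^ 3) ^ 2 + 4 * m + 2 * p + 20 * (m * (p + 1) + n * (p + 1) ^ 2) +
        (n * (3 * (2 * (n + 2) ^ 3) + 4) + 1 + (2 * (n + 2) ^ 3 *
        (n * (4 ^ (p + 1) * (24 * n + 28) + 2) + 13 * n + 27) + 1 + 1)))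
        (fun s => s.v .ans = 1 ↔ yes c) (start c) := by
  obtain ⟨q, K, _, _, F, ord, hq, h⟩ := wp_algorithm hE hI hS hp.ge
  refine ⟨_, ⟨fun hno c hc => ?_, fun hyes => ?_⟩, h⟩
  · refine hc ?_
    rw [eval_solutionPoly]
    exact Finset.sum_eq_zero fun F _ => if_neg fun hF => hno ⟨F, hF⟩
  · simp only [ne_eq, not_not]
    exact RandomBits.fairCoins_eval_eq_zero_le F.val_bij F.card hq
      (solutionPoly_ne_zero G S k ord hyes) (totalDegree_solutionPoly_le G S k ord)

end Loop

theorem theorem3 :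
    ∃ (P : WordRAM.Program) (C : ℕ),
      ∀ (n m k : ℕ) (G : SimpleGraph (Fin n)) (D : TreeDecomposition G m) (S : Finset (Fin n))
        (p w : ℕ),
        S.Nonempty → p = D.width → w = C * (p + Nat.size (n + m + k)) →
        -- running time: the program halts for all outcomes of the random bits
        (∀ coins : ℕ → Bool, ∃ (t : ℕ) (b : Bool),
          WordRAM.Answers w P (encodeInstance G D S k) coins t b ∧
            t ≤ C * (4 ^ p * (p + 1) * n ^ 6 + (p + 1) * m)) ∧
        -- no false positives
        ((¬ ∃ F : Finset (Fin n), IsConstrainedCVCP3Solution G S k F) →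
          ∀ (coins : ℕ → Bool) (t : ℕ),
            ¬ WordRAM.Answers w P (encodeInstance G D S k) coins t true) ∧
        -- false negatives with probability at most one half
        ((∃ F : Finset (Fin n), IsConstrainedCVCP3Solution G S k F) →
          WordRAM.fairCoins
            {coins | ∃ t : ℕ, WordRAM.Answers w P (encodeInstance G D S k) coins t false} ≤
              1 / 2) := by
  refine ⟨Loop.program Loop.algorithm, Loop.constant Loop.algorithm, fun n m k G D S p w hS hp hw => ?_⟩
  have hn : 1 ≤ n := hS.elim fun v _ => v.pos
  obtain ⟨yes, ⟨hno, hyes⟩, h⟩ := Loop.Stmt.exists_answers Loop.algorithm D hS (Loop.time_le hn)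
    (fun E hE hI => Loop.algorithm_correct hS hp hE hI) hw
  refine ⟨fun c => ?_, fun hno' c t ht => ?_, fun hyes' => ?_⟩
  · obtain ⟨t, ht, b, hb, -⟩ := h c
    exact ⟨t, b, hb, ht⟩
  · obtain ⟨t', -, b, hb, hiff⟩ := h c
    exact hno hno' c (hiff.1 (hb.deterministic ht))
  -- By determinism, random bits with the answer NO fail to satisfy `yes`, so monotonicity of the
  -- measure suffices.
  · refine le_trans (MeasureTheory.measure_mono ?_) (hyes hyes')
    rintro c ⟨t, ht⟩ hc
    obtain ⟨t', -, b, hb, hiff⟩ := h c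
    exact Bool.false_ne_true ((ht.deterministic hb).trans (hiff.2 hc))
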